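/- Let $\mathbb C$ be a $\tau$-pretopos, i.e. a Barr-exact, finitary extensive category with finite coproducts in which every relation $R\rightarrowtail A\times A$ has a transitive closure (a smallest transitive relation containing it). Let $\mathsf{PreOrd}(\mathbb C)$ be the category of internal preorders in $\mathbb C$, let $\mathsf{Eq}(\mathbb C)$ and $\mathsf{ParOrd}(\mathbb C)$ be the full subcategories of equivalence relations and of partial orders, and let $\mathcal Z=\mathsf{Eq}(\mathbb C)\cap\mathsf{ParOrd}(\mathbb C)$. A morphism is $\mathcal Z$-trivial if it factors through an object of $\mathcal Z$; $\mathcal Z$-kernels, $\mathcal Z$-cokernels and short $\mathcal Z$-exact sequences are defined like kernels, cokernels and short exact sequences, with $\mathcal Z$-trivial morphisms in place of zero morphisms. A pair $(\mathcal T,\mathcal F)$ of replete full subcategories of a category is a pretorsion theory if every morphism from an object of $\mathcal T$ to an object of $\mathcal F$ is $(\mathcal T\cap\mathcal F)$-trivial and every object $A$ has a short $(\mathcal T\cap\mathcal F)$-exact sequence $T_A\to A\to F_A$ with $T_A\in\mathcal T$, $F_A\in\mathcal F$; a torsion theory in a pointed category is defined in the same way with zero morphisms and short exact sequences. A torsion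 theory functor from a category with a pretorsion theory to a pointed category with a torsion theory is a functor that sends the two subcategories into the corresponding ones and sends the sequences $T_A\to A\to F_A$ to short exact sequences. The stable category $\mathsf{Stab}(\mathbb C)$ has as objects the internal preorders. Its morphisms $A\to B$ are represented by partial morphisms $A\xleftarrow{\alpha}A'\xrightarrow{f}B$ with $\alpha$ a complemented subobject in $\mathsf{PreOrd}(\mathbb C)$, where $(\alpha_1,f_1)$ and $(\alpha_2,f_2)$ are identified when there is a subobject $A_0$ complemented in both domains, compatibly with their inclusions into $A$, on which $f_1$ and $f_2$ agree and on whose complements in the two domains $f_1$ and $f_2$ are $\mathcal Z$-trivial. Composition is by pullback. Let $\Sigma\colon\mathsf{PreOrd}(\mathbb C)\to\mathsf{Stab}(\mathbb C)$ be the canonical functor. Binary coproducts are disjoint if the coprojections are monomorphisms and the pullback of $A\to A\sqcup B\leftarrow B$ exists and is initial. They are pre-universal if for every $f\colon S\to A\sqcup B$ there are a coproduct decomposition $A'\xrightarrow{i}S\xleftarrow{j}B'$ and morphisms $f_A\colon A'\to A$, $f_B\colon B'\to B$ such that $fi=s_Af_A$ and $fj=s_Bf_B$, where $s_A,s_B$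 are the coprojections of $A\sqcup B$. Then $\Sigma$ is universal among the finite coproduct preserving torsion theory functors from $(\mathsf{PreOrd}(\mathbb C),\mathsf{Eq}(\mathbb C),\mathsf{ParOrd}(\mathbb C))$ to pointed categories that have a torsion theory and disjoint, pre-universal binary coproducts. That is: 1. $(\mathsf{Eq}(\mathbb C),\mathsf{ParOrd}(\mathbb C))$ is a pretorsion theory in $\mathsf{PreOrd}(\mathbb C)$ and a torsion theory in the pointed category $\mathsf{Stab}(\mathbb C)$, $\mathsf{Stab}(\mathbb C)$ has disjoint and pre-universal binary coproducts, and $\Sigma$ is a finite coproduct preserving torsion theory functor. 2. Let $\mathbb X$ be a pointed category with a torsion theory $(\mathcal T,\mathcal F)$ and with binary coproducts that are disjoint and pre-universal, and let $G\colon\mathsf{PreOrd}(\mathbb C)\to\mathbb X$ be a finite coproduct preserving torsion theory functor. There is a unique functor $\overline G\colon\mathsf{Stab}(\mathbb C)\to\mathbb X$ with $\overline G\,\Sigma=G$, and $\overline G$ preserves finite coproducts and is a torsion theory functor. If moreover $G$ sends $\mathcal Z$-kernels to kernels and $\mathcal Z$-cokernels to cokernels, then $\overline G$ preserves kernels, cokernels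 and short exact sequences. -/

import Mathlib

open CategoryTheory CategoryTheory.Limits

universe v u v' u'

namespace StableCategory

/-! ### Trivial morphisms, relative kernels and cokernels, (pre)torsion theories -/

section General

variable {D : Type u} [Category.{v} D]

/-- A morphism is trivial with respect to a class `Z` of objects if it factors through an object
of `Z`.  When `Z` is the class of zero objects of a pointed category, these are the zero
morphisms. -/
def IsTrivial (Z : ObjectProperty D) {A B : D} (f : A ⟶ B) : Prop :=
  ∃ (W : D) (_ : Z W) (g : A ⟶ W) (h : W ⟶ B), g ≫ h = f

/-- `k` is a `Z`-kernel of `f` (a kernel of `f` when `Z` is the class of zero objects). -/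
def IsKernelRel (Z : ObjectProperty D) {K A B : D} (k : K ⟶ A) (f : A ⟶ B) : Prop :=
  IsTrivial Z (k ≫ f) ∧
    ∀ ⦃Y : D⦄ (l : Y ⟶ A), IsTrivial Z (l ≫ f) → ∃! m : Y ⟶ K, m ≫ k = l

/-- `q` is a `Z`-cokernel of `f` (a cokernel of `f` when `Z` is the class of zero objects). -/
def IsCokernelRel (Z : ObjectProperty D) {A B Q : D} (q : B ⟶ Q) (f : A ⟶ B) : Prop :=
  IsTrivial Z (f ≫ q) ∧
    ∀ ⦃Y : D⦄ (l : B ⟶ Y), IsTrivial Z (f ≫ l) → ∃! m : Q ⟶ Y, q ≫ m = l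

/-- `f, g` form a short `Z`-exact sequence. -/
def IsShortExactRel (Z : ObjectProperty D) {A B Q : D} (f : A ⟶ B) (g : B ⟶ Q) : Prop :=
  IsKernelRel Z f g ∧ IsCokernelRel Z g f

/-- The class of zero objects. -/
def zeroObjects (D : Type u) [Category.{v} D] : ObjectProperty D := fun A => IsZero A

/-- A pretorsion theory `(T, F)`, with class of trivial objects `T ∩ F`. -/
structure IsPretorsionTheory (T F : ObjectProperty D) : Prop where
  replete_left : T.IsClosedUnderIsomorphisms
  replete_right : F.IsClosedUnderIsomorphisms
  trivial : ∀ ⦃A B : D⦄ (f : A ⟶ B), T A → F B → IsTrivial (T ⊓ F) f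
  exact : ∀ A : D, ∃ (TA FA : D) (f : TA ⟶ A) (g : A ⟶ FA),
    T TA ∧ F FA ∧ IsShortExactRel (T ⊓ F) f g

/-- The category is pointed and `(T, F)` is a (classical) torsion theory in it. -/
structure IsTorsionTheory (T F : ObjectProperty D) : Prop where
  pointed : HasZeroObject D
  replete_left : T.IsClosedUnderIsomorphisms
  replete_right : F.IsClosedUnderIsomorphisms
  zero : ∀ ⦃A B : D⦄ (f : A ⟶ B), T A → F B → IsTrivial (zeroObjects D) f
  exact : ∀ A : D, ∃ (TA FA : D) (f : TA ⟶ A) (g : A ⟶ FA),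
    T TA ∧ F FA ∧ IsShortExactRel (zeroObjects D) f g

variable {X : Type u'} [Category.{v'} X]

/-- A torsion theory functor from a category with a pretorsion theory `(T, F)` to a pointed
category with a torsion theory `(T', F')`.  (The canonical short exact sequence of `A` is unique up
to isomorphism, so all such sequences are considered.) -/
structure IsTorsionTheoryFunctor (T F : ObjectProperty D) (T' F' : ObjectProperty X)
    (G : D ⥤ X) : Prop where
  map_left : ∀ A, T A → T' (G.obj A)
  map_right : ∀ A, F A → F' (G.obj A)
  map_exact : ∀ ⦃TA A FA : D⦄ (f : TA ⟶ A) (g : A ⟶ FA), T TA → F FA →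
    IsShortExactRel (T ⊓ F) f g → IsShortExactRel (zeroObjects X) (G.map f) (G.map g)

/-- `G` sends `Z`-kernels to `Z'`-kernels. -/
def SendsKernels (Z : ObjectProperty D) (Z' : ObjectProperty X) (G : D ⥤ X) : Prop :=
  ∀ ⦃K A B : D⦄ (k : K ⟶ A) (f : A ⟶ B),
    IsKernelRel Z k f → IsKernelRel Z' (G.map k) (G.map f)

/-- `G` sends `Z`-cokernels to `Z'`-cokernels. -/
def SendsCokernels (Z : ObjectProperty D) (Z' : ObjectProperty X) (G : D ⥤ X) : Prop :=
  ∀ ⦃A B Q : D⦄ (q : B ⟶ Q) (f : A ⟶ B),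
    IsCokernelRel Z q f → IsCokernelRel Z' (G.map q) (G.map f)

/-- `G` sends short `Z`-exact sequences to short `Z'`-exact sequences. -/
def SendsShortExact (Z : ObjectProperty D) (Z' : ObjectProperty X) (G : D ⥤ X) : Prop :=
  ∀ ⦃A B Q : D⦄ (f : A ⟶ B) (g : B ⟶ Q),
    IsShortExactRel Z f g → IsShortExactRel Z' (G.map f) (G.map g)

/-- Binary coproducts are disjoint: the coprojections are monomorphisms, and their pullback exists
and is initial. -/
def DisjointCoproducts (D : Type u) [Category.{v} D] [HasBinaryCoproducts D] : Prop :=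
  ∀ A B : D, Mono (coprod.inl : A ⟶ A ⨿ B) ∧ Mono (coprod.inr : B ⟶ A ⨿ B) ∧
    ∃ (I : D) (p : I ⟶ A) (q : I ⟶ B),
      IsPullback p q (coprod.inl : A ⟶ A ⨿ B) coprod.inr ∧ Nonempty (IsInitial I)

/-- `i` and `j` are the coprojections of a binary coproduct. -/
def IsSum {A B S : D} (i : A ⟶ S) (j : B ⟶ S) : Prop :=
  Nonempty (IsColimit (BinaryCofan.mk i j))

/-- Binary coproducts are pre-universal. -/
def PreUniversalCoproducts (D : Type u) [Category.{v} D] [HasBinaryCoproducts D] : Prop :=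
  ∀ ⦃S A B : D⦄ (f : S ⟶ A ⨿ B), ∃ (A' B' : D) (i : A' ⟶ S) (j : B' ⟶ S)
    (fA : A' ⟶ A) (fB : B' ⟶ B),
      IsSum i j ∧ i ≫ f = fA ≫ coprod.inl ∧ j ≫ f = fB ≫ coprod.inr

/-- `α` and `β` represent complementary subobjects of `B`: their intersection is the initial
object, and their union is `B`, i.e. the only subobject containing both is `B` itself. -/
structure IsComplement {A A' B : D} (α : A ⟶ B) (β : A' ⟶ B) : Prop where
  mono_left : Mono α
  mono_right : Mono β
  inter : ∃ (I : D) (p : I ⟶ A) (q : I ⟶ A'), IsPullback p q α β ∧ Nonempty (IsInitial I)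
  union : ∀ ⦃S : D⦄ (s : S ⟶ B), Mono s → (∃ a, a ≫ s = α) → (∃ b, b ≫ s = β) → IsIso s

/-- The complemented subobjects of a category. -/
def complemented (D : Type u) [Category.{v} D] : MorphismProperty D :=
  fun _ B α => ∃ (A' : D) (β : A' ⟶ B), IsComplement α β

end General

/-! ### Pretoposes -/

/-- A pretopos: a Barr-exact category (regular, and all equivalence relations are effective) that
is finitary extensive. -/
class Pretopos (C : Type u) [Category.{v} C] : Prop extends Regular C, FinitaryExtensive C where
  effective : ∀ {R A : C} (p₁ p₂ : R ⟶ A), IsEquivalenceRelation p₁ p₂ →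
    IsEffectiveEquivalenceRelation p₁ p₂

/-- A relation on `A`, as a subobject of `A ⨯ A`, is transitive. -/
def RelIsTransitive {C : Type u} [Category.{v} C] [HasBinaryProducts C] {A : C}
    (S : Subobject (A ⨯ A)) : Prop :=
  Nonempty (TransitiveRelation (S.arrow ≫ prod.fst) (S.arrow ≫ prod.snd))

/-- A `τ`-pretopos: a pretopos in which the transitive closure of any relation on an object
exists. -/
class TauPretopos (C : Type u) [Category.{v} C] : Prop extends Pretopos C where
  transitiveClosure : ∀ {A : C} (R : Subobject (A ⨯ A)),
    ∃ T : Subobject (A ⨯ A), IsLeast {S | R ≤ S ∧ RelIsTransitive S} T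

/-! ### Internal preorders -/

/-- An internal preorder in `C`: a reflexive and transitive relation `⟨r₁, r₂⟩` on `carrier`. -/
structure PreOrd (C : Type u) [Category.{v} C] where
  carrier : C
  rel : C
  r₁ : rel ⟶ carrier
  r₂ : rel ⟶ carrier
  mono : JointlyMono₂ r₁ r₂
  refl : Nonempty (ReflexiveRelation r₁ r₂)
  trans : Nonempty (TransitiveRelation r₁ r₂)

namespace PreOrd

variable {C : Type u} [Category.{v} C]

/-- Morphisms of internal preorders. -/
@[ext]
structure Hom (A B : PreOrd C) where
  base : A.carrier ⟶ B.carrier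
  hat : A.rel ⟶ B.rel
  w₁ : A.r₁ ≫ base = hat ≫ B.r₁
  w₂ : A.r₂ ≫ base = hat ≫ B.r₂

instance : Category (PreOrd C) where
  Hom := Hom
  id A := ⟨𝟙 _, 𝟙 _, by simp, by simp⟩
  comp f g := ⟨f.base ≫ g.base, f.hat ≫ g.hat, by
    rw [← Category.assoc, f.w₁, Category.assoc, g.w₁, Category.assoc], by
    rw [← Category.assoc, f.w₂, Category.assoc, g.w₂, Category.assoc]⟩
  id_comp f := by simp
  comp_id f := by simp
  assoc f g h := by simp

/-- The underlying morphism of a morphism of preorders. -/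
abbrev base {A B : PreOrd C} (f : A ⟶ B) : A.carrier ⟶ B.carrier := Hom.base f

/-- The morphism between the relations. -/
abbrev hat {A B : PreOrd C} (f : A ⟶ B) : A.rel ⟶ B.rel := Hom.hat f

theorem w₁ {A B : PreOrd C} (f : A ⟶ B) : A.r₁ ≫ base f = hat f ≫ B.r₁ := Hom.w₁ f

theorem w₂ {A B : PreOrd C} (f : A ⟶ B) : A.r₂ ≫ base f = hat f ≫ B.r₂ := Hom.w₂ f

@[simp] theorem base_comp {A B E : PreOrd C} (f : A ⟶ B) (g : B ⟶ E) :
    base (f ≫ g) = base f ≫ base g := rfl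

@[simp] theorem hat_comp {A B E : PreOrd C} (f : A ⟶ B) (g : B ⟶ E) :
    hat (f ≫ g) = hat f ≫ hat g := rfl

@[simp] theorem base_id (A : PreOrd C) : base (𝟙 A) = 𝟙 _ := rfl

@[simp] theorem hat_id (A : PreOrd C) : hat (𝟙 A) = 𝟙 _ := rfl

theorem rel_ext (A : PreOrd C) {W : C} {a b : W ⟶ A.rel} (h₁ : a ≫ A.r₁ = b ≫ A.r₁)
    (h₂ : a ≫ A.r₂ = b ≫ A.r₂) : a = b :=
  A.mono.right_cancellation _ _ h₁ h₂

theorem hom_ext {A B : PreOrd C} {f g : A ⟶ B} (h : base f = base g) : f = g :=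
  Hom.ext h (B.rel_ext (by rw [← w₁, ← w₁, h]) (by rw [← w₂, ← w₂, h]))

theorem base_eq {A B : PreOrd C} {f g : A ⟶ B} (h : f = g) : base f = base g := by rw [h]

theorem hat_eq {A B : PreOrd C} {f g : A ⟶ B} (h : f = g) : hat f = hat g := by rw [h]

/-- The relation on generalized elements given by a preorder. -/
def Le (A : PreOrd C) {W : C} (a b : W ⟶ A.carrier) : Prop :=
  ∃ t : W ⟶ A.rel, t ≫ A.r₁ = a ∧ t ≫ A.r₂ = b

/-- The preorder is an equivalence relation. -/
def isEq (C : Type u) [Category.{v} C] : ObjectProperty (PreOrd C) :=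
  fun A => Nonempty (SymmetricRelation A.r₁ A.r₂)

/-- The preorder is a partial order: the intersection of the relation with its opposite is
contained in (hence equal to) the discrete relation, in terms of generalized elements. -/
def isPar (C : Type u) [Category.{v} C] : ObjectProperty (PreOrd C) :=
  fun A => ∀ ⦃W : C⦄ (a b : W ⟶ A.carrier), A.Le a b → A.Le b a → a = b

/-- The class of trivial objects. -/
abbrev isTriv (C : Type u) [Category.{v} C] : ObjectProperty (PreOrd C) := isEq C ⊓ isPar C

theorem le_refl (A : PreOrd C) {W : C} (a : W ⟶ A.carrier) : A.Le a a := by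
  obtain ⟨e⟩ := A.refl
  exact ⟨a ≫ e.r, by simp, by simp⟩

theorem le_trans (A : PreOrd C) {W : C} {a b c : W ⟶ A.carrier} (h : A.Le a b)
    (h' : A.Le b c) : A.Le a c := by
  obtain ⟨e⟩ := A.trans
  obtain ⟨s, rfl, rfl⟩ := h
  obtain ⟨t, ht, rfl⟩ := h'
  refine ⟨PullbackCone.IsLimit.lift e.isLimit s t ht.symm ≫ e.t, ?_, ?_⟩
  · rw [Category.assoc, e.transitivity₁, ← Category.assoc, PullbackCone.IsLimit.lift_fst]
  · rw [Category.assoc, e.transitivity₂, ← Category.assoc, PullbackCone.IsLimit.lift_snd]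

/-- Constructor through generalized elements. -/
@[reducible]
def ofLe [HasPullbacks C] {A R : C} (r₁ r₂ : R ⟶ A)
    (mono : ∀ ⦃W : C⦄ (a b : W ⟶ R), a ≫ r₁ = b ≫ r₁ → a ≫ r₂ = b ≫ r₂ → a = b)
    (refl : ∃ r : A ⟶ R, r ≫ r₁ = 𝟙 _ ∧ r ≫ r₂ = 𝟙 _)
    (trans : ∀ ⦃W : C⦄ (s t : W ⟶ R), s ≫ r₂ = t ≫ r₁ →
      ∃ m : W ⟶ R, m ≫ r₁ = s ≫ r₁ ∧ m ≫ r₂ = t ≫ r₂) : PreOrd C where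
  carrier := A
  rel := R
  r₁ := r₁
  r₂ := r₂
  mono := ⟨mono⟩
  refl := by
    obtain ⟨r, h₁, h₂⟩ := refl
    exact ⟨{ right_cancellation := mono, r := r, reflexivity₁ := h₁, reflexivity₂ := h₂ }⟩
  trans := by
    obtain ⟨m, h₁, h₂⟩ := trans (pullback.fst r₂ r₁) (pullback.snd r₂ r₁) pullback.condition
    exact ⟨{ right_cancellation := mono, c := pullback.cone r₂ r₁,
             isLimit := pullback.isLimit r₂ r₁, t := m, transitivity₁ := h₁,
             transitivity₂ := h₂ }⟩

theorem mono_of_base {A B : PreOrd C} (f : A ⟶ B) (hf : Mono (base f)) : Mono f :=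
  ⟨fun a b h => hom_ext (by rw [← cancel_mono (base f)]; exact base_eq h)⟩

theorem mono_hat {A B : PreOrd C} (f : A ⟶ B) (hf : Mono (base f)) : Mono (hat f) := by
  constructor
  intro W a b h
  apply A.rel_ext
  · rw [← cancel_mono (base f), Category.assoc, Category.assoc, w₁, reassoc_of% h]
  · rw [← cancel_mono (base f), Category.assoc, Category.assoc, w₂, reassoc_of% h]

theorem isIso_of {A B : PreOrd C} (f : A ⟶ B) (h : IsIso (base f)) (h' : IsIso (hat f)) :
    IsIso f := by
  refine ⟨Hom.mk (inv (base f)) (inv (hat f)) ?_ ?_, hom_ext ?_, hom_ext ?_⟩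
  · rw [← cancel_mono (base f), Category.assoc, Category.assoc, w₁]; simp
  · rw [← cancel_mono (base f), Category.assoc, Category.assoc, w₂]; simp
  · exact IsIso.hom_inv_id (base f)
  · exact IsIso.inv_hom_id (base f)

section Pullbacks

variable [HasPullbacks C]

/-- The discrete preorder. -/
def disc (A : C) : PreOrd C :=
  ofLe (𝟙 A) (𝟙 A) (fun _ _ _ h _ => by simpa using h) ⟨𝟙 _, by simp, by simp⟩
    (fun _ s t h => ⟨s, rfl, by simpa using h⟩)

/-- Morphisms out of a discrete preorder. -/
noncomputable def discHom {A : C} {B : PreOrd C} (f : A ⟶ B.carrier) : disc A ⟶ B :=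
  Hom.mk f (B.le_refl f).choose
    ((Category.id_comp _).trans (B.le_refl f).choose_spec.1.symm)
    ((Category.id_comp _).trans (B.le_refl f).choose_spec.2.symm)

/-- The pullback of preorders, computed componentwise. -/
noncomputable def pb {A B E : PreOrd C} (f : A ⟶ E) (g : B ⟶ E) : PreOrd C :=
  ofLe (A := pullback (base f) (base g)) (R := pullback (hat f) (hat g))
    (pullback.lift (pullback.fst _ _ ≫ A.r₁) (pullback.snd _ _ ≫ B.r₁)
      (by rw [Category.assoc, Category.assoc, w₁, w₁, pullback.condition_assoc]))
    (pullback.lift (pullback.fst _ _ ≫ A.r₂) (pullback.snd _ _ ≫ B.r₂)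
      (by rw [Category.assoc, Category.assoc, w₂, w₂, pullback.condition_assoc]))
    (by
      intro W a b h₁ h₂
      apply pullback.hom_ext
      · apply A.rel_ext
        · simpa [pullback.lift_fst, pullback.lift_snd] using h₁ =≫ pullback.fst _ _
        · simpa [pullback.lift_fst, pullback.lift_snd] using h₂ =≫ pullback.fst _ _
      · apply B.rel_ext
        · simpa [pullback.lift_fst, pullback.lift_snd] using h₁ =≫ pullback.snd _ _
        · simpa [pullback.lift_fst, pullback.lift_snd] using h₂ =≫ pullback.snd _ _)
    (by
      obtain ⟨s, h₁, h₂⟩ := A.le_refl (pullback.fst (base f) (base g))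
      obtain ⟨t, k₁, k₂⟩ := B.le_refl (pullback.snd (base f) (base g))
      refine ⟨pullback.lift s t ?_, ?_, ?_⟩
      · apply E.rel_ext
        · rw [Category.assoc, Category.assoc, ← w₁, ← w₁, reassoc_of% h₁, reassoc_of% k₁,
            pullback.condition]
        · rw [Category.assoc, Category.assoc, ← w₂, ← w₂, reassoc_of% h₂, reassoc_of% k₂,
            pullback.condition]
      · apply pullback.hom_ext <;> simp [pullback.lift_fst, pullback.lift_snd, pullback.lift_fst_assoc,
          pullback.lift_snd_assoc, h₁, k₁]
      · apply pullback.hom_ext <;> simp [pullback.lift_fst, pullback.lift_snd, pullback.lift_fst_assoc,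
          pullback.lift_snd_assoc, h₂, k₂])
    (by
      intro W s t h
      have hA : (s ≫ pullback.fst _ _) ≫ A.r₂ = (t ≫ pullback.fst _ _) ≫ A.r₁ := by
        simpa [pullback.lift_fst, pullback.lift_snd] using h =≫ pullback.fst _ _
      have hB : (s ≫ pullback.snd _ _) ≫ B.r₂ = (t ≫ pullback.snd _ _) ≫ B.r₁ := by
        simpa [pullback.lift_fst, pullback.lift_snd] using h =≫ pullback.snd _ _
      obtain ⟨m, h₁, h₂⟩ := A.le_trans ⟨_, rfl, rfl⟩ ⟨_, hA.symm, rfl⟩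
      obtain ⟨n, k₁, k₂⟩ := B.le_trans ⟨_, rfl, rfl⟩ ⟨_, hB.symm, rfl⟩
      simp only [Category.assoc] at h₁ h₂ k₁ k₂
      refine ⟨pullback.lift m n ?_, ?_, ?_⟩
      · apply E.rel_ext
        · rw [Category.assoc, Category.assoc, ← w₁, ← w₁, reassoc_of% h₁, reassoc_of% k₁,
            w₁, w₁, pullback.condition_assoc]
        · rw [Category.assoc, Category.assoc, ← w₂, ← w₂, reassoc_of% h₂, reassoc_of% k₂,
            w₂, w₂, pullback.condition_assoc]
      · apply pullback.hom_ext <;> simp [pullback.lift_fst, pullback.lift_snd, pullback.lift_fst_assoc,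
          pullback.lift_snd_assoc, h₁, k₁]
      · apply pullback.hom_ext <;> simp [pullback.lift_fst, pullback.lift_snd, pullback.lift_fst_assoc,
          pullback.lift_snd_assoc, h₂, k₂])

/-- First projection. -/
noncomputable def pbFst {A B E : PreOrd C} (f : A ⟶ E) (g : B ⟶ E) : pb f g ⟶ A :=
  Hom.mk (pullback.fst (base f) (base g)) (pullback.fst (hat f) (hat g))
    (pullback.lift_fst _ _ _) (pullback.lift_fst _ _ _)

/-- Second projection. -/
noncomputable def pbSnd {A B E : PreOrd C} (f : A ⟶ E) (g : B ⟶ E) : pb f g ⟶ B :=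
  Hom.mk (pullback.snd (base f) (base g)) (pullback.snd (hat f) (hat g))
    (pullback.lift_snd _ _ _) (pullback.lift_snd _ _ _)

/-- The morphism induced by the universal property of the pullback. -/
noncomputable def pbLift {W A B E : PreOrd C} {f : A ⟶ E} {g : B ⟶ E} (a : W ⟶ A) (b : W ⟶ B)
    (h : a ≫ f = b ≫ g) : W ⟶ pb f g :=
  Hom.mk (pullback.lift (base a) (base b) (base_eq h)) (pullback.lift (hat a) (hat b) (hat_eq h))
    (by apply pullback.hom_ext <;> simp [pullback.lift_fst, pullback.lift_snd, pullback.lift_fst_assoc,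
          pullback.lift_snd_assoc, pb, w₁])
    (by apply pullback.hom_ext <;> simp [pullback.lift_fst, pullback.lift_snd, pullback.lift_fst_assoc,
          pullback.lift_snd_assoc, pb, w₂])

theorem isPullback_pb {A B E : PreOrd C} (f : A ⟶ E) (g : B ⟶ E) :
    IsPullback (pbFst f g) (pbSnd f g) f g :=
  ⟨⟨hom_ext pullback.condition⟩, ⟨PullbackCone.IsLimit.mk _
    (fun s => pbLift s.fst s.snd s.condition)
    (fun s => hom_ext (pullback.lift_fst _ _ _))
    (fun s => hom_ext (pullback.lift_snd _ _ _))
    (fun s m h₁ h₂ => hom_ext (by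
      apply pullback.hom_ext
      · exact (base_eq h₁).trans (pullback.lift_fst _ _ _).symm
      · exact (base_eq h₂).trans (pullback.lift_snd _ _ _).symm))⟩⟩

instance : HasPullbacks (PreOrd C) :=
  have : ∀ {A B E : PreOrd C} {f : A ⟶ E} {g : B ⟶ E}, HasLimit (cospan f g) :=
    fun {_ _ _ f g} => (isPullback_pb f g).hasPullback
  hasPullbacks_of_hasLimit_cospan _

/-- The functor to underlying objects. -/
def baseFunctor (C : Type u) [Category.{v} C] : PreOrd C ⥤ C where
  obj A := A.carrier
  map f := base f

/-- The functor to relations. -/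
def hatFunctor (C : Type u) [Category.{v} C] : PreOrd C ⥤ C where
  obj A := A.rel
  map f := hat f

theorem isPullback_base_hat {P A B E : PreOrd C} {p : P ⟶ A} {q : P ⟶ B} {f : A ⟶ E}
    {g : B ⟶ E} (h : IsPullback p q f g) :
    IsPullback (base p) (base q) (base f) (base g) ∧
      IsPullback (hat p) (hat q) (hat f) (hat g) := by
  let e := h.isoIsPullback _ _ (isPullback_pb f g)
  have h₁ : e.hom ≫ pbFst f g = p := h.isoIsPullback_hom_fst _ _ _
  have h₂ : e.hom ≫ pbSnd f g = q := h.isoIsPullback_hom_snd _ _ _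
  constructor
  · refine (IsPullback.of_hasPullback (base f) (base g)).of_iso
      ((baseFunctor C).mapIso e).symm (Iso.refl _) (Iso.refl _) (Iso.refl _) ?_ ?_ ?_ ?_
    · rw [← h₁]; exact ((Category.comp_id _).trans (base_eq (e.inv_hom_id_assoc (pbFst f g))).symm)
    · rw [← h₂]; exact ((Category.comp_id _).trans (base_eq (e.inv_hom_id_assoc (pbSnd f g))).symm)
    · simp
    · simp
  · refine (IsPullback.of_hasPullback (hat f) (hat g)).of_iso
      ((hatFunctor C).mapIso e).symm (Iso.refl _) (Iso.refl _) (Iso.refl _) ?_ ?_ ?_ ?_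
    · rw [← h₁]; exact ((Category.comp_id _).trans (hat_eq (e.inv_hom_id_assoc (pbFst f g))).symm)
    · rw [← h₂]; exact ((Category.comp_id _).trans (hat_eq (e.inv_hom_id_assoc (pbSnd f g))).symm)
    · simp
    · simp

theorem mono_base {A B : PreOrd C} (f : A ⟶ B) (hf : Mono f) : Mono (base f) := by
  constructor
  intro W a b h
  have : discHom a = discHom b := by
    rw [← cancel_mono f]
    exact hom_ext h
  exact base_eq this

end Pullbacks

end PreOrd

/-! ### Complemented subobjects of internal preorders -/

section Sums

variable {C : Type u} [Category.{v} C]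

theorem IsSum.hom_ext {A B S W : C} {i : A ⟶ S} {j : B ⟶ S} (h : IsSum i j) {x y : S ⟶ W}
    (h₁ : i ≫ x = i ≫ y) (h₂ : j ≫ x = j ≫ y) : x = y :=
  BinaryCofan.IsColimit.hom_ext h.some h₁ h₂

theorem IsSum.exists_desc {A B S W : C} {i : A ⟶ S} {j : B ⟶ S} (h : IsSum i j) (x : A ⟶ W)
    (y : B ⟶ W) : ∃ d : S ⟶ W, i ≫ d = x ∧ j ≫ d = y :=
  let d := BinaryCofan.IsColimit.desc' h.some x y
  ⟨d.1, d.2.1, d.2.2⟩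

theorem isSum_of {A B S : C} {i : A ⟶ S} {j : B ⟶ S}
    (h : ∀ ⦃W : C⦄ (x : A ⟶ W) (y : B ⟶ W), ∃ d : S ⟶ W, i ≫ d = x ∧ j ≫ d = y)
    (h' : ∀ ⦃W : C⦄ (x y : S ⟶ W), i ≫ x = i ≫ y → j ≫ x = j ≫ y → x = y) : IsSum i j :=
  ⟨BinaryCofan.isColimitMk (fun s => (h s.inl s.inr).choose)
    (fun s => (h s.inl s.inr).choose_spec.1) (fun s => (h s.inl s.inr).choose_spec.2)
    (fun s _ h₁ h₂ => h' _ _ (h₁.trans (h s.inl s.inr).choose_spec.1.symm)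
      (h₂.trans (h s.inl s.inr).choose_spec.2.symm))⟩

theorem isSum_coprod [HasBinaryCoproducts C] (A B : C) :
    IsSum (coprod.inl : A ⟶ A ⨿ B) coprod.inr := ⟨coprodIsCoprod A B⟩

theorem IsSum.comp_iso {A B S S' : C} {i : A ⟶ S} {j : B ⟶ S} (h : IsSum i j) (e : S ⟶ S')
    [IsIso e] : IsSum (i ≫ e) (j ≫ e) :=
  isSum_of (fun _ x y => by
    obtain ⟨d, rfl, rfl⟩ := h.exists_desc x y
    exact ⟨inv e ≫ d, by simp, by simp⟩)
    (fun _ x y h₁ h₂ => by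
      rw [← cancel_epi e]
      exact h.hom_ext (by simpa using h₁) (by simpa using h₂))

/-- Associativity of sums. -/
theorem IsSum.assoc {A A' B D S E : C} {γ : A' ⟶ A} {δ : D ⟶ A} {α : A ⟶ S} {β : B ⟶ S}
    {i : D ⟶ E} {j : B ⟶ E} {ε : E ⟶ S} (h : IsSum γ δ) (h' : IsSum α β) (h'' : IsSum i j)
    (hi : i ≫ ε = δ ≫ α) (hj : j ≫ ε = β) : IsSum (γ ≫ α) ε :=
  isSum_of (fun _ x y => by
    obtain ⟨d, h₁, h₂⟩ := h.exists_desc x (i ≫ y)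
    obtain ⟨e, h₃, h₄⟩ := h'.exists_desc d (j ≫ y)
    refine ⟨e, by rw [Category.assoc, h₃, h₁], h''.hom_ext ?_ ?_⟩
    · rw [reassoc_of% hi, h₃, h₂]
    · rw [reassoc_of% hj, h₄])
    (fun _ x y h₁ h₂ => by
      refine h'.hom_ext (h.hom_ext (by simpa using h₁) ?_) ?_
      · rw [← reassoc_of% hi, ← reassoc_of% hi, h₂]
      · rw [← hj, Category.assoc, Category.assoc, h₂])

variable [FinitaryExtensive C]

theorem IsSum.mono_left {A B S : C} {i : A ⟶ S} {j : B ⟶ S} (h : IsSum i j) : Mono i :=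
  FinitaryExtensive.mono_inl_of_isColimit h.some

theorem IsSum.mono_right {A B S : C} {i : A ⟶ S} {j : B ⟶ S} (h : IsSum i j) : Mono j :=
  FinitaryExtensive.mono_inr_of_isColimit h.some

theorem IsSum.of_isPullback {A B S A' B' W : C} {i : A ⟶ S} {j : B ⟶ S} (h : IsSum i j)
    {f : W ⟶ S} {p : A' ⟶ W} {a : A' ⟶ A} {q : B' ⟶ W} {b : B' ⟶ B} (hp : IsPullback p a f i)
    (hq : IsPullback q b f j) : IsSum p q :=
  ((BinaryCofan.isVanKampen_iff _).1 (FinitaryExtensive.van_kampen' _ h.some)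
    (BinaryCofan.mk p q) a b f hp.w.symm hq.w.symm).2 ⟨hp, hq⟩

theorem IsSum.isPullback {A B S A' B' W : C} {i : A ⟶ S} {j : B ⟶ S} (h : IsSum i j)
    {f : W ⟶ S} {p : A' ⟶ W} {a : A' ⟶ A} {q : B' ⟶ W} {b : B' ⟶ B} (h' : IsSum p q)
    (hp : p ≫ f = a ≫ i) (hq : q ≫ f = b ≫ j) : IsPullback p a f i ∧ IsPullback q b f j :=
  ((BinaryCofan.isVanKampen_iff _).1 (FinitaryExtensive.van_kampen' _ h.some)
    (BinaryCofan.mk p q) a b f hp.symm hq.symm).1 h'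

theorem IsSum.split [HasPullbacks C] {A B S W : C} {i : A ⟶ S} {j : B ⟶ S} (h : IsSum i j)
    (f : W ⟶ S) : ∃ (A' B' : C) (p : A' ⟶ W) (q : B' ⟶ W) (a : A' ⟶ A) (b : B' ⟶ B),
      IsSum p q ∧ p ≫ f = a ≫ i ∧ q ≫ f = b ≫ j :=
  ⟨_, _, pullback.fst f i, pullback.fst f j, pullback.snd f i, pullback.snd f j,
    h.of_isPullback (.of_hasPullback f i) (.of_hasPullback f j), pullback.condition,
    pullback.condition⟩

theorem IsSum.isPullback_initial {A B S : C} {i : A ⟶ S} {j : B ⟶ S} (h : IsSum i j) :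
    IsPullback (initial.to A) (initial.to B) i j :=
  FinitaryExtensive.isPullback_initial_to_binaryCofan h.some

theorem eq_of_to_initial {W Y : C} (z : W ⟶ ⊥_ C) (x y : W ⟶ Y) : x = y :=
  (IsInitial.ofStrict z initialIsInitial).hom_ext x y

theorem IsSum.eq_of_disjoint {A B S W Y : C} {i : A ⟶ S} {j : B ⟶ S} (h : IsSum i j)
    {a : W ⟶ A} {b : W ⟶ B} (w : a ≫ i = b ≫ j) (x y : W ⟶ Y) : x = y :=
  eq_of_to_initial (h.isPullback_initial.lift a b w) x y

/-- The union of two disjoint subobjects is their sum. -/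
theorem mono_of_disjoint [HasPullbacks C] {A B S E : C} {i : A ⟶ S} {j : B ⟶ S} (h : IsSum i j)
    {f : S ⟶ E} (hi : Mono (i ≫ f)) (hj : Mono (j ≫ f))
    (hd : ∀ ⦃W : C⦄ (a : W ⟶ A) (b : W ⟶ B), a ≫ i ≫ f = b ≫ j ≫ f → Nonempty (W ⟶ ⊥_ C)) :
    Mono f := by
  constructor
  intro W x y e
  obtain ⟨W₁, W₂, p, q, a, b, hpq, hp, hq⟩ := h.split x
  refine hpq.hom_ext ?_ ?_
  · obtain ⟨V₁, V₂, r, s, c, d, hrs, hr, hs⟩ := h.split (p ≫ y)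
    have e' : a ≫ i ≫ f = p ≫ y ≫ f := by rw [← e, reassoc_of% hp]
    refine hrs.hom_ext ?_ ?_
    · have : r ≫ a = c := by
        rw [← cancel_mono (i ≫ f), Category.assoc, e', reassoc_of% hr]
      rw [hr, hp, ← this, Category.assoc]
    · obtain ⟨z⟩ := hd (s ≫ a) d (by rw [Category.assoc, e', reassoc_of% hs])
      exact eq_of_to_initial z _ _
  · obtain ⟨V₁, V₂, r, s, c, d, hrs, hr, hs⟩ := h.split (q ≫ y)
    have e' : b ≫ j ≫ f = q ≫ y ≫ f := by rw [← e, reassoc_of% hq]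
    refine hrs.hom_ext ?_ ?_
    · obtain ⟨z⟩ := hd c (r ≫ b) (by rw [Category.assoc, e', reassoc_of% hr])
      exact eq_of_to_initial z _ _
    · have : s ≫ b = d := by
        rw [← cancel_mono (j ≫ f), Category.assoc, e', reassoc_of% hs]
      rw [hs, hq, ← this, Category.assoc]

end Sums

namespace PreOrd

variable {C : Type u} [Category.{v} C] [HasPullbacks C] [FinitaryExtensive C]

/-- The sum of two preorders, computed componentwise. -/
noncomputable def sum (A B : PreOrd C) : PreOrd C :=
  ofLe (A := A.carrier ⨿ B.carrier) (R := A.rel ⨿ B.rel)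
    (coprod.map A.r₁ B.r₁) (coprod.map A.r₂ B.r₂)
    (by
      intro W x y h₁ h₂
      have hR := isSum_coprod A.rel B.rel
      have hS := isSum_coprod A.carrier B.carrier
      have P := hS.isPullback hR (f := coprod.map A.r₁ B.r₁) (a := A.r₁) (b := B.r₁)
        (coprod.inl_map _ _) (coprod.inr_map _ _)
      obtain ⟨W₁, W₂, p, q, a, b, hpq, hp, hq⟩ := hR.split x
      refine hpq.hom_ext ?_ ?_
      · have e : (p ≫ y) ≫ coprod.map A.r₁ B.r₁ = (a ≫ A.r₁) ≫ coprod.inl := by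
          rw [Category.assoc, ← h₁, reassoc_of% hp, coprod.inl_map, Category.assoc]
        have ha := P.1.lift_fst _ _ e
        have := hS.mono_left
        have k₁ := P.1.lift_snd _ _ e
        have k₂ : P.1.lift _ _ e ≫ A.r₂ = a ≫ A.r₂ := by
          rw [← cancel_mono (coprod.inl : A.carrier ⟶ A.carrier ⨿ B.carrier), Category.assoc,
            Category.assoc, ← coprod.inl_map A.r₂ B.r₂, reassoc_of% ha, ← h₂, reassoc_of% hp]
        rw [hp, ← ha, A.rel_ext k₁ k₂]
      · have e : (q ≫ y) ≫ coprod.map A.r₁ B.r₁ = (b ≫ B.r₁) ≫ coprod.inr := by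
          rw [Category.assoc, ← h₁, reassoc_of% hq, coprod.inr_map, Category.assoc]
        have ha := P.2.lift_fst _ _ e
        have := hS.mono_right
        have k₁ := P.2.lift_snd _ _ e
        have k₂ : P.2.lift _ _ e ≫ B.r₂ = b ≫ B.r₂ := by
          rw [← cancel_mono (coprod.inr : B.carrier ⟶ A.carrier ⨿ B.carrier), Category.assoc,
            Category.assoc, ← coprod.inr_map A.r₂ B.r₂, reassoc_of% ha, ← h₂, reassoc_of% hq]
        rw [hq, ← ha, B.rel_ext k₁ k₂])
    (by
      obtain ⟨s, h₁, h₂⟩ := A.le_refl (𝟙 _)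
      obtain ⟨t, k₁, k₂⟩ := B.le_refl (𝟙 _)
      exact ⟨coprod.map s t, by simp [h₁, k₁], by simp [h₂, k₂]⟩)
    (by
      intro W x y h
      have hR := isSum_coprod A.rel B.rel
      have hS := isSum_coprod A.carrier B.carrier
      have P := hS.isPullback hR (f := coprod.map A.r₁ B.r₁) (a := A.r₁) (b := B.r₁)
        (coprod.inl_map _ _) (coprod.inr_map _ _)
      obtain ⟨W₁, W₂, p, q, a, b, hpq, hp, hq⟩ := hR.split x
      have e : (p ≫ y) ≫ coprod.map A.r₁ B.r₁ = (a ≫ A.r₂) ≫ coprod.inl := by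
        rw [Category.assoc, ← h, reassoc_of% hp, coprod.inl_map, Category.assoc]
      have e' : (q ≫ y) ≫ coprod.map A.r₁ B.r₁ = (b ≫ B.r₂) ≫ coprod.inr := by
        rw [Category.assoc, ← h, reassoc_of% hq, coprod.inr_map, Category.assoc]
      obtain ⟨m, m₁, m₂⟩ := A.le_trans ⟨a, rfl, rfl⟩ ⟨_, P.1.lift_snd _ _ e, rfl⟩
      obtain ⟨n, n₁, n₂⟩ := B.le_trans ⟨b, rfl, rfl⟩ ⟨_, P.2.lift_snd _ _ e', rfl⟩
      obtain ⟨d, d₁, d₂⟩ := hpq.exists_desc (m ≫ coprod.inl) (n ≫ coprod.inr)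
      have ha := P.1.lift_fst _ _ e
      have hb := P.2.lift_fst _ _ e'
      refine ⟨d, hpq.hom_ext ?_ ?_, hpq.hom_ext ?_ ?_⟩
      · rw [reassoc_of% d₁, reassoc_of% hp, coprod.inl_map, reassoc_of% m₁]
      · rw [reassoc_of% d₂, reassoc_of% hq, coprod.inr_map, reassoc_of% n₁]
      · rw [reassoc_of% d₁, ← reassoc_of% ha, coprod.inl_map, reassoc_of% m₂]
      · rw [reassoc_of% d₂, ← reassoc_of% hb, coprod.inr_map, reassoc_of% n₂])

/-- The morphism out of a sum of preorders. -/
noncomputable def sumDesc {A B E : PreOrd C} (f : A ⟶ E) (g : B ⟶ E) : sum A B ⟶ E :=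
  Hom.mk (coprod.desc (base f) (base g)) (coprod.desc (hat f) (hat g))
    (by apply coprod.hom_ext <;> simp [sum, w₁]) (by apply coprod.hom_ext <;> simp [sum, w₂])

/-- Coprojection. -/
noncomputable def sumInl (A B : PreOrd C) : A ⟶ sum A B :=
  Hom.mk coprod.inl coprod.inl (coprod.inl_map _ _).symm (coprod.inl_map _ _).symm

/-- Coprojection. -/
noncomputable def sumInr (A B : PreOrd C) : B ⟶ sum A B :=
  Hom.mk coprod.inr coprod.inr (coprod.inr_map _ _).symm (coprod.inr_map _ _).symm

/-- The discrete preorder on the initial object is initial. -/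
noncomputable def discInitial (C : Type u) [Category.{v} C] [HasPullbacks C]
    [FinitaryExtensive C] : IsInitial (disc (⊥_ C)) :=
  IsInitial.ofUniqueHom (fun _ => discHom (initial.to _)) (fun _ _ => hom_ext (initial.hom_ext _ _))

theorem isComplement_iff {A A' B : PreOrd C} (α : A ⟶ B) (β : A' ⟶ B) :
    IsComplement α β ↔ IsSum (base α) (base β) ∧ IsSum (hat α) (hat β) := by
  constructor
  · intro h
    have m₁ := mono_base α h.mono_left
    have m₂ := mono_base β h.mono_right
    obtain ⟨I, p, q, hI, ⟨hI'⟩⟩ := h.inter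
    have hm : Mono (base (sumDesc α β)) := by
      refine mono_of_disjoint (isSum_coprod A.carrier A'.carrier) ?_ ?_ ?_
      · exact (coprod.inl_desc (base α) (base β)).symm ▸ m₁
      · exact (coprod.inr_desc (base α) (base β)).symm ▸ m₂
      · intro W a b w
        have w' : discHom a ≫ α = discHom b ≫ β := hom_ext (by
          have h₁ : coprod.inl ≫ base (sumDesc α β) = base α := coprod.inl_desc _ _
          have h₂ : coprod.inr ≫ base (sumDesc α β) = base β := coprod.inr_desc _ _
          change a ≫ base α = b ≫ base β
          rw [h₁, h₂] at w
          exact w)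
        exact ⟨base (hI.lift _ _ w' ≫ hI'.to (disc (⊥_ C)))⟩
    have := h.union (sumDesc α β) (mono_of_base _ hm)
      ⟨sumInl A A', hom_ext (coprod.inl_desc _ _)⟩ ⟨sumInr A A', hom_ext (coprod.inr_desc _ _)⟩
    have i₁ : IsIso (coprod.desc (base α) (base β)) :=
      (inferInstance : IsIso ((baseFunctor C).map (sumDesc α β)))
    have i₂ : IsIso (coprod.desc (hat α) (hat β)) :=
      (inferInstance : IsIso ((hatFunctor C).map (sumDesc α β)))
    have s₁ := (isSum_coprod A.carrier A'.carrier).comp_iso (coprod.desc (base α) (base β))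
    have s₂ := (isSum_coprod A.rel A'.rel).comp_iso (coprod.desc (hat α) (hat β))
    rw [coprod.inl_desc, coprod.inr_desc] at s₁ s₂
    exact ⟨s₁, s₂⟩
  · rintro ⟨h₁, h₂⟩
    refine ⟨mono_of_base _ h₁.mono_left, mono_of_base _ h₁.mono_right,
      ⟨disc (⊥_ C), (discInitial C).to _, (discInitial C).to _, ?_, ⟨discInitial C⟩⟩, ?_⟩
    · refine ⟨⟨(discInitial C).hom_ext _ _⟩, ⟨PullbackCone.IsLimit.mk _
        (fun s => Hom.mk (h₁.isPullback_initial.lift (base s.fst) (base s.snd)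
            (base_eq s.condition))
          (s.pt.r₁ ≫ h₁.isPullback_initial.lift (base s.fst) (base s.snd) (base_eq s.condition))
          (Category.comp_id _).symm
          (eq_of_to_initial (s.pt.r₁ ≫ h₁.isPullback_initial.lift (base s.fst) (base s.snd)
            (base_eq s.condition)) _ _)) ?_ ?_ ?_⟩⟩
      · exact fun s => hom_ext (h₁.eq_of_disjoint (base_eq s.condition) _ _)
      · exact fun s => hom_ext (h₁.eq_of_disjoint (base_eq s.condition) _ _)
      · exact fun s _ _ _ => hom_ext (h₁.eq_of_disjoint (base_eq s.condition) _ _)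
    · rintro S s hs ⟨a, ha⟩ ⟨b, hb⟩
      have m₁ := mono_base s hs
      have m₂ := mono_hat s m₁
      obtain ⟨c, c₁, c₂⟩ := h₁.exists_desc (base a) (base b)
      obtain ⟨d, d₁, d₂⟩ := h₂.exists_desc (hat a) (hat b)
      have e₁ : c ≫ base s = 𝟙 _ := h₁.hom_ext
        (by rw [reassoc_of% c₁, Category.comp_id]; exact base_eq ha)
        (by rw [reassoc_of% c₂, Category.comp_id]; exact base_eq hb)
      have e₂ : d ≫ hat s = 𝟙 _ := h₂.hom_ext
        (by rw [reassoc_of% d₁, Category.comp_id]; exact hat_eq ha)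
        (by rw [reassoc_of% d₂, Category.comp_id]; exact hat_eq hb)
      refine isIso_of s ⟨c, ?_, e₁⟩ ⟨d, ?_, e₂⟩
      · rw [← cancel_mono (base s), Category.assoc, e₁]; simp
      · rw [← cancel_mono (hat s), Category.assoc, e₂]; simp

instance : (complemented (PreOrd C)).IsMultiplicative where
  id_mem A := ⟨disc (⊥_ C), (discInitial C).to A, by
    rw [isComplement_iff]
    constructor
    · exact isSum_of (fun _ x _ => ⟨x, Category.id_comp _, initial.hom_ext _ _⟩)
        (fun _ x y h _ => by simpa using h)
    · exact isSum_of (fun _ x _ => ⟨x, Category.id_comp _, initial.hom_ext _ _⟩)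
        (fun _ x y h _ => by simpa using h)⟩
  comp_mem γ α := by
    rintro ⟨D, δ, hδ⟩ ⟨B, β, hβ⟩
    rw [isComplement_iff] at hδ hβ
    refine ⟨sum D B, sumDesc (δ ≫ α) β, ?_⟩
    rw [isComplement_iff]
    exact ⟨hδ.1.assoc hβ.1 (isSum_coprod _ _) (coprod.inl_desc _ _) (coprod.inr_desc _ _),
      hδ.2.assoc hβ.2 (isSum_coprod _ _) (coprod.inl_desc _ _) (coprod.inr_desc _ _)⟩

instance : (complemented (PreOrd C)).IsStableUnderBaseChange where
  of_isPullback {_ _ _ _ f _ _ _} sq := by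
    rintro ⟨B, β, hβ⟩
    rw [isComplement_iff] at hβ
    have h₁ := isPullback_base_hat sq
    have h₂ := isPullback_base_hat (isPullback_pb f β)
    refine ⟨_, pbFst f β, ?_⟩
    rw [isComplement_iff]
    exact ⟨hβ.1.of_isPullback h₁.1.flip h₂.1, hβ.2.of_isPullback h₁.2.flip h₂.2⟩

end PreOrd

/-! ### Categories of partial maps -/

section PartialMaps

variable {D : Type u} [Category.{v} D] (W : MorphismProperty D)

/-- A span representing a partial map from `A` to `B`, defined on a subobject in the class `W`. -/
structure PartialMap (A B : D) where
  dom : D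
  ι : dom ⟶ A
  mem : W ι
  map : dom ⟶ B

/-- Two spans represent the same partial map when they differ by an isomorphism of their
domains. -/
def partialMapSetoid (A B : D) : Setoid (PartialMap W A B) where
  r p q := ∃ e : p.dom ≅ q.dom, e.hom ≫ q.ι = p.ι ∧ e.hom ≫ q.map = p.map
  iseqv :=
    { refl := fun p => ⟨Iso.refl _, by simp, by simp⟩
      symm := by
        rintro p q ⟨e, h₁, h₂⟩
        exact ⟨e.symm, by simp [← h₁], by simp [← h₂]⟩
      trans := by
        rintro p q r ⟨e, h₁, h₂⟩ ⟨e', h₃, h₄⟩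
        exact ⟨e ≪≫ e', by simp [h₁, h₃], by simp [h₂, h₄]⟩ }

/-- The category with the objects of `D`, and partial maps as morphisms. -/
structure PartialMapCat (_W : MorphismProperty D) where
  /-- The object of `D`. -/
  obj : D

variable {W}

/-- The identity partial map. -/
def PartialMap.id [W.IsMultiplicative] (A : D) : PartialMap W A A :=
  ⟨A, 𝟙 A, W.id_mem A, 𝟙 A⟩

variable [HasPullbacks D] [W.IsMultiplicative] [W.IsStableUnderBaseChange]

/-- Composition of partial maps, by pullback. -/
noncomputable def PartialMap.comp {A B E : D} (p : PartialMap W A B) (q : PartialMap W B E) :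
    PartialMap W A E where
  dom := pullback p.map q.ι
  ι := pullback.fst p.map q.ι ≫ p.ι
  mem := W.comp_mem _ _
    (MorphismProperty.IsStableUnderBaseChange.of_isPullback
      (IsPullback.of_hasPullback p.map q.ι).flip q.mem) p.mem
  map := pullback.snd p.map q.ι ≫ q.map

/-- The composite may be computed with any pullback. -/
theorem PartialMap.rel_comp {A B E : D} {p : PartialMap W A B} {q : PartialMap W B E}
    {r : PartialMap W A E} {x : r.dom ⟶ p.dom} {y : r.dom ⟶ q.dom}
    (h : IsPullback x y p.map q.ι) (h₁ : x ≫ p.ι = r.ι) (h₂ : y ≫ q.map = r.map) :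
    partialMapSetoid W A E r (p.comp q) :=
  ⟨h.isoPullback, by
    change h.isoPullback.hom ≫ pullback.fst _ _ ≫ p.ι = _
    rw [h.isoPullback_hom_fst_assoc, h₁], by
    change h.isoPullback.hom ≫ pullback.snd _ _ ≫ q.map = _
    rw [h.isoPullback_hom_snd_assoc, h₂]⟩

theorem PartialMap.comp_rel {A B E : D} {p p' : PartialMap W A B} {q q' : PartialMap W B E}
    (hp : partialMapSetoid W A B p p') (hq : partialMapSetoid W B E q q') :
    partialMapSetoid W A E (p.comp q) (p'.comp q') := by
  obtain ⟨e, h₁, h₂⟩ := hp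
  obtain ⟨e', h₃, h₄⟩ := hq
  refine PartialMap.rel_comp (x := pullback.fst p.map q.ι ≫ e.hom)
    (y := pullback.snd p.map q.ι ≫ e'.hom) ?_ ?_ ?_
  · exact (IsPullback.of_hasPullback p.map q.ι).of_iso (Iso.refl _) e e' (Iso.refl _)
      (Category.id_comp _).symm (Category.id_comp _).symm
      ((Category.comp_id _).trans h₂.symm) ((Category.comp_id _).trans h₃.symm)
  · exact (Category.assoc _ _ _).trans (congrArg (pullback.fst p.map q.ι ≫ ·) h₁)
  · exact (Category.assoc _ _ _).trans (congrArg (pullback.snd p.map q.ι ≫ ·) h₄)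

noncomputable instance : Category (PartialMapCat W) where
  Hom A B := _root_.Quotient (partialMapSetoid W A.obj B.obj)
  id A := Quotient.mk _ (PartialMap.id A.obj)
  comp {A B E} := Quotient.map₂ PartialMap.comp
    (fun _ _ hp _ _ hq => PartialMap.comp_rel hp hq)
  id_comp := by
    rintro A B ⟨p⟩
    exact (Quotient.sound (PartialMap.rel_comp (x := p.ι) (y := 𝟙 _)
      (IsPullback.of_vert_isIso (f := 𝟙 A.obj) ⟨by simp⟩) (Category.comp_id _)
      (Category.id_comp _))).symm
  comp_id := by
    rintro A B ⟨p⟩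
    exact (Quotient.sound (PartialMap.rel_comp (x := 𝟙 _) (y := p.map)
      (IsPullback.of_horiz_isIso (g := 𝟙 B.obj) ⟨by simp⟩) (Category.id_comp _)
      (Category.comp_id _))).symm
  assoc := by
    rintro A B E F ⟨p⟩ ⟨q⟩ ⟨r⟩
    have P := IsPullback.of_hasPullback p.map q.ι
    have Q := IsPullback.of_hasPullback q.map r.ι
    have R := IsPullback.of_hasPullback (p.comp q).map r.ι
    have w : (pullback.fst (p.comp q).map r.ι ≫ pullback.snd p.map q.ι) ≫ q.map =
        pullback.snd (p.comp q).map r.ι ≫ r.ι := (Category.assoc _ _ _).trans R.w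
    have h₁ := Q.lift_fst _ _ w
    have h₂ := Q.lift_snd _ _ w
    refine Quotient.sound (PartialMap.rel_comp (q := q.comp r)
      (x := pullback.fst (p.comp q).map r.ι ≫ pullback.fst p.map q.ι)
      (y := Q.lift _ _ w) ?_ ?_ ?_)
    · have S : IsPullback (pullback.fst (p.comp q).map r.ι)
          (Q.lift _ _ w ≫ pullback.snd q.map r.ι) (pullback.snd p.map q.ι ≫ q.map) r.ι :=
        h₂.symm ▸ R
      exact IsPullback.paste_horiz (IsPullback.of_bot S h₁.symm Q) P
    · exact Category.assoc _ _ _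
    · change Q.lift _ _ w ≫ pullback.snd _ _ ≫ r.map = _
      exact (Category.assoc _ _ _).symm.trans (congrArg (· ≫ r.map) h₂)

variable (W)

/-- The functor viewing a morphism as an everywhere defined partial map. -/
noncomputable def toPartialMapCat : D ⥤ PartialMapCat W where
  obj A := ⟨A⟩
  map {A B} f := Quotient.mk (partialMapSetoid W A B) ⟨A, 𝟙 A, W.id_mem A, f⟩
  map_id A := rfl
  map_comp {A B E} f g := Quotient.sound (PartialMap.rel_comp (x := 𝟙 A) (y := f)
    (IsPullback.of_horiz_isIso (g := 𝟙 B) ⟨by simp⟩) (Category.id_comp _) rfl)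

end PartialMaps

/-! ### The stable category -/

section Stable

variable (C : Type u) [Category.{v} C] [Pretopos C]

/-- The category of internal preorders and partial maps defined on complemented subobjects. -/
abbrev PaPreOrd := PartialMapCat (complemented (PreOrd C))

variable {C}

/-- There is a congruence diagram between two partial maps `p` and `q`: a subobject `A₀`
complemented in the domains of both, on which they agree, such that they are trivial on the
complements of `A₀`.  (Complemented subobjects compose, so `A₀` is complemented in `A` as well.) -/
def CongruenceDiagram {A B : PreOrd C} (p q : PartialMap (complemented (PreOrd C)) A B) : Prop :=
  ∃ (A₀ A₁ A₂ : PreOrd C) (a₁ : A₀ ⟶ p.dom) (c₁ : A₁ ⟶ p.dom) (a₂ : A₀ ⟶ q.dom)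
    (c₂ : A₂ ⟶ q.dom), IsComplement a₁ c₁ ∧ IsComplement a₂ c₂ ∧
      a₁ ≫ p.ι = a₂ ≫ q.ι ∧ a₁ ≫ p.map = a₂ ≫ q.map ∧
      IsTrivial (PreOrd.isTriv C) (c₁ ≫ p.map) ∧ IsTrivial (PreOrd.isTriv C) (c₂ ≫ q.map)

variable (C)

/-- The relation on partial maps given by the existence of a congruence diagram between
representatives.  It is a congruence, so the quotient by it makes no further identifications. -/
def stableRel : HomRel (PaPreOrd C) := fun A B f g =>
  ∃ p q : PartialMap (complemented (PreOrd C)) A.obj B.obj,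
    f = Quotient.mk _ p ∧ g = Quotient.mk _ q ∧ CongruenceDiagram p q

/-- The stable category of internal preorders. -/
abbrev Stab := CategoryTheory.Quotient (stableRel C)

/-- The canonical functor from preorders to the stable category. -/
noncomputable def sigma : PreOrd C ⥤ Stab C :=
  toPartialMapCat (complemented (PreOrd C)) ⋙ CategoryTheory.Quotient.functor (stableRel C)

/-- The equivalence relations, as objects of the stable category. -/
def stabEq : ObjectProperty (Stab C) := fun A => PreOrd.isEq C A.as.obj

/-- The partial orders, as objects of the stable category. -/
def stabPar : ObjectProperty (Stab C) := fun A => PreOrd.isPar C A.as.obj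

end Stable

end StableCategory

open StableCategory

/-!
# The universal property of the stable category of internal preorders

*The stable category.*  In `PreOrd C`, complementary subobjects are the same as decompositions into
sums, and they are stable under pullback.  A partial map `A ⇀ B` defined on a complemented subobject
is therefore the same as a morphism `A ⟶ addPoint B` to the preorder `B` with an isolated point
added: everything outside of the domain is sent to that point (`IsTotalization`).  In these terms,
composition of partial maps is Kleisli composition (`IsTotalization.comp`), and the relation between
partial maps that defines the stable category becomes `StablyEq`: two morphisms are stably equal
when their domain is a sum of a part on which they agree and of a part on which both are trivial
(`congruenceDiagram_iff`).  It is a congruence, and two facts about the canonical functor `Σ`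
follow, from which everything else about the stable category is derived:

* `Σ f = Σ g` if and only if `f` and `g` are stably equal (`sigma_map_eq_iff`);
* `Σ (toAddPoint B)` is invertible, and every morphism `φ : Σ A ⟶ Σ B` is a fraction
  `Σ f ≫ (Σ (toAddPoint B))⁻¹` with `f : A ⟶ addPoint B` (`exists_comp_sigma_toAddPoint`).

So the zero objects of the stable category are the trivial preorders, and sums of preorders are
coproducts in the stable category.  Relative kernels become kernels because a trivial composite with
a relative kernel forces triviality.  Relative cokernels become cokernels because morphisms to a
discrete preorder are trivial: complementary subobjects of the codomain of `f` are classified by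
such a morphism, hence descend to a relative cokernel of `f`
(`IsCokernelRel.exists_isComplement`).

*The pretorsion theory.*  Triviality of a morphism means that it identifies comparable elements
(`PreOrd.isTrivial_iff`).  The short exact sequence of a preorder `A` is given by the quotient of
`A` by the equivalence relation `a ≤ b ≤ a`, ordered by the image of the order of `A`
(`exists_isShortExactRel`).  Relative cokernels of arbitrary morphisms exist because of transitive
closures (`exists_isCokernelRel`).  Both are computed with generalized elements, up to a regular
epimorphism.

*The universal property.*  An object that is both torsion and torsion-free is zero, so `G` sends
trivial preorders to zero objects.  As it preserves sums, it identifies stably equal morphisms and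
inverts `toAddPoint B`.  The induced functor is then forced to send the fraction above to
`G f ≫ (G (toAddPoint B))⁻¹` (`stableExtension`).  Kernels and cokernels in the stable category are,
up to isomorphism, images of relative kernels and cokernels of the numerators `f`, which gives the
last statement.
-/


namespace StableCategory

open PreOrd

/-! ### Trivial morphisms -/

section TrivialMorphisms

variable {D : Type u} [Category.{v} D] {Z : ObjectProperty D}

theorem IsTrivial.of_source {A B : D} (hA : Z A) (f : A ⟶ B) : IsTrivial Z f :=
  ⟨A, hA, 𝟙 A, f, Category.id_comp f⟩

theorem IsTrivial.of_target {A B : D} (hB : Z B) (f : A ⟶ B) : IsTrivial Z f :=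
  ⟨B, hB, f, 𝟙 B, Category.comp_id f⟩

theorem IsTrivial.comp_left {A B E : D} {f : B ⟶ E} (hf : IsTrivial Z f) (e : A ⟶ B) :
    IsTrivial Z (e ≫ f) := by
  obtain ⟨W, hW, g, h, rfl⟩ := hf
  exact ⟨W, hW, e ≫ g, h, Category.assoc _ _ _⟩

theorem IsTrivial.comp_right {A B E : D} {f : A ⟶ B} (hf : IsTrivial Z f) (e : B ⟶ E) :
    IsTrivial Z (f ≫ e) := by
  obtain ⟨W, hW, g, h, rfl⟩ := hf
  exact ⟨W, hW, g, h ≫ e, (Category.assoc _ _ _).symm⟩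

theorem IsTrivial.of_comp_isIso {A B E : D} {f : A ⟶ B} {e : B ⟶ E} [IsIso e]
    (hf : IsTrivial Z (f ≫ e)) : IsTrivial Z f := by
  simpa using hf.comp_right (inv e)

theorem IsTrivial.map {X : Type u'} [Category.{v'} X] {Z' : ObjectProperty X} {G : D ⥤ X}
    (hG : ∀ A, Z A → Z' (G.obj A)) {A B : D} {f : A ⟶ B} (hf : IsTrivial Z f) :
    IsTrivial Z' (G.map f) := by
  obtain ⟨W, hW, g, h, rfl⟩ := hf
  exact ⟨G.obj W, hG W hW, G.map g, G.map h, (G.map_comp _ _).symm⟩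

/-- Between two given objects there is at most one zero morphism. -/
theorem IsTrivial.eq {A B : D} {f g : A ⟶ B} (hf : IsTrivial (zeroObjects D) f)
    (hg : IsTrivial (zeroObjects D) g) : f = g := by
  obtain ⟨W, hW, a, b, rfl⟩ := hf
  obtain ⟨V, hV, c, d, rfl⟩ := hg
  rw [hW.eq_of_tgt a (c ≫ hV.to_ W), Category.assoc, hV.eq_of_src (hV.to_ W ≫ b) d]

theorem isTrivial_zeroObjects [HasZeroObject D] (A B : D) :
    ∃ f : A ⟶ B, IsTrivial (zeroObjects D) f := by
  obtain ⟨O, hO⟩ := HasZeroObject.zero (C := D)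
  exact ⟨hO.from_ A ≫ hO.to_ B, O, hO, _, _, rfl⟩

/-! ### Kernels and cokernels relative to a class of trivial objects -/

theorem IsKernelRel.mono {K A B : D} {k : K ⟶ A} {f : A ⟶ B} (h : IsKernelRel Z k f) :
    Mono k :=
  ⟨fun a b e => (h.2 (a ≫ k) (by
    rw [Category.assoc]; exact h.1.comp_left a)).unique rfl e.symm⟩

theorem IsCokernelRel.epi {A B Q : D} {q : B ⟶ Q} {f : A ⟶ B} (h : IsCokernelRel Z q f) :
    Epi q :=
  ⟨fun a b e => (h.2 (q ≫ a) (by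
    rw [← Category.assoc]; exact h.1.comp_right a)).unique rfl e.symm⟩

theorem IsKernelRel.of_mono {K A B : D} {k : K ⟶ A} {f : A ⟶ B} [Mono k]
    (h : IsTrivial Z (k ≫ f))
    (h' : ∀ ⦃Y : D⦄ (l : Y ⟶ A), IsTrivial Z (l ≫ f) → ∃ m : Y ⟶ K, m ≫ k = l) :
    IsKernelRel Z k f :=
  ⟨h, fun _ l hl => (h' l hl).imp fun m hm => ⟨hm, fun n hn => by
    rw [← cancel_mono k]; exact hn.trans hm.symm⟩⟩

theorem IsCokernelRel.of_epi {A B Q : D} {q : B ⟶ Q} {f : A ⟶ B} [Epi q]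
    (h : IsTrivial Z (f ≫ q))
    (h' : ∀ ⦃Y : D⦄ (l : B ⟶ Y), IsTrivial Z (f ≫ l) → ∃ m : Q ⟶ Y, q ≫ m = l) :
    IsCokernelRel Z q f :=
  ⟨h, fun _ l hl => (h' l hl).imp fun m hm => ⟨hm, fun n hn => by
    rw [← cancel_epi q]; exact hn.trans hm.symm⟩⟩

theorem IsKernelRel.exists_iso {K K' A B : D} {k : K ⟶ A} {k' : K' ⟶ A} {f : A ⟶ B}
    (h : IsKernelRel Z k f) (h' : IsKernelRel Z k' f) : ∃ e : K ≅ K', e.hom ≫ k' = k := by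
  have := h.mono
  have := h'.mono
  obtain ⟨a, ha, -⟩ := h'.2 k h.1
  obtain ⟨b, hb, -⟩ := h.2 k' h'.1
  exact ⟨⟨a, b, by rw [← cancel_mono k]; simp [hb, ha],
    by rw [← cancel_mono k']; simp [hb, ha]⟩, ha⟩

theorem IsCokernelRel.exists_iso {A B Q Q' : D} {q : B ⟶ Q} {q' : B ⟶ Q'} {f : A ⟶ B}
    (h : IsCokernelRel Z q f) (h' : IsCokernelRel Z q' f) :
    ∃ e : Q ≅ Q', q ≫ e.hom = q' := by
  have := h.epi
  have := h'.epi
  obtain ⟨a, ha, -⟩ := h.2 q' h'.1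
  obtain ⟨b, hb, -⟩ := h'.2 q h.1
  exact ⟨⟨a, b, by rw [← cancel_epi q]; simp [reassoc_of% ha, hb],
    by rw [← cancel_epi q']; simp [reassoc_of% hb, ha]⟩, ha⟩

theorem IsKernelRel.iso_comp {K K' A B : D} {k : K ⟶ A} {f : A ⟶ B} (h : IsKernelRel Z k f)
    (e : K' ⟶ K) [IsIso e] : IsKernelRel Z (e ≫ k) f := by
  have := h.mono
  refine .of_mono (by rw [Category.assoc]; exact h.1.comp_left e) fun Y l hl => ?_
  obtain ⟨m, hm, -⟩ := h.2 l hl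
  exact ⟨m ≫ inv e, by simpa using hm⟩

theorem IsCokernelRel.comp_iso {A B Q Q' : D} {q : B ⟶ Q} {f : A ⟶ B}
    (h : IsCokernelRel Z q f) (e : Q ⟶ Q') [IsIso e] : IsCokernelRel Z (q ≫ e) f := by
  have := h.epi
  refine .of_epi (by rw [← Category.assoc]; exact h.1.comp_right e) fun Y l hl => ?_
  obtain ⟨m, hm, -⟩ := h.2 l hl
  exact ⟨inv e ≫ m, by simpa using hm⟩

/-- A kernel does not change when the morphism is followed by an isomorphism. -/
theorem isKernelRel_comp_iso_iff {K A B E : D} {k : K ⟶ A} {f : A ⟶ B} (e : B ⟶ E) [IsIso e] :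
    IsKernelRel Z k (f ≫ e) ↔ IsKernelRel Z k f := by
  have key {Y : D} (l : Y ⟶ A) : IsTrivial Z (l ≫ f ≫ e) ↔ IsTrivial Z (l ≫ f) := by
    rw [← Category.assoc]
    exact ⟨fun h => h.of_comp_isIso, fun h => h.comp_right e⟩
  simp only [IsKernelRel, key]

/-- If `q` is a cokernel of `f ≫ e`, with `e` invertible, then `e ≫ q` is a cokernel of `f`. -/
theorem IsCokernelRel.of_comp_iso {A B E Q : D} {f : A ⟶ B} {e : B ⟶ E} [IsIso e] {q : E ⟶ Q}
    (h : IsCokernelRel Z q (f ≫ e)) : IsCokernelRel Z (e ≫ q) f := by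
  have := h.epi
  refine .of_epi (by rw [← Category.assoc]; exact h.1) fun Y l hl => ?_
  obtain ⟨m, hm, -⟩ := h.2 (inv e ≫ l) (by simpa using hl)
  exact ⟨m, by rw [Category.assoc, hm, IsIso.hom_inv_id_assoc]⟩

end TrivialMorphisms

/-! ### Trivial morphisms and sums of internal preorders -/

namespace PreOrd

section Basic

variable {C : Type u} [Category.{v} C]

theorem isTriv_iff (A : PreOrd C) : isTriv C A ↔ A.r₁ = A.r₂ := by
  constructor
  · rintro ⟨⟨e⟩, h⟩
    exact h _ _ ⟨𝟙 _, Category.id_comp _, Category.id_comp _⟩ ⟨e.s, e.symmetry₁, e.symmetry₂⟩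
  · intro h
    exact ⟨⟨{ right_cancellation := A.mono.right_cancellation, s := 𝟙 _,
              symmetry₁ := by simp [h], symmetry₂ := by simp [h] }⟩, by
      rintro W _ _ ⟨t, rfl, rfl⟩ -
      rw [h]⟩

theorem le_comp {A B : PreOrd C} (f : A ⟶ B) {W : C} {a b : W ⟶ A.carrier} (h : A.Le a b) :
    B.Le (a ≫ base f) (b ≫ base f) := by
  obtain ⟨t, rfl, rfl⟩ := h
  exact ⟨t ≫ hat f, by rw [Category.assoc, ← w₁, Category.assoc],
    by rw [Category.assoc, ← w₂, Category.assoc]⟩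

theorem le_precomp {A : PreOrd C} {V W : C} {a b : W ⟶ A.carrier} (h : A.Le a b) (e : V ⟶ W) :
    A.Le (e ≫ a) (e ≫ b) := by
  obtain ⟨t, rfl, rfl⟩ := h
  exact ⟨e ≫ t, Category.assoc _ _ _, Category.assoc _ _ _⟩

theorem le_of_isSum {A : PreOrd C} {W W₀ W₁ : C} {p : W₀ ⟶ W} {q : W₁ ⟶ W} (h : IsSum p q)
    {a b : W ⟶ A.carrier} (h₀ : A.Le (p ≫ a) (p ≫ b)) (h₁ : A.Le (q ≫ a) (q ≫ b)) :
    A.Le a b := by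
  obtain ⟨s, s₁, s₂⟩ := h₀
  obtain ⟨t, t₁, t₂⟩ := h₁
  obtain ⟨d, d₁, d₂⟩ := h.exists_desc s t
  exact ⟨d, h.hom_ext (by rw [reassoc_of% d₁, s₁]) (by rw [reassoc_of% d₂, t₁]),
    h.hom_ext (by rw [reassoc_of% d₁, s₂]) (by rw [reassoc_of% d₂, t₂])⟩

theorem le_r (A : PreOrd C) : A.Le A.r₁ A.r₂ := ⟨𝟙 _, Category.id_comp _, Category.id_comp _⟩

/-- A morphism of preorders from a morphism which is monotone on generalized elements. -/
noncomputable def homOfLe {A B : PreOrd C} (f : A.carrier ⟶ B.carrier)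
    (h : B.Le (A.r₁ ≫ f) (A.r₂ ≫ f)) : A ⟶ B :=
  Hom.mk f h.choose h.choose_spec.1.symm h.choose_spec.2.symm

theorem isEq_iff (A : PreOrd C) :
    isEq C A ↔ ∀ ⦃W : C⦄ (a b : W ⟶ A.carrier), A.Le a b → A.Le b a := by
  constructor
  · rintro ⟨e⟩ W _ _ ⟨t, rfl, rfl⟩
    exact ⟨t ≫ e.s, by rw [Category.assoc, e.symmetry₁], by rw [Category.assoc, e.symmetry₂]⟩
  · intro h
    obtain ⟨s, h₁, h₂⟩ := h _ _ A.le_r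
    exact ⟨{ right_cancellation := A.mono.right_cancellation, s := s,
             symmetry₁ := h₁, symmetry₂ := h₂ }⟩

theorem isEq_of_iso {A B : PreOrd C} (e : A ≅ B) (hA : isEq C A) : isEq C B := by
  rw [isEq_iff] at hA ⊢
  intro W a b h
  have h₁ := base_eq e.inv_hom_id
  rw [base_comp, base_id] at h₁
  simpa [h₁] using le_comp e.hom (hA _ _ (le_comp e.inv h))

theorem isPar_of_iso {A B : PreOrd C} (e : A ≅ B) (hA : isPar C A) : isPar C B := by
  intro W a b h h'
  have h₁ := base_eq e.inv_hom_id
  rw [base_comp, base_id] at h₁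
  simpa [h₁] using (hA _ _ (le_comp e.inv h) (le_comp e.inv h')) =≫ base e.hom

theorem isPullback_of_base_hat {P A B E : PreOrd C} {p : P ⟶ A} {q : P ⟶ B} {f : A ⟶ E}
    {g : B ⟶ E} (h : IsPullback (base p) (base q) (base f) (base g))
    (h' : IsPullback (hat p) (hat q) (hat f) (hat g)) : IsPullback p q f g := by
  refine ⟨⟨hom_ext h.w⟩, ⟨PullbackCone.IsLimit.mk _
    (fun s => Hom.mk (h.lift (base s.fst) (base s.snd) (base_eq s.condition))
      (h'.lift (hat s.fst) (hat s.snd) (hat_eq s.condition)) ?_ ?_)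
    (fun s => hom_ext (h.lift_fst _ _ _)) (fun s => hom_ext (h.lift_snd _ _ _))
    (fun s m h₁ h₂ => hom_ext (h.hom_ext ?_ ?_))⟩⟩
  · apply h.hom_ext
    · rw [Category.assoc, h.lift_fst, Category.assoc, w₁ p, h'.lift_fst_assoc, w₁]
    · rw [Category.assoc, h.lift_snd, Category.assoc, w₁ q, h'.lift_snd_assoc, w₁]
  · apply h.hom_ext
    · rw [Category.assoc, h.lift_fst, Category.assoc, w₂ p, h'.lift_fst_assoc, w₂]
    · rw [Category.assoc, h.lift_snd, Category.assoc, w₂ q, h'.lift_snd_assoc, w₂]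
  · exact (base_eq h₁).trans (h.lift_fst _ _ _).symm
  · exact (base_eq h₂).trans (h.lift_snd _ _ _).symm

variable [HasPullbacks C]

theorem isTriv_disc (A : C) : isTriv C (disc A) := (isTriv_iff _).2 rfl

/-- A morphism of preorders is trivial exactly when it identifies comparable elements: it then
factors through the discrete preorder on its codomain. -/
theorem isTrivial_iff {A B : PreOrd C} (f : A ⟶ B) :
    IsTrivial (isTriv C) f ↔ A.r₁ ≫ base f = A.r₂ ≫ base f := by
  constructor
  · rintro ⟨W, hW, g, h, rfl⟩
    rw [base_comp, reassoc_of% w₁ g, reassoc_of% w₂ g, (isTriv_iff W).1 hW]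
  · intro h
    exact ⟨disc B.carrier, isTriv_disc _, Hom.mk (base (B := B) f) (A.r₁ ≫ base f)
      (Category.comp_id _).symm (h.symm.trans (Category.comp_id _).symm), discHom (𝟙 _),
      hom_ext (Category.comp_id _)⟩

theorem isTrivial_of_isEq_of_isPar {A B : PreOrd C} (f : A ⟶ B) (hA : isEq C A)
    (hB : isPar C B) : IsTrivial (isTriv C) f := by
  rw [isTrivial_iff]
  exact hB _ _ (le_comp f A.le_r) (le_comp f ((isEq_iff A).1 hA _ _ A.le_r))

theorem isTrivial_of_comp_mono {A B E : PreOrd C} {f : A ⟶ B} (m : B ⟶ E) [Mono m]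
    (h : IsTrivial (isTriv C) (f ≫ m)) : IsTrivial (isTriv C) f := by
  rw [isTrivial_iff] at h ⊢
  have := mono_base m inferInstance
  rw [← cancel_mono (base m)]
  simpa using h

end Basic

section Sums

variable {C : Type u} [Category.{v} C] [HasPullbacks C] [FinitaryExtensive C]

theorem isComplement_sum (A B : PreOrd C) : IsComplement (sumInl A B) (sumInr A B) :=
  (isComplement_iff _ _).2 ⟨isSum_coprod _ _, isSum_coprod _ _⟩

@[simp]
theorem sumInl_desc {A B E : PreOrd C} (f : A ⟶ E) (g : B ⟶ E) :
    sumInl A B ≫ sumDesc f g = f := hom_ext (coprod.inl_desc _ _)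

@[simp]
theorem sumInr_desc {A B E : PreOrd C} (f : A ⟶ E) (g : B ⟶ E) :
    sumInr A B ≫ sumDesc f g = g := hom_ext (coprod.inr_desc _ _)

@[simp]
theorem sumInl_desc_assoc {A B E Y : PreOrd C} (f : A ⟶ E) (g : B ⟶ E) (h : E ⟶ Y) :
    sumInl A B ≫ sumDesc f g ≫ h = f ≫ h := by
  rw [← Category.assoc, sumInl_desc]

@[simp]
theorem sumInr_desc_assoc {A B E Y : PreOrd C} (f : A ⟶ E) (g : B ⟶ E) (h : E ⟶ Y) :
    sumInr A B ≫ sumDesc f g ≫ h = g ≫ h := by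
  rw [← Category.assoc, sumInr_desc]

theorem sum_hom_ext {A B E : PreOrd C} {f g : sum A B ⟶ E}
    (h₁ : sumInl A B ≫ f = sumInl A B ≫ g) (h₂ : sumInr A B ≫ f = sumInr A B ≫ g) : f = g :=
  hom_ext (coprod.hom_ext (base_eq h₁) (base_eq h₂))

end Sums

end PreOrd

section Complements

variable {C : Type u} [Category.{v} C] [HasPullbacks C] [FinitaryExtensive C]
variable {A A' B : PreOrd C} {α : A ⟶ B} {β : A' ⟶ B}

theorem IsComplement.hom_ext (h : IsComplement α β) {Y : PreOrd C} {f g : B ⟶ Y}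
    (h₁ : α ≫ f = α ≫ g) (h₂ : β ≫ f = β ≫ g) : f = g :=
  PreOrd.hom_ext (((isComplement_iff α β).1 h).1.hom_ext (base_eq h₁) (base_eq h₂))

theorem IsComplement.exists_desc (h : IsComplement α β) {Y : PreOrd C} (f : A ⟶ Y)
    (g : A' ⟶ Y) : ∃ d : B ⟶ Y, α ≫ d = f ∧ β ≫ d = g := by
  rw [isComplement_iff] at h
  obtain ⟨d, h₁, h₂⟩ := h.1.exists_desc (base f) (base g)
  obtain ⟨e, h₃, h₄⟩ := h.2.exists_desc (hat f) (hat g)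
  refine ⟨Hom.mk d e (h.2.hom_ext ?_ ?_) (h.2.hom_ext ?_ ?_), PreOrd.hom_ext h₁, PreOrd.hom_ext h₂⟩
  · rw [← reassoc_of% w₁ α, h₁, reassoc_of% h₃, w₁]
  · rw [← reassoc_of% w₁ β, h₂, reassoc_of% h₄, w₁]
  · rw [← reassoc_of% w₂ α, h₁, reassoc_of% h₃, w₂]
  · rw [← reassoc_of% w₂ β, h₂, reassoc_of% h₄, w₂]

/-- Complementary subobjects of a preorder exhibit it as the sum of the two. -/
theorem IsComplement.isSum (h : IsComplement α β) : IsSum α β :=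
  isSum_of (fun _ => h.exists_desc) (fun _ _ _ => h.hom_ext)

theorem IsComplement.symm (h : IsComplement α β) : IsComplement β α := by
  rw [isComplement_iff] at h ⊢
  have key {A B S : C} {i : A ⟶ S} {j : B ⟶ S} (h : IsSum i j) : IsSum j i :=
    isSum_of (fun _ x y => (h.exists_desc y x).imp fun _ hd => hd.symm)
      (fun _ _ _ h₁ h₂ => h.hom_ext h₂ h₁)
  exact ⟨key h.1, key h.2⟩

/-- Complementary subobjects are stable under pullback. -/
theorem IsComplement.of_isPullback (h : IsComplement α β) {P P' W : PreOrd C} {f : W ⟶ B}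
    {p : P ⟶ W} {a : P ⟶ A} {q : P' ⟶ W} {b : P' ⟶ A'} (hp : IsPullback p a f α)
    (hq : IsPullback q b f β) : IsComplement p q := by
  rw [isComplement_iff] at h ⊢
  have hp := isPullback_base_hat hp
  have hq := isPullback_base_hat hq
  exact ⟨h.1.of_isPullback hp.1 hq.1, h.2.of_isPullback hp.2 hq.2⟩

/-- A morphism that respects two decompositions into complementary subobjects exhibits the first
decomposition as a pullback of the second. -/
theorem IsComplement.isPullback (h : IsComplement α β) {P P' W : PreOrd C} {f : W ⟶ B}
    {p : P ⟶ W} {a : P ⟶ A} {q : P' ⟶ W} {b : P' ⟶ A'} (h' : IsComplement p q)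
    (hp : p ≫ f = a ≫ α) (hq : q ≫ f = b ≫ β) : IsPullback p a f α ∧ IsPullback q b f β := by
  rw [isComplement_iff] at h h'
  have h₁ := h.1.isPullback h'.1 (base_eq hp) (base_eq hq)
  have h₂ := h.2.isPullback h'.2 (hat_eq hp) (hat_eq hq)
  exact ⟨isPullback_of_base_hat h₁.1 h₂.1, isPullback_of_base_hat h₁.2 h₂.2⟩

theorem IsComplement.split (h : IsComplement α β) {W : PreOrd C} (f : W ⟶ B) :
    ∃ (P P' : PreOrd C) (p : P ⟶ W) (q : P' ⟶ W) (a : P ⟶ A) (b : P' ⟶ A'),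
      IsComplement p q ∧ p ≫ f = a ≫ α ∧ q ≫ f = b ≫ β :=
  ⟨_, _, pbFst f α, pbFst f β, pbSnd f α, pbSnd f β,
    h.of_isPullback (isPullback_pb f α) (isPullback_pb f β), (isPullback_pb f α).w,
    (isPullback_pb f β).w⟩

theorem IsComplement.assoc (h : IsComplement α β) {P P' : PreOrd C} {γ : P ⟶ A} {δ : P' ⟶ A}
    (h' : IsComplement γ δ) : IsComplement (γ ≫ α) (sumDesc (δ ≫ α) β) := by
  rw [isComplement_iff] at h h' ⊢
  exact ⟨h'.1.assoc h.1 (isSum_coprod _ _) (coprod.inl_desc _ _) (coprod.inr_desc _ _),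
    h'.2.assoc h.2 (isSum_coprod _ _) (coprod.inl_desc _ _) (coprod.inr_desc _ _)⟩

theorem IsComplement.isTrivial_iff (h : IsComplement α β) {Y : PreOrd C} (f : B ⟶ Y) :
    IsTrivial (isTriv C) f ↔ IsTrivial (isTriv C) (α ≫ f) ∧ IsTrivial (isTriv C) (β ≫ f) := by
  refine ⟨fun hf => ⟨hf.comp_left α, hf.comp_left β⟩, ?_⟩
  rw [isComplement_iff] at h
  simp only [PreOrd.isTrivial_iff, base_comp, reassoc_of% w₁ α, reassoc_of% w₂ α,
    reassoc_of% w₁ β, reassoc_of% w₂ β]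
  exact fun hf => h.2.hom_ext hf.1 hf.2

end Complements

section StablyEqual

variable {C : Type u} [Category.{v} C]

/-! ### Agreement up to trivial morphisms on a complemented part -/

/-- Two morphisms of preorders are stably equal when their domain is the sum of a part on which
they agree and of a part on which both are trivial. -/
def StablyEq {A B : PreOrd C} (f g : A ⟶ B) : Prop :=
  ∃ (A₀ A₁ : PreOrd C) (α : A₀ ⟶ A) (β : A₁ ⟶ A), IsComplement α β ∧ α ≫ f = α ≫ g ∧
    IsTrivial (isTriv C) (β ≫ f) ∧ IsTrivial (isTriv C) (β ≫ g)

namespace StablyEq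

variable {A B E : PreOrd C}

theorem symm {f g : A ⟶ B} : StablyEq f g → StablyEq g f :=
  fun ⟨_, _, α, β, h, e, hf, hg⟩ => ⟨_, _, α, β, h, e.symm, hg, hf⟩

theorem comp_right {f g : A ⟶ B} (e : B ⟶ E) : StablyEq f g → StablyEq (f ≫ e) (g ≫ e) := by
  rintro ⟨A₀, A₁, α, β, h, w, hf, hg⟩
  refine ⟨_, _, α, β, h, ?_, ?_, ?_⟩
  · rw [reassoc_of% w]
  · rw [← Category.assoc]
    exact hf.comp_right e
  · rw [← Category.assoc]
    exact hg.comp_right e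

theorem of_comp_mono [HasPullbacks C] {f g : A ⟶ B} (m : B ⟶ E) [Mono m] :
    StablyEq (f ≫ m) (g ≫ m) → StablyEq f g := by
  rintro ⟨A₀, A₁, α, β, h, w, hf, hg⟩
  refine ⟨_, _, α, β, h, ?_, isTrivial_of_comp_mono m ?_, isTrivial_of_comp_mono m ?_⟩
  · rw [← cancel_mono m]
    simpa using w
  · simpa using hf
  · simpa using hg

end StablyEq

variable [HasPullbacks C] [FinitaryExtensive C]

theorem isComplement_id (A : PreOrd C) : IsComplement (𝟙 A) ((discInitial C).to A) := by
  rw [isComplement_iff]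
  constructor <;>
  exact isSum_of (fun _ x _ => ⟨x, Category.id_comp _, initial.hom_ext _ _⟩)
    (fun _ x y h _ => by simpa using h)

theorem IsComplement.eq_of_disjoint {A A' B : PreOrd C} {α : A ⟶ B} {β : A' ⟶ B}
    (h : IsComplement α β) {W Y : PreOrd C} {a : W ⟶ A} {b : W ⟶ A'} (w : a ≫ α = b ≫ β)
    (x y : W ⟶ Y) : x = y :=
  PreOrd.hom_ext (((isComplement_iff α β).1 h).1.eq_of_disjoint (base_eq w) _ _)

theorem IsComplement.isTrivial_of_disjoint {A A' B : PreOrd C} {α : A ⟶ B} {β : A' ⟶ B}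
    (h : IsComplement α β) {W Y : PreOrd C} {a : W ⟶ A} {b : W ⟶ A'} (w : a ≫ α = b ≫ β)
    (f : W ⟶ Y) : IsTrivial (isTriv C) f := by
  rw [PreOrd.isTrivial_iff]
  exact ((isComplement_iff α β).1 h).1.eq_of_disjoint (a := W.r₁ ≫ base a) (b := W.r₁ ≫ base b)
    (by simpa using W.r₁ ≫= base_eq w) _ _

/-- Being trivial on a complement of `α` does not depend on the choice of the complement. -/
theorem IsComplement.isTrivial_of_isComplement {A A' A'' B Y : PreOrd C} {α : A ⟶ B}
    {β : A' ⟶ B} {β' : A'' ⟶ B} (h : IsComplement α β) (h' : IsComplement α β') {f : B ⟶ Y}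
    (hf : IsTrivial (isTriv C) (β ≫ f)) : IsTrivial (isTriv C) (β' ≫ f) := by
  obtain ⟨P, P', p, q, a, b, hpq, hp, hq⟩ := h.split β'
  rw [hpq.isTrivial_iff]
  refine ⟨h'.isTrivial_of_disjoint hp.symm _, ?_⟩
  rw [reassoc_of% hq]
  exact hf.comp_left b

namespace StablyEq

variable {A B E : PreOrd C}

theorem refl (f : A ⟶ B) : StablyEq f f :=
  ⟨_, _, _, _, isComplement_id A, rfl, .of_source (isTriv_disc _) _,
    .of_source (isTriv_disc _) _⟩

theorem trans {f g k : A ⟶ B} : StablyEq f g → StablyEq g k → StablyEq f k := by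
  rintro ⟨A₀, A₁, α, β, h, e, hf, hg⟩ ⟨A₀', A₁', α', β', h', e', hg', hk⟩
  obtain ⟨P, P', p, q, a, b, hpq, hp, hq⟩ := h'.split α
  refine ⟨_, _, _, _, h.assoc hpq, ?_, ?_, ?_⟩
  · rw [Category.assoc, e, reassoc_of% hp, e', Category.assoc, reassoc_of% hp]
  · rw [(isComplement_sum _ _).isTrivial_iff, sumInl_desc_assoc, sumInr_desc_assoc]
    refine ⟨?_, hf⟩
    rw [Category.assoc, e, reassoc_of% hq]
    exact hg'.comp_left b
  · rw [(isComplement_sum _ _).isTrivial_iff, sumInl_desc_assoc, sumInr_desc_assoc]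
    constructor
    · rw [Category.assoc, reassoc_of% hq]
      exact hk.comp_left b
    · obtain ⟨R, R', r, s, c, d, hrs, hr, hs⟩ := h'.split β
      rw [hrs.isTrivial_iff]
      constructor
      · rw [reassoc_of% hr, ← e', ← reassoc_of% hr]
        exact hg.comp_left r
      · rw [reassoc_of% hs]
        exact hk.comp_left d

theorem comp_left {f g : A ⟶ B} (e : E ⟶ A) : StablyEq f g → StablyEq (e ≫ f) (e ≫ g) := by
  rintro ⟨A₀, A₁, α, β, h, w, hf, hg⟩
  obtain ⟨P, P', p, q, a, b, hpq, hp, hq⟩ := h.split e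
  refine ⟨_, _, p, q, hpq, ?_, ?_, ?_⟩
  · rw [reassoc_of% hp, w, reassoc_of% hp]
  · rw [reassoc_of% hq]
    exact hf.comp_left b
  · rw [reassoc_of% hq]
    exact hg.comp_left b

theorem of_isTrivial {f g : A ⟶ B} (hf : IsTrivial (isTriv C) f)
    (hg : IsTrivial (isTriv C) g) : StablyEq f g :=
  ⟨_, _, _, _, (isComplement_id A).symm, (discInitial C).hom_ext _ _, hf.comp_left _,
    hg.comp_left _⟩

theorem isTrivial {f g : A ⟶ B} (h : StablyEq f g) (hg : IsTrivial (isTriv C) g) :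
    IsTrivial (isTriv C) f := by
  obtain ⟨A₀, A₁, α, β, h, w, hf, -⟩ := h
  rw [h.isTrivial_iff]
  exact ⟨w ▸ hg.comp_left α, hf⟩

theorem of_left {A₀ A₁ : PreOrd C} {α : A₀ ⟶ A} {β : A₁ ⟶ A} (h : IsComplement α β)
    {f g : A ⟶ B} (h₀ : StablyEq (α ≫ f) (α ≫ g)) (h₁ : β ≫ f = β ≫ g) : StablyEq f g := by
  obtain ⟨P, P', p, q, hpq, e, hf, hg⟩ := h₀
  refine ⟨_, _, _, _, (h.assoc hpq.symm).symm, sum_hom_ext ?_ ?_, ?_, ?_⟩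
  · simpa using e
  · simpa using h₁
  · simpa using hf
  · simpa using hg

/-- Stable equality can be checked on the two parts of a sum. -/
theorem of_isComplement {A₀ A₁ : PreOrd C} {α : A₀ ⟶ A} {β : A₁ ⟶ A} (h : IsComplement α β)
    {f g : A ⟶ B} (h₀ : StablyEq (α ≫ f) (α ≫ g)) (h₁ : StablyEq (β ≫ f) (β ≫ g)) :
    StablyEq f g := by
  obtain ⟨d, hα, hβ⟩ := h.exists_desc (α ≫ f) (β ≫ g)
  exact trans (of_left h.symm (by rwa [hβ]) hα.symm) (of_left h (by rwa [hα]) hβ)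

end StablyEq

end StablyEqual

/-! ### Partial maps as total maps into a preorder with an added point -/

section Totalization

variable {C : Type u} [Category.{v} C] [Pretopos C]

/-- The preorder obtained by adding an isolated point.  A partial map `A ⇀ B` defined on a
complemented subobject is the same as a morphism `A ⟶ addPoint B`. -/
noncomputable abbrev addPoint (B : PreOrd C) : PreOrd C := sum B (disc (⊤_ C))

/-- The inclusion of a preorder into the preorder with an added point. -/
noncomputable abbrev toAddPoint (B : PreOrd C) : B ⟶ addPoint B := sumInl B (disc (⊤_ C))

/-- The inclusion of the added point. -/
noncomputable abbrev point (B : PreOrd C) : disc (⊤_ C) ⟶ addPoint B := sumInr B (disc (⊤_ C))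

/-- Extension along `toAddPoint` that fixes the added point (the Kleisli extension). -/
noncomputable abbrev addPointExt {B E : PreOrd C} (g : B ⟶ addPoint E) :
    addPoint B ⟶ addPoint E := sumDesc g (point E)

theorem discTop_hom_ext {A : PreOrd C} (f g : A ⟶ disc (⊤_ C)) : f = g :=
  PreOrd.hom_ext (terminal.hom_ext _ _)

theorem exists_discTop_hom (A : PreOrd C) : ∃ _ : A ⟶ disc (⊤_ C), True :=
  ⟨Hom.mk (terminal.from _) (terminal.from _) (terminal.hom_ext _ _) (terminal.hom_ext _ _),
    trivial⟩

theorem isComplement_addPoint (B : PreOrd C) : IsComplement (toAddPoint B) (point B) :=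
  isComplement_sum _ _

instance (B : PreOrd C) : Mono (toAddPoint B) := (isComplement_addPoint B).mono_left

variable {A B E : PreOrd C}

/-- The total map `f` sends the domain of the partial map `p` to `B` through `p`, and everything
else to the added point. -/
def IsTotalization (p : PartialMap (complemented (PreOrd C)) A B) (f : A ⟶ addPoint B) : Prop :=
  IsPullback p.ι p.map f (toAddPoint B)

theorem exists_isTotalization (p : PartialMap (complemented (PreOrd C)) A B) :
    ∃ f, IsTotalization p f := by
  obtain ⟨A', β, h⟩ := p.mem
  obtain ⟨t, -⟩ := exists_discTop_hom A'
  obtain ⟨f, h₁, h₂⟩ := h.exists_desc (p.map ≫ toAddPoint B) (t ≫ point B)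
  exact ⟨f, ((isComplement_addPoint B).isPullback h h₁ h₂).1⟩

theorem IsTotalization.comp_complement {p : PartialMap (complemented (PreOrd C)) A B}
    {f : A ⟶ addPoint B} (hf : IsTotalization p f) {A' : PreOrd C} {β : A' ⟶ A}
    (h : IsComplement p.ι β) (t : A' ⟶ disc (⊤_ C)) : β ≫ f = t ≫ point B := by
  obtain ⟨P, P', u, u', a, b, huu, hu, hu'⟩ := (isComplement_addPoint B).split (β ≫ f)
  refine huu.hom_ext ?_ ?_
  · -- points of the complement that are sent into `B` would lie in the domain of `p`
    have w : (u ≫ β) ≫ f = a ≫ toAddPoint B := by rw [Category.assoc, hu]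
    have hl : hf.lift _ _ w ≫ p.ι = u ≫ β := hf.lift_fst _ _ w
    exact h.eq_of_disjoint hl _ _
  · rw [hu', discTop_hom_ext b (u' ≫ t), Category.assoc]

theorem IsTotalization.isTrivial_complement {p : PartialMap (complemented (PreOrd C)) A B}
    {f : A ⟶ addPoint B} (hf : IsTotalization p f) {A' : PreOrd C} {β : A' ⟶ A}
    (h : IsComplement p.ι β) : IsTrivial (isTriv C) (β ≫ f) := by
  obtain ⟨t, -⟩ := exists_discTop_hom A'
  rw [hf.comp_complement h t]
  exact (IsTrivial.of_target (isTriv_disc _) t).comp_right _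

theorem IsTotalization.of_rel {p q : PartialMap (complemented (PreOrd C)) A B}
    {f : A ⟶ addPoint B} (hf : IsTotalization p f)
    (h : partialMapSetoid (complemented (PreOrd C)) A B p q) : IsTotalization q f := by
  obtain ⟨e, h₁, h₂⟩ := h
  exact IsPullback.of_iso hf e (Iso.refl _) (Iso.refl _) (Iso.refl _) (by simp [h₁])
    (by simp [h₂]) (by simp) (by simp)

/-- Total maps compose as in the Kleisli category of the monad adding a point, and this is
composition of partial maps by pullback. -/
theorem IsTotalization.comp {p : PartialMap (complemented (PreOrd C)) A B}
    {q : PartialMap (complemented (PreOrd C)) B E} {f : A ⟶ addPoint B} {g : B ⟶ addPoint E}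
    (hf : IsTotalization p f) (hg : IsTotalization q g) :
    IsTotalization (p.comp q) (f ≫ addPointExt g) := by
  obtain ⟨B', β, h⟩ := q.mem
  obtain ⟨t, -⟩ := exists_discTop_hom B'
  have sq : IsPullback (q.ι ≫ toAddPoint B) q.map (addPointExt g) (toAddPoint E) := by
    refine ((isComplement_addPoint E).isPullback ((isComplement_addPoint B).assoc h)
      (b := sumDesc t (𝟙 _)) ?_ (sum_hom_ext ?_ ?_)).1
    · simpa using hg.w
    · simpa using hg.comp_complement h t
    · simp
  exact ((IsPullback.of_hasPullback p.map q.ι).paste_horiz hf).paste_vert sq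

/-- The congruence on partial maps is stable equality of the corresponding total maps. -/
theorem congruenceDiagram_iff {p q : PartialMap (complemented (PreOrd C)) A B}
    {f g : A ⟶ addPoint B} (hf : IsTotalization p f) (hg : IsTotalization q g) :
    CongruenceDiagram p q ↔ StablyEq f g := by
  constructor
  · rintro ⟨A₀, A₁, A₂, a₁, c₁, a₂, c₂, h₁, h₂, hι, hmap, t₁, t₂⟩
    have key {p : PartialMap (complemented (PreOrd C)) A B} {f : A ⟶ addPoint B}
        (hf : IsTotalization p f) {A₁ : PreOrd C} {a : A₀ ⟶ p.dom} {c : A₁ ⟶ p.dom}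
        (h : IsComplement a c) (t : IsTrivial (isTriv C) (c ≫ p.map)) :
        ∃ (A' : PreOrd C) (β : A' ⟶ A), IsComplement (a ≫ p.ι) β ∧
          IsTrivial (isTriv C) (β ≫ f) := by
      obtain ⟨A', β, hβ⟩ := p.mem
      refine ⟨_, _, hβ.assoc h, ?_⟩
      rw [(isComplement_sum _ _).isTrivial_iff, sumInl_desc_assoc, sumInr_desc_assoc,
        Category.assoc, hf.w, ← Category.assoc]
      exact ⟨t.comp_right _, hf.isTrivial_complement hβ⟩
    obtain ⟨D₁, β₁, hβ₁, s₁⟩ := key hf h₁ t₁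
    obtain ⟨D₂, β₂, hβ₂, s₂⟩ := key hg h₂ t₂
    refine ⟨_, _, _, _, hβ₁, ?_, s₁, (hι ▸ hβ₂).isTrivial_of_isComplement hβ₁ s₂⟩
    rw [Category.assoc, hf.w, reassoc_of% hmap, ← hg.w, ← reassoc_of% hι, Category.assoc]
  · rintro ⟨A₀, A₁, α, β, h, e, tf, tg⟩
    -- the part of `A₀` on which the two partial maps are defined
    obtain ⟨P, P', u, u', a, b, huu, hu, hu'⟩ := (isComplement_addPoint B).split (α ≫ f)
    have H := h.assoc huu
    have key {p : PartialMap (complemented (PreOrd C)) A B} {f : A ⟶ addPoint B}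
        (hf : IsTotalization p f) (hu : u ≫ α ≫ f = a ≫ toAddPoint B)
        (hu' : u' ≫ α ≫ f = b ≫ point B) (t : IsTrivial (isTriv C) (β ≫ f)) :
        ∃ (A' : PreOrd C) (s : P ⟶ p.dom) (c : A' ⟶ p.dom), IsComplement s c ∧
          s ≫ p.ι = u ≫ α ∧ s ≫ p.map = a ∧ IsTrivial (isTriv C) (c ≫ p.map) := by
      have w : (u ≫ α) ≫ f = a ≫ toAddPoint B := by rw [Category.assoc, hu]
      have hs : hf.lift _ _ w ≫ p.ι = u ≫ α := hf.lift_fst _ _ w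
      obtain ⟨A', β', hβ'⟩ := p.mem
      have := hβ'.mono_left
      have sq : IsPullback (hf.lift _ _ w) (𝟙 P) p.ι (u ≫ α) :=
        ⟨⟨by rw [hs, Category.id_comp]⟩, ⟨PullbackCone.IsLimit.mk _ (fun s => s.snd)
          (fun s => by rw [← cancel_mono p.ι, Category.assoc, hs, s.condition])
          (fun s => Category.comp_id _)
          (fun s m _ h₂ => (Category.comp_id m).symm.trans h₂)⟩⟩
      refine ⟨_, _, _, H.of_isPullback sq (isPullback_pb p.ι _), hs, hf.lift_snd _ _ w,
        isTrivial_of_comp_mono (toAddPoint B) ?_⟩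
      rw [Category.assoc, ← hf.w, reassoc_of% (isPullback_pb p.ι (sumDesc (u' ≫ α) β)).w]
      refine IsTrivial.comp_left ?_ _
      rw [(isComplement_sum _ _).isTrivial_iff, sumInl_desc_assoc, sumInr_desc_assoc,
        Category.assoc, hu']
      exact ⟨(IsTrivial.of_target (isTriv_disc _) b).comp_right _, t⟩
    obtain ⟨D₁, s₁, c₁, h₁, i₁, m₁, t₁⟩ := key hf hu hu' tf
    obtain ⟨D₂, s₂, c₂, h₂, i₂, m₂, t₂⟩ := key hg (e ▸ hu) (e ▸ hu') tg
    exact ⟨P, D₁, D₂, s₁, c₁, s₂, c₂, h₁, h₂, i₁.trans i₂.symm, m₁.trans m₂.symm, t₁, t₂⟩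

/-- The total map `f` represents the morphism `φ` of the category of partial maps. -/
def Totalizes {A B : PaPreOrd C} (φ : A ⟶ B) (f : A.obj ⟶ addPoint B.obj) : Prop :=
  ∃ p, φ = Quotient.mk _ p ∧ IsTotalization p f

namespace Totalizes

variable {A B E : PaPreOrd C}

theorem exists_right (φ : A ⟶ B) : ∃ f, Totalizes φ f := by
  obtain ⟨p⟩ := φ
  obtain ⟨f, hf⟩ := exists_isTotalization p
  exact ⟨f, p, rfl, hf⟩

theorem exists_left (f : A.obj ⟶ addPoint B.obj) : ∃ φ : A ⟶ B, Totalizes φ f :=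
  ⟨_, ⟨pb f (toAddPoint B.obj), pbFst _ _, ⟨_, pbFst f (point B.obj),
    (isComplement_addPoint B.obj).of_isPullback (isPullback_pb _ _) (isPullback_pb _ _)⟩,
    pbSnd _ _⟩, rfl, isPullback_pb _ _⟩

theorem isTotalization {φ : A ⟶ B} {f : A.obj ⟶ addPoint B.obj} (h : Totalizes φ f)
    {p : PartialMap (complemented (PreOrd C)) A.obj B.obj} (hp : φ = Quotient.mk _ p) :
    IsTotalization p f := by
  obtain ⟨q, hq, hf⟩ := h
  exact hf.of_rel (Quotient.exact (hq.symm.trans hp))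

theorem comp {φ : A ⟶ B} {ψ : B ⟶ E} {f : A.obj ⟶ addPoint B.obj}
    {g : B.obj ⟶ addPoint E.obj} (h : Totalizes φ f) (h' : Totalizes ψ g) :
    Totalizes (φ ≫ ψ) (f ≫ addPointExt g) := by
  obtain ⟨p, rfl, hp⟩ := h
  obtain ⟨q, rfl, hq⟩ := h'
  exact ⟨p.comp q, rfl, hp.comp hq⟩

theorem map {A B : PreOrd C} (f : A ⟶ B) : Totalizes (A := ⟨A⟩) (B := ⟨B⟩)
    ((toPartialMapCat (complemented (PreOrd C))).map f) (f ≫ toAddPoint B) := by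
  have sq : IsPullback (𝟙 B) (𝟙 B) (toAddPoint B) (toAddPoint B) :=
    IsKernelPair.id_of_mono (toAddPoint B)
  have sq' : IsPullback (𝟙 A) f f (𝟙 B) := IsPullback.of_horiz_isIso ⟨by simp⟩
  refine ⟨_, rfl, ?_⟩
  have := sq'.paste_vert sq
  rwa [Category.comp_id] at this

theorem id (A : PaPreOrd C) : Totalizes (𝟙 A) (toAddPoint A.obj) := by
  have := map (𝟙 A.obj)
  rwa [Category.id_comp] at this

theorem stableRel_iff {φ ψ : A ⟶ B} {f g : A.obj ⟶ addPoint B.obj} (hf : Totalizes φ f)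
    (hg : Totalizes ψ g) : stableRel C φ ψ ↔ StablyEq f g := by
  constructor
  · rintro ⟨p, q, hp, hq, h⟩
    exact (congruenceDiagram_iff (hf.isTotalization hp) (hg.isTotalization hq)).1 h
  · obtain ⟨p, rfl, hp⟩ := hf
    obtain ⟨q, rfl, hq⟩ := hg
    exact fun h => ⟨p, q, rfl, rfl, (congruenceDiagram_iff hp hq).2 h⟩

end Totalizes

/-- The relation defining the stable category is a congruence, so that the quotient by it makes no
further identifications. -/
instance : Congruence (stableRel C) where
  comp_left {_ _ _} φ {ψ ψ'} h := by
    obtain ⟨f, hf⟩ := Totalizes.exists_right φ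
    obtain ⟨g, hg⟩ := Totalizes.exists_right ψ
    obtain ⟨g', hg'⟩ := Totalizes.exists_right ψ'
    rw [hg.stableRel_iff hg'] at h
    rw [(hf.comp hg).stableRel_iff (hf.comp hg')]
    refine StablyEq.comp_left f (.of_isComplement (isComplement_addPoint _) ?_ ?_)
    · simpa using h
    · simpa using .refl _
  comp_right {_ _ _ φ φ'} ψ h := by
    obtain ⟨f, hf⟩ := Totalizes.exists_right φ
    obtain ⟨f', hf'⟩ := Totalizes.exists_right φ'
    obtain ⟨g, hg⟩ := Totalizes.exists_right ψ
    rw [hf.stableRel_iff hf'] at h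
    rw [(hf.comp hg).stableRel_iff (hf'.comp hg)]
    exact h.comp_right _
  equivalence :=
    { refl := fun φ => by
        obtain ⟨f, hf⟩ := Totalizes.exists_right φ
        exact (hf.stableRel_iff hf).2 (.refl f)
      symm := fun {φ ψ} => by
        obtain ⟨f, hf⟩ := Totalizes.exists_right φ
        obtain ⟨g, hg⟩ := Totalizes.exists_right ψ
        rw [hf.stableRel_iff hg, hg.stableRel_iff hf]
        exact .symm
      trans := fun {φ ψ χ} => by
        obtain ⟨f, hf⟩ := Totalizes.exists_right φ
        obtain ⟨g, hg⟩ := Totalizes.exists_right ψ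
        obtain ⟨k, hk⟩ := Totalizes.exists_right χ
        rw [hf.stableRel_iff hg, hg.stableRel_iff hk, hf.stableRel_iff hk]
        exact .trans }

/-! ### Morphisms of the stable category -/

theorem Totalizes.functor_map_eq_iff {A B : PaPreOrd C} {φ ψ : A ⟶ B}
    {f g : A.obj ⟶ addPoint B.obj} (hf : Totalizes φ f) (hg : Totalizes ψ g) :
    (Quotient.functor (stableRel C)).map φ = (Quotient.functor (stableRel C)).map ψ ↔
      StablyEq f g := by
  rw [Quotient.functor_map_eq_iff, hf.stableRel_iff hg]

/-- Two morphisms of preorders are identified in the stable category exactly when they are stably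
equal. -/
theorem sigma_map_eq_iff {A B : PreOrd C} {f g : A ⟶ B} :
    (sigma C).map f = (sigma C).map g ↔ StablyEq f g :=
  ((Totalizes.map f).functor_map_eq_iff (Totalizes.map g)).trans
    ⟨.of_comp_mono (toAddPoint B), .comp_right _⟩

theorem stablyEq_addPointExt (B : PreOrd C) :
    StablyEq (addPointExt (toAddPoint B ≫ toAddPoint (addPoint B)))
      (toAddPoint (addPoint B)) := by
  refine .of_isComplement (isComplement_addPoint B) ?_ ?_
  · simpa using .refl _
  · exact .of_isTrivial (.of_source (isTriv_disc _) _) (.of_source (isTriv_disc _) _)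

/-- Adding an isolated point does not change a preorder, up to isomorphism in the stable
category. -/
instance isIso_sigma_toAddPoint (B : PreOrd C) : IsIso ((sigma C).map (toAddPoint B)) := by
  have hη := Totalizes.map (toAddPoint B)
  obtain ⟨ρ, hρ⟩ := Totalizes.exists_left (A := ⟨addPoint B⟩) (B := ⟨B⟩) (𝟙 (addPoint B))
  refine ⟨(Quotient.functor (stableRel C)).map ρ, ?_, ?_⟩
  · refine ((hη.comp hρ).functor_map_eq_iff (Totalizes.id ⟨B⟩)).2 ?_
    simpa using .refl (toAddPoint B)
  · refine ((hρ.comp hη).functor_map_eq_iff (Totalizes.id ⟨addPoint B⟩)).2 ?_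
    simpa using stablyEq_addPointExt B

/-- Every morphism of the stable category is a fraction, with a denominator of the form
`toAddPoint B`. -/
theorem exists_comp_sigma_toAddPoint {A B : PreOrd C} (φ : (sigma C).obj A ⟶ (sigma C).obj B) :
    ∃ f : A ⟶ addPoint B, φ ≫ (sigma C).map (toAddPoint B) = (sigma C).map f := by
  obtain ⟨φ, rfl⟩ := (Quotient.functor (stableRel C)).map_surjective φ
  obtain ⟨f, hf⟩ := Totalizes.exists_right φ
  exact ⟨f, ((hf.comp (Totalizes.map (toAddPoint B))).functor_map_eq_iff (Totalizes.map f)).2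
    ((stablyEq_addPointExt B).comp_left f)⟩

end Totalization

section General

variable {D : Type u} [Category.{v} D] {Z : ObjectProperty D}

/-- Following a relative kernel reflects triviality. -/
theorem IsKernelRel.isTrivial_of_comp {K A B Y : D} {k : K ⟶ A} {f : A ⟶ B}
    (h : IsKernelRel Z k f) {l : Y ⟶ K} (hl : IsTrivial Z (l ≫ k)) : IsTrivial Z l := by
  have := h.mono
  obtain ⟨W, hW, a, b, e⟩ := hl
  obtain ⟨c, hc, -⟩ := h.2 b (.of_source hW _)
  exact ⟨W, hW, a, c, by rw [← cancel_mono k, Category.assoc, hc, e]⟩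

/-- Preceding a relative cokernel reflects triviality. -/
theorem IsCokernelRel.isTrivial_of_comp {A B Q Y : D} {q : B ⟶ Q} {f : A ⟶ B}
    (h : IsCokernelRel Z q f) {l : Q ⟶ Y} (hl : IsTrivial Z (q ≫ l)) : IsTrivial Z l := by
  have := h.epi
  obtain ⟨W, hW, a, b, e⟩ := hl
  obtain ⟨c, hc, -⟩ := h.2 a (.of_target hW _)
  exact ⟨W, hW, c, b, by rw [← cancel_epi q, reassoc_of% hc, e]⟩

theorem preservesFiniteCoproducts_of_isSum {X : Type u'} [Category.{v'} X] (F : D ⥤ X)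
    {I : D} (hI : IsInitial I) (hFI : IsInitial (F.obj I))
    (h : ∀ A B : D, ∃ (S : D) (i : A ⟶ S) (j : B ⟶ S), IsSum i j ∧ IsSum (F.map i) (F.map j)) :
    PreservesFiniteCoproducts F := by
  have : HasInitial D := hI.hasInitial
  have (A B : D) : HasColimit (pair A B) := by
    obtain ⟨S, i, j, ⟨h⟩, -⟩ := h A B
    exact ⟨⟨⟨_, h⟩⟩⟩
  have : HasBinaryCoproducts D := hasBinaryCoproducts_of_hasColimit_pair D
  have : HasFiniteCoproducts D := hasFiniteCoproducts_of_has_binary_and_initial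
  have (A B : D) : PreservesColimit (pair A B) F := by
    obtain ⟨S, i, j, ⟨h⟩, ⟨h'⟩⟩ := h A B
    exact preservesColimit_of_preserves_colimit_cocone h
      ((isColimitMapCoconeBinaryCofanEquiv F i j).symm h')
  have : PreservesColimitsOfShape (Discrete WalkingPair) F :=
    ⟨fun {K} => preservesColimit_of_iso_diagram F (diagramIsoPair K).symm⟩
  have : PreservesColimit (Functor.empty.{0} D) F :=
    preservesColimit_of_preserves_colimit_cocone hI
      ((isColimitMapCoconeEmptyCoconeEquiv F I).symm hFI)
  have : PreservesColimitsOfShape (Discrete.{0} PEmpty) F :=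
    preservesColimitsOfShape_pempty_of_preservesInitial F
  exact ⟨fun n => PreservesFiniteCoproducts.of_preserves_binary_and_initial F (Fin n)⟩

theorem IsSum.exists_iso {A B S S' : D} {i : A ⟶ S} {j : B ⟶ S} {i' : A ⟶ S'} {j' : B ⟶ S'}
    (h : IsSum i j) (h' : IsSum i' j') : ∃ e : S ≅ S', i ≫ e.hom = i' ∧ j ≫ e.hom = j' := by
  obtain ⟨d, h₁, h₂⟩ := h.exists_desc i' j'
  obtain ⟨d', h₁', h₂'⟩ := h'.exists_desc i j
  exact ⟨⟨d, d', h.hom_ext (by simp [reassoc_of% h₁, h₁']) (by simp [reassoc_of% h₂, h₂']),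
    h'.hom_ext (by simp [reassoc_of% h₁', h₁]) (by simp [reassoc_of% h₂', h₂])⟩, h₁, h₂⟩

theorem IsSum.map {X : Type u'} [Category.{v'} X] {A B S : D} {i : A ⟶ S} {j : B ⟶ S}
    (h : IsSum i j) (F : D ⥤ X) [PreservesFiniteCoproducts F] : IsSum (F.map i) (F.map j) :=
  ⟨isColimitMapCoconeBinaryCofanEquiv F i j (isColimitOfPreserves F h.some)⟩

/-- In a pointed category, binary coproducts are automatically disjoint: the coprojections are
split monomorphisms, and two morphisms that agree after following the two coprojections vanish. -/
theorem disjointCoproducts_of_hasZeroObject [HasZeroObject D] [HasBinaryCoproducts D] :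
    DisjointCoproducts D := by
  intro A B
  obtain ⟨O, hO⟩ := HasZeroObject.zero (C := D)
  obtain ⟨a, ha, ha'⟩ := (isSum_coprod A B).exists_desc (𝟙 A) (hO.from_ B ≫ hO.to_ A)
  obtain ⟨b, hb, hb'⟩ := (isSum_coprod A B).exists_desc (hO.from_ A ≫ hO.to_ B) (𝟙 B)
  refine ⟨⟨fun x y e => ?_⟩, ⟨fun x y e => ?_⟩, O, hO.to_ A, hO.to_ B,
    ⟨⟨hO.eq_of_src _ _⟩, ⟨PullbackCone.IsLimit.mk _ (fun s => hO.from_ _) (fun s => ?_)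
      (fun s => ?_) (fun s _ _ _ => hO.eq_of_tgt _ _)⟩⟩, ⟨hO.isInitial⟩⟩
  · have := e =≫ a
    simpa only [Category.assoc, ha, Category.comp_id] using this
  · have := e =≫ b
    simpa only [Category.assoc, hb', Category.comp_id] using this
  · have := s.condition =≫ a
    simp only [Category.assoc, ha, ha', Category.comp_id] at this
    rw [this, ← Category.assoc, hO.eq_of_tgt (s.snd ≫ hO.from_ B)]
  · have := s.condition =≫ b
    simp only [Category.assoc, hb, hb', Category.comp_id] at this
    rw [← this, ← Category.assoc, hO.eq_of_tgt (s.fst ≫ hO.from_ A)]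

end General

section StableCategory

variable {C : Type u} [Category.{v} C] [Pretopos C]

/-! ### Zero objects and zero morphisms of the stable category -/

theorem isTrivial_toAddPoint_of_isTriv {A B : PreOrd C} (hB : isTriv C B) (f : A ⟶ addPoint B) :
    IsTrivial (isTriv C) f := by
  have : IsTrivial (isTriv C) (𝟙 (addPoint B)) := by
    rw [(isComplement_addPoint B).isTrivial_iff]
    exact ⟨.of_source hB _, .of_source (isTriv_disc _) _⟩
  simpa using this.comp_left f

theorem exists_point (A B : PreOrd C) :
    ∃ f : A ⟶ addPoint B, IsTrivial (isTriv C) f := by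
  obtain ⟨t, -⟩ := exists_discTop_hom A
  exact ⟨t ≫ point B, (IsTrivial.of_target (isTriv_disc _) t).comp_right _⟩

theorem isTriv_of_isTrivial_mono {A B : PreOrd C} (m : A ⟶ B) [Mono m]
    (hm : IsTrivial (isTriv C) m) : isTriv C A := by
  have : IsTrivial (isTriv C) (𝟙 A) := isTrivial_of_comp_mono m (by simpa using hm)
  rw [isTrivial_iff] at this
  rw [isTriv_iff]
  simpa using this

theorem exists_eq_sigma_obj (A : Stab C) : ∃ B : PreOrd C, A = (sigma C).obj B :=
  ⟨A.as.obj, rfl⟩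

/-- Up to the isomorphism `toAddPoint B`, every morphism of preorders `A ⟶ addPoint B` gives a
morphism of the stable category. -/
theorem exists_comp_sigma_toAddPoint_eq {A B : PreOrd C} (f : A ⟶ addPoint B) :
    ∃ φ : (sigma C).obj A ⟶ (sigma C).obj B,
      φ ≫ (sigma C).map (toAddPoint B) = (sigma C).map f :=
  ⟨(sigma C).map f ≫ inv ((sigma C).map (toAddPoint B)), by simp⟩

theorem sigma_obj_isZero {A : PreOrd C} (hA : isTriv C A) : IsZero ((sigma C).obj A) := by
  constructor <;> intro Y <;> obtain ⟨Y, rfl⟩ := exists_eq_sigma_obj Y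
  · obtain ⟨z, hz⟩ := exists_point A Y
    obtain ⟨ζ, hζ⟩ := exists_comp_sigma_toAddPoint_eq z
    refine ⟨⟨⟨ζ⟩, fun φ => ?_⟩⟩
    obtain ⟨f, hf⟩ := exists_comp_sigma_toAddPoint φ
    rw [← cancel_mono ((sigma C).map (toAddPoint Y)), hf]
    exact (sigma_map_eq_iff.2 (.of_isTrivial (.of_source hA _) hz)).trans hζ.symm
  · obtain ⟨z, hz⟩ := exists_point Y A
    obtain ⟨ζ, hζ⟩ := exists_comp_sigma_toAddPoint_eq z
    refine ⟨⟨⟨ζ⟩, fun φ => ?_⟩⟩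
    obtain ⟨f, hf⟩ := exists_comp_sigma_toAddPoint φ
    rw [← cancel_mono ((sigma C).map (toAddPoint A)), hf]
    exact (sigma_map_eq_iff.2 (.of_isTrivial (isTrivial_toAddPoint_of_isTriv hA _) hz)).trans
      hζ.symm

theorem isTrivial_sigma_map_iff {A B : PreOrd C} (f : A ⟶ B) :
    IsTrivial (zeroObjects (Stab C)) ((sigma C).map f) ↔ IsTrivial (isTriv C) f := by
  have key {A B : PreOrd C} {f : A ⟶ B} (hf : IsTrivial (isTriv C) f) :
      IsTrivial (zeroObjects (Stab C)) ((sigma C).map f) :=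
    hf.map (fun _ => sigma_obj_isZero)
  refine ⟨fun h => isTrivial_of_comp_mono (toAddPoint B) ?_, key⟩
  obtain ⟨z, hz⟩ := exists_point A B
  refine StablyEq.isTrivial (sigma_map_eq_iff.1 (IsTrivial.eq ?_ (key hz))) hz
  rw [Functor.map_comp]
  exact h.comp_right _

theorem isZero_iff (A : Stab C) : IsZero A ↔ isTriv C A.as.obj := by
  refine ⟨fun h => ?_, sigma_obj_isZero⟩
  obtain ⟨z, hz⟩ := exists_point A.as.obj A.as.obj
  refine isTriv_of_isTrivial_mono (toAddPoint A.as.obj)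
    (StablyEq.isTrivial (sigma_map_eq_iff.1 ?_) hz)
  exact h.eq_of_src _ _

instance : HasZeroObject (Stab C) := ⟨(sigma C).obj (disc (⊤_ C)), sigma_obj_isZero (isTriv_disc _)⟩

theorem stabEq_inf_stabPar : stabEq C ⊓ stabPar C = zeroObjects (Stab C) := by
  funext A
  exact propext (isZero_iff A).symm

/-! ### Coproducts in the stable category -/

theorem IsComplement.isSum_sigma {A A' B : PreOrd C} {α : A ⟶ B} {β : A' ⟶ B}
    (h : IsComplement α β) : IsSum ((sigma C).map α) ((sigma C).map β) := by
  refine isSum_of (fun Y x y => ?_) (fun Y x y h₁ h₂ => ?_) <;>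
  obtain ⟨Y, rfl⟩ := exists_eq_sigma_obj Y <;>
  obtain ⟨f, hf⟩ := exists_comp_sigma_toAddPoint x <;>
  obtain ⟨g, hg⟩ := exists_comp_sigma_toAddPoint y
  · obtain ⟨d, rfl, rfl⟩ := h.exists_desc f g
    obtain ⟨δ, hδ⟩ := exists_comp_sigma_toAddPoint_eq d
    refine ⟨δ, ?_, ?_⟩ <;> rw [← cancel_mono ((sigma C).map (toAddPoint Y)), Category.assoc, hδ]
    · rw [hf, Functor.map_comp]
    · rw [hg, Functor.map_comp]
  · rw [← cancel_mono ((sigma C).map (toAddPoint Y)), hf, hg, sigma_map_eq_iff]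
    refine .of_isComplement h (sigma_map_eq_iff.1 ?_) (sigma_map_eq_iff.1 ?_)
    · rw [Functor.map_comp, Functor.map_comp, ← hf, ← hg, reassoc_of% h₁]
    · rw [Functor.map_comp, Functor.map_comp, ← hf, ← hg, reassoc_of% h₂]

instance : HasBinaryCoproducts (Stab C) := by
  have (A B : Stab C) : HasColimit (pair A B) :=
    ⟨⟨⟨_, (isComplement_sum A.as.obj B.as.obj).isSum_sigma.some⟩⟩⟩
  exact hasBinaryCoproducts_of_hasColimit_pair (Stab C)

instance preservesFiniteCoproducts_sigma : PreservesFiniteCoproducts (sigma C) :=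
  preservesFiniteCoproducts_of_isSum _ (discInitial C) (sigma_obj_isZero (isTriv_disc _)).isInitial
    fun A B => ⟨_, _, _, (isComplement_sum A B).isSum, (isComplement_sum A B).isSum_sigma⟩

/-- Every morphism of the stable category is the sum of a morphism of preorders and of a zero
morphism. -/
theorem exists_isComplement_comp {A B : PreOrd C} (φ : (sigma C).obj A ⟶ (sigma C).obj B) :
    ∃ (P P' : PreOrd C) (u : P ⟶ A) (u' : P' ⟶ A) (f : P ⟶ B), IsComplement u u' ∧
      (sigma C).map u ≫ φ = (sigma C).map f ∧
      IsTrivial (zeroObjects (Stab C)) ((sigma C).map u' ≫ φ) := by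
  obtain ⟨f, hf⟩ := exists_comp_sigma_toAddPoint φ
  obtain ⟨P, P', u, u', a, b, huu, hu, hu'⟩ := (isComplement_addPoint B).split f
  refine ⟨P, P', u, u', a, huu, ?_, IsTrivial.of_comp_isIso (e := (sigma C).map (toAddPoint B)) ?_⟩
  · rw [← cancel_mono ((sigma C).map (toAddPoint B)), Category.assoc, hf, ← Functor.map_comp, hu,
      Functor.map_comp]
  · rw [Category.assoc, hf, ← Functor.map_comp, hu', isTrivial_sigma_map_iff]
    exact (IsTrivial.of_target (isTriv_disc _) b).comp_right _

theorem preUniversalCoproducts_stab : PreUniversalCoproducts (Stab C) := by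
  intro S A B φ
  obtain ⟨S, rfl⟩ := exists_eq_sigma_obj S
  obtain ⟨A, rfl⟩ := exists_eq_sigma_obj A
  obtain ⟨B, rfl⟩ := exists_eq_sigma_obj B
  obtain ⟨e, e₁, e₂⟩ := (isSum_coprod ((sigma C).obj A) ((sigma C).obj B)).exists_iso
    (isComplement_sum A B).isSum_sigma
  obtain ⟨P, P', u, u', f, h, hu, hu'⟩ := exists_isComplement_comp (φ ≫ e.hom)
  obtain ⟨R, R', r, r', a, b, h', hr, hr'⟩ := (isComplement_sum A B).split f
  obtain ⟨z, hz⟩ := isTrivial_zeroObjects ((sigma C).obj P') ((sigma C).obj B)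
  -- the part on which `φ` vanishes is put together with the part sent into `B`
  have hI := (isComplement_sum R' P').isSum_sigma
  obtain ⟨g, hg₁, hg₂⟩ := hI.exists_desc ((sigma C).map b) z
  refine ⟨_, _, _, _, (sigma C).map a, g, (h.assoc h').isSum_sigma, ?_, hI.hom_ext ?_ ?_⟩ <;>
    rw [← cancel_mono e.hom]
  · simp only [Category.assoc, e₁, Functor.map_comp, hu]
    rw [← Functor.map_comp, hr, Functor.map_comp]
  · simp only [Category.assoc, e₂, reassoc_of% hg₁]
    rw [← Functor.map_comp_assoc, sumInl_desc, Functor.map_comp_assoc, hu, ← Functor.map_comp, hr',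
      Functor.map_comp]
  · simp only [Category.assoc, e₂, reassoc_of% hg₂]
    rw [← Functor.map_comp_assoc, sumInr_desc]
    exact hu'.eq (hz.comp_right _)

end StableCategory

section StableExactness

variable {C : Type u} [Category.{v} C] [Pretopos C]

/-! ### Kernels and cokernels in the stable category -/

/-- The morphism induced between the preorders with an added point. -/
noncomputable abbrev addPointMap {K A : PreOrd C} (k : K ⟶ A) : addPoint K ⟶ addPoint A :=
  sumDesc (k ≫ toAddPoint A) (point A)

theorem isPullback_addPointMap {K A : PreOrd C} (k : K ⟶ A) :
    IsPullback (toAddPoint K) k (addPointMap k) (toAddPoint A) ∧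
      IsPullback (point K) (𝟙 _) (addPointMap k) (point A) :=
  (isComplement_addPoint A).isPullback (isComplement_addPoint K) (by simp) (by simp)

theorem mono_addPointMap {K A : PreOrd C} (k : K ⟶ A) [Mono k] : Mono (addPointMap k) := by
  obtain ⟨sq, sq'⟩ := isPullback_addPointMap k
  refine ⟨fun {W} x y e => ?_⟩
  obtain ⟨P, P', u, u', a, b, h, hu, hu'⟩ := (isComplement_addPoint K).split x
  refine h.hom_ext ?_ ?_
  · have w : (u ≫ y) ≫ addPointMap k = (a ≫ k) ≫ toAddPoint A := by
      rw [Category.assoc, ← e, reassoc_of% hu, sumInl_desc, Category.assoc]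
    have h₁ := sq.lift_fst _ _ w
    have h₂ : sq.lift _ _ w ≫ k = a ≫ k := sq.lift_snd _ _ w
    rw [← h₁, (cancel_mono k).1 h₂, hu]
  · have w : (u' ≫ y) ≫ addPointMap k = b ≫ point A := by
      rw [Category.assoc, ← e, reassoc_of% hu', sumInr_desc]
    rw [← sq'.lift_fst _ _ w, hu', discTop_hom_ext (sq'.lift _ _ w) b]

theorem isTrivial_of_comp_addPointMap {K A Y : PreOrd C} {k : K ⟶ A}
    (hk : ∀ ⦃Y : PreOrd C⦄ (l : Y ⟶ K), IsTrivial (isTriv C) (l ≫ k) → IsTrivial (isTriv C) l)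
    {f : Y ⟶ addPoint K} (hf : IsTrivial (isTriv C) (f ≫ addPointMap k)) :
    IsTrivial (isTriv C) f := by
  obtain ⟨P, P', u, u', a, b, h, hu, hu'⟩ := (isComplement_addPoint K).split f
  rw [h.isTrivial_iff]
  constructor
  · rw [hu]
    refine (hk a (isTrivial_of_comp_mono (toAddPoint A) ?_)).comp_right _
    simpa [reassoc_of% hu] using hf.comp_left u
  · rw [hu']
    exact (IsTrivial.of_target (isTriv_disc _) b).comp_right _

theorem IsKernelRel.mono_sigma_map {K A B : PreOrd C} {k : K ⟶ A} {f : A ⟶ B}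
    (h : IsKernelRel (isTriv C) k f) : Mono ((sigma C).map k) := by
  have := h.mono
  have := mono_addPointMap k
  refine ⟨fun {Y} x y e => ?_⟩
  obtain ⟨Y, rfl⟩ := exists_eq_sigma_obj Y
  obtain ⟨x', hx⟩ := exists_comp_sigma_toAddPoint x
  obtain ⟨y', hy⟩ := exists_comp_sigma_toAddPoint y
  have key : (sigma C).map (x' ≫ addPointMap k) = (sigma C).map (y' ≫ addPointMap k) := by
    simp only [Functor.map_comp, ← hx, ← hy, Category.assoc]
    rw [← Functor.map_comp, sumInl_desc, Functor.map_comp, reassoc_of% e]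
  rw [sigma_map_eq_iff] at key
  obtain ⟨P, P', u, u', h', e', t, t'⟩ := key
  rw [← cancel_mono ((sigma C).map (toAddPoint K)), hx, hy, sigma_map_eq_iff]
  refine ⟨P, P', u, u', h', by rw [← cancel_mono (addPointMap k)]; simpa using e', ?_, ?_⟩
  · exact isTrivial_of_comp_addPointMap (fun _ _ => h.isTrivial_of_comp) (by simpa using t)
  · exact isTrivial_of_comp_addPointMap (fun _ _ => h.isTrivial_of_comp) (by simpa using t')

/-- The canonical functor to the stable category sends relative kernels to kernels. -/
theorem IsKernelRel.sigma_map {K A B : PreOrd C} {k : K ⟶ A} {f : A ⟶ B}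
    (h : IsKernelRel (isTriv C) k f) :
    IsKernelRel (zeroObjects (Stab C)) ((sigma C).map k) ((sigma C).map f) := by
  have := h.mono_sigma_map
  refine .of_mono ?_ fun Y l hl => ?_
  · rw [← Functor.map_comp, isTrivial_sigma_map_iff]
    exact h.1
  obtain ⟨Y, rfl⟩ := exists_eq_sigma_obj Y
  obtain ⟨P, P', u, u', l', h', hu, hu'⟩ := exists_isComplement_comp l
  obtain ⟨m, hm, -⟩ := h.2 l' (by
    rw [← isTrivial_sigma_map_iff, Functor.map_comp, ← hu, Category.assoc]
    exact hl.comp_left _)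
  obtain ⟨z, hz⟩ := isTrivial_zeroObjects ((sigma C).obj P') ((sigma C).obj K)
  obtain ⟨d, hd, hd'⟩ := h'.isSum_sigma.exists_desc ((sigma C).map m) z
  refine ⟨d, h'.isSum_sigma.hom_ext ?_ ?_⟩
  · rw [reassoc_of% hd, ← Functor.map_comp, hm, hu]
  · rw [reassoc_of% hd']
    exact (hz.comp_right _).eq hu'

/-- Complementary subobjects descend along a relative cokernel: they are classified by morphisms to
a discrete preorder, and those are trivial. -/
theorem IsCokernelRel.exists_isComplement {A B Q : PreOrd C} {q : B ⟶ Q} {f : A ⟶ B}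
    (h : IsCokernelRel (isTriv C) q f) {P P' : PreOrd C} {α : P ⟶ B} {β : P' ⟶ B}
    (hαβ : IsComplement α β) :
    ∃ (R R' : PreOrd C) (u : R ⟶ Q) (u' : R' ⟶ Q) (a : P ⟶ R) (b : P' ⟶ R'),
      IsComplement u u' ∧ α ≫ q = a ≫ u ∧ β ≫ q = b ≫ u' := by
  let O : PreOrd C := disc (⊤_ C)
  have hO : isTriv C O := isTriv_disc _
  obtain ⟨s, -⟩ := exists_discTop_hom P
  obtain ⟨t, -⟩ := exists_discTop_hom P'
  obtain ⟨χ, h₁, h₂⟩ := hαβ.exists_desc (s ≫ sumInl O O) (t ≫ sumInr O O)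
  obtain ⟨χ', hχ, -⟩ := h.2 χ (isTrivial_toAddPoint_of_isTriv hO _)
  have sq := isPullback_pb χ' (sumInl O O)
  have sq' := isPullback_pb χ' (sumInr O O)
  have w : (α ≫ q) ≫ χ' = s ≫ sumInl O O := by rw [Category.assoc, hχ, h₁]
  have w' : (β ≫ q) ≫ χ' = t ≫ sumInr O O := by rw [Category.assoc, hχ, h₂]
  exact ⟨_, _, _, _, sq.lift _ _ w, sq'.lift _ _ w',
    (isComplement_sum O O).of_isPullback sq sq', (sq.lift_fst _ _ _).symm,
    (sq'.lift_fst _ _ _).symm⟩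

theorem IsCokernelRel.stablyEq_of_comp {A B Q Y : PreOrd C} {q : B ⟶ Q} {f : A ⟶ B}
    (h : IsCokernelRel (isTriv C) q f) {x y : Q ⟶ addPoint Y} (e : StablyEq (q ≫ x) (q ≫ y)) :
    StablyEq x y := by
  obtain ⟨P, P', α, β, hαβ, e, hx, hy⟩ := e
  obtain ⟨R, R', u, u', a, b, hu, ha, hb⟩ := h.exists_isComplement hαβ
  have := h.epi
  -- a morphism out of `R'` that becomes trivial on `P'` can be extended to `Q` by a constant
  have triv {x : Q ⟶ addPoint Y} (hx : IsTrivial (isTriv C) (β ≫ q ≫ x)) :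
      IsTrivial (isTriv C) (u' ≫ x) := by
    obtain ⟨s, hs⟩ := exists_point R Y
    obtain ⟨d, h₁, h₂⟩ := hu.exists_desc s (u' ≫ x)
    rw [← h₂]
    refine (h.isTrivial_of_comp ?_).comp_left u'
    rw [hαβ.isTrivial_iff, reassoc_of% ha, reassoc_of% hb, h₁, h₂, ← reassoc_of% hb]
    exact ⟨hs.comp_left a, hx⟩
  obtain ⟨s, -⟩ := exists_point R' Y
  obtain ⟨d, h₁, h₂⟩ := hu.exists_desc (u ≫ x) s
  obtain ⟨d', h₁', h₂'⟩ := hu.exists_desc (u ≫ y) s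
  have hd : d = d' := by
    rw [← cancel_epi q]
    refine hαβ.hom_ext ?_ ?_
    · rw [reassoc_of% ha, reassoc_of% ha, h₁, h₁', ← reassoc_of% ha, ← reassoc_of% ha, e]
    · rw [reassoc_of% hb, reassoc_of% hb, h₂, h₂']
  exact ⟨R, R', u, u', hu, by rw [← h₁, ← h₁', hd], triv hx, triv hy⟩

/-- The canonical functor to the stable category sends relative cokernels to cokernels. -/
theorem IsCokernelRel.sigma_map {A B Q : PreOrd C} {q : B ⟶ Q} {f : A ⟶ B}
    (h : IsCokernelRel (isTriv C) q f) :
    IsCokernelRel (zeroObjects (Stab C)) ((sigma C).map q) ((sigma C).map f) := by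
  have : Epi ((sigma C).map q) := by
    refine ⟨fun {Y} x y e => ?_⟩
    obtain ⟨Y, rfl⟩ := exists_eq_sigma_obj Y
    obtain ⟨x', hx⟩ := exists_comp_sigma_toAddPoint x
    obtain ⟨y', hy⟩ := exists_comp_sigma_toAddPoint y
    rw [← cancel_mono ((sigma C).map (toAddPoint Y)), hx, hy, sigma_map_eq_iff]
    refine h.stablyEq_of_comp (sigma_map_eq_iff.1 ?_)
    rw [Functor.map_comp, Functor.map_comp, ← hx, ← hy, reassoc_of% e]
  refine .of_epi ?_ fun Y l hl => ?_
  · rw [← Functor.map_comp, isTrivial_sigma_map_iff]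
    exact h.1
  obtain ⟨Y, rfl⟩ := exists_eq_sigma_obj Y
  obtain ⟨l', hl'⟩ := exists_comp_sigma_toAddPoint l
  obtain ⟨m, hm, -⟩ := h.2 l' (by
    rw [← isTrivial_sigma_map_iff, Functor.map_comp, ← hl', ← Category.assoc]
    exact hl.comp_right _)
  obtain ⟨μ, hμ⟩ := exists_comp_sigma_toAddPoint_eq m
  refine ⟨μ, ?_⟩
  rw [← cancel_mono ((sigma C).map (toAddPoint Y)), Category.assoc, hμ, ← Functor.map_comp, hm,
    hl']

theorem IsShortExactRel.sigma_map {A B Q : PreOrd C} {f : A ⟶ B} {g : B ⟶ Q}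
    (h : IsShortExactRel (isTriv C) f g) :
    IsShortExactRel (zeroObjects (Stab C)) ((sigma C).map f) ((sigma C).map g) :=
  ⟨h.1.sigma_map, h.2.sigma_map⟩

/-! ### Equivalence relations and partial orders in the stable category -/

/-- The inclusion of a complemented subobject reflects the order. -/
theorem IsComplement.le_of_comp {A A' B : PreOrd C} {α : A ⟶ B} {β : A' ⟶ B}
    (h : IsComplement α β) {W : C} {a b : W ⟶ A.carrier}
    (hab : B.Le (a ≫ base α) (b ≫ base α)) : A.Le a b := by
  rw [isComplement_iff] at h
  obtain ⟨t, t₁, t₂⟩ := hab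
  have sq := (h.1.isPullback h.2 (w₁ α).symm (w₁ β).symm).1
  have := h.1.mono_left
  have e := sq.lift_fst _ _ t₁
  refine ⟨sq.lift _ _ t₁, sq.lift_snd _ _ t₁, ?_⟩
  rw [← cancel_mono (base α), ← t₂, Category.assoc, w₂, reassoc_of% e]

/-- Comparable elements of a sum lie, locally, in the same summand and are comparable there. -/
theorem IsComplement.exists_le {A A' B : PreOrd C} {α : A ⟶ B} {β : A' ⟶ B}
    (h : IsComplement α β) {W : C} {a b : W ⟶ B.carrier} (hab : B.Le a b) :
    ∃ (W₀ W₁ : C) (p : W₀ ⟶ W) (q : W₁ ⟶ W) (a₀ b₀ : W₀ ⟶ A.carrier) (a₁ b₁ : W₁ ⟶ A'.carrier),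
      IsSum p q ∧ p ≫ a = a₀ ≫ base α ∧ p ≫ b = b₀ ≫ base α ∧ q ≫ a = a₁ ≫ base β ∧
        q ≫ b = b₁ ≫ base β ∧ A.Le a₀ b₀ ∧ A'.Le a₁ b₁ := by
  rw [isComplement_iff] at h
  obtain ⟨t, rfl, rfl⟩ := hab
  obtain ⟨W₀, W₁, p, q, s₀, s₁, hpq, hp, hq⟩ := h.2.split t
  refine ⟨W₀, W₁, p, q, s₀ ≫ A.r₁, s₀ ≫ A.r₂, s₁ ≫ A'.r₁, s₁ ≫ A'.r₂, hpq, ?_, ?_, ?_, ?_,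
    le_precomp A.le_r s₀, le_precomp A'.le_r s₁⟩
  · rw [reassoc_of% hp, Category.assoc, w₁]
  · rw [reassoc_of% hp, Category.assoc, w₂]
  · rw [reassoc_of% hq, Category.assoc, w₁]
  · rw [reassoc_of% hq, Category.assoc, w₂]

theorem IsComplement.isEq {A A' B : PreOrd C} {α : A ⟶ B} {β : A' ⟶ B} (h : IsComplement α β)
    (hA : isEq C A) (hA' : isEq C A') : isEq C B := by
  rw [isEq_iff] at *
  intro W a b hab
  obtain ⟨W₀, W₁, p, q, a₀, b₀, a₁, b₁, hpq, h₁, h₂, h₃, h₄, l₀, l₁⟩ := h.exists_le hab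
  refine le_of_isSum hpq ?_ ?_
  · rw [h₁, h₂]
    exact le_comp α (hA _ _ l₀)
  · rw [h₃, h₄]
    exact le_comp β (hA' _ _ l₁)

theorem IsComplement.isPar {A A' B : PreOrd C} {α : A ⟶ B} {β : A' ⟶ B} (h : IsComplement α β)
    (hA : isPar C A) (hA' : isPar C A') : isPar C B := by
  intro W a b hab hba
  obtain ⟨W₀, W₁, p, q, a₀, b₀, a₁, b₁, hpq, h₁, h₂, h₃, h₄, l₀, l₁⟩ := h.exists_le hab
  refine hpq.hom_ext ?_ ?_
  · rw [h₁, h₂, hA _ _ l₀ (h.le_of_comp (h₁ ▸ h₂ ▸ le_precomp hba p))]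
  · rw [h₃, h₄, hA' _ _ l₁ (h.symm.le_of_comp (h₃ ▸ h₄ ▸ le_precomp hba q))]

/-- A class of preorders that is closed under sums, contains the discrete preorders, and is closed
under retracts up to a complemented subobject is invariant under isomorphism in the stable
category. -/
theorem of_stab_iso {P : ObjectProperty (PreOrd C)} (hZ : ∀ ⦃A⦄, isTriv C A → P A)
    (hP : ∀ ⦃A A' B : PreOrd C⦄ ⦃α : A ⟶ B⦄ ⦃β : A' ⟶ B⦄, IsComplement α β → P A → P A' → P B)
    (hR : ∀ ⦃A B E B' : PreOrd C⦄ (i : A ⟶ B) (r : B ⟶ E) ⦃α : A ⟶ E⦄ ⦃β : B' ⟶ E⦄,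
      IsComplement α β → i ≫ r = α → P B → P A)
    {A B : PreOrd C} (e : (sigma C).obj A ≅ (sigma C).obj B) (hA : P A) : P B := by
  obtain ⟨r, hr⟩ := exists_comp_sigma_toAddPoint e.hom
  obtain ⟨i, hi⟩ := exists_comp_sigma_toAddPoint e.inv
  have key : (sigma C).map (i ≫ addPointExt r) = (sigma C).map (toAddPoint B) := by
    rw [Functor.map_comp, ← hi, Category.assoc, ← Functor.map_comp, sumInl_desc, ← hr,
      e.inv_hom_id_assoc]
  rw [sigma_map_eq_iff] at key
  obtain ⟨B₀, B₁, α, β, h, e₀, -, t⟩ := key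
  have := h.mono_right
  have t' : isTriv C B₁ := isTriv_of_isTrivial_mono β (isTrivial_of_comp_mono (toAddPoint B) t)
  refine hP h (hR (α ≫ i) (addPointExt r) ((isComplement_addPoint B).assoc h) ?_
    (hP (isComplement_addPoint A) hA (hZ (isTriv_disc _)))) (hZ t')
  rw [Category.assoc, e₀]

theorem isEq_of_stab_iso {A B : PreOrd C} (e : (sigma C).obj A ≅ (sigma C).obj B)
    (hA : isEq C A) : isEq C B := by
  refine of_stab_iso (fun _ h => h.1) (fun _ _ _ _ _ h => h.isEq) ?_ e hA
  rintro A B E B' i r _ β h rfl hB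
  rw [isEq_iff] at hB ⊢
  intro W a b hab
  exact h.le_of_comp (by simpa using le_comp r (hB _ _ (le_comp i hab)))

theorem isPar_of_stab_iso {A B : PreOrd C} (e : (sigma C).obj A ≅ (sigma C).obj B)
    (hA : isPar C A) : isPar C B := by
  refine of_stab_iso (fun _ h => h.2) (fun _ _ _ _ _ h => h.isPar) ?_ e hA
  rintro A B E B' i r _ β h rfl hB W a b hab hba
  have := mono_base _ h.mono_left
  rw [← cancel_mono (base (i ≫ r))]
  simpa using hB _ _ (le_comp i hab) (le_comp i hba) =≫ base r

instance : (stabEq C).IsClosedUnderIsomorphisms :=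
  ⟨fun {A B} e hA => isEq_of_stab_iso (A := A.as.obj) (B := B.as.obj) e hA⟩

instance : (stabPar C).IsClosedUnderIsomorphisms :=
  ⟨fun {A B} e hA => isPar_of_stab_iso (A := A.as.obj) (B := B.as.obj) e hA⟩

theorem isTrivial_of_stabEq_of_stabPar {A B : Stab C} (φ : A ⟶ B) (hA : stabEq C A)
    (hB : stabPar C B) : IsTrivial (zeroObjects (Stab C)) φ := by
  obtain ⟨A, rfl⟩ := exists_eq_sigma_obj A
  obtain ⟨B, rfl⟩ := exists_eq_sigma_obj B
  obtain ⟨f, hf⟩ := exists_comp_sigma_toAddPoint φ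
  refine IsTrivial.of_comp_isIso (e := (sigma C).map (toAddPoint B)) ?_
  rw [hf, isTrivial_sigma_map_iff]
  exact isTrivial_of_isEq_of_isPar f hA
    ((isComplement_addPoint B).isPar hB (isTriv_disc (⊤_ C)).2)

theorem isTorsionTheory_stab (h : IsPretorsionTheory (isEq C) (isPar C)) :
    IsTorsionTheory (stabEq C) (stabPar C) where
  pointed := inferInstance
  replete_left := inferInstance
  replete_right := inferInstance
  zero _ _ φ hA hB := isTrivial_of_stabEq_of_stabPar φ hA hB
  exact A := by
    obtain ⟨T, F, f, g, hT, hF, hfg⟩ := h.exact A.as.obj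
    exact ⟨_, _, (sigma C).map f, (sigma C).map g, hT, hF, hfg.sigma_map⟩

theorem isTorsionTheoryFunctor_sigma :
    IsTorsionTheoryFunctor (isEq C) (isPar C) (stabEq C) (stabPar C) (sigma C) where
  map_left _ h := h
  map_right _ h := h
  map_exact _ _ _ _ _ _ _ h := h.sigma_map

end StableExactness

/-! ### Relations on generalized elements -/

section Relations

variable {C : Type u} [Category.{v} C]

/-- The generalized elements `a` and `b` are related by the relation spanned by `r₁` and `r₂`. -/
def Related {R A : C} (r₁ r₂ : R ⟶ A) {W : C} (a b : W ⟶ A) : Prop :=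
  ∃ t : W ⟶ R, t ≫ r₁ = a ∧ t ≫ r₂ = b

/-- The relation spanned by `r₁` and `r₂` is transitive, in terms of generalized elements. -/
def IsTransRel {R A : C} (r₁ r₂ : R ⟶ A) : Prop :=
  ∀ ⦃W : C⦄ (a b c : W ⟶ A), Related r₁ r₂ a b → Related r₁ r₂ b c → Related r₁ r₂ a c

variable {R A : C} {r₁ r₂ : R ⟶ A}

theorem related_self (r₁ r₂ : R ⟶ A) : Related r₁ r₂ r₁ r₂ :=
  ⟨𝟙 R, Category.id_comp _, Category.id_comp _⟩

theorem Related.precomp {V W : C} {a b : W ⟶ A} (h : Related r₁ r₂ a b) (e : V ⟶ W) :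
    Related r₁ r₂ (e ≫ a) (e ≫ b) := by
  obtain ⟨t, rfl, rfl⟩ := h
  exact ⟨e ≫ t, Category.assoc _ _ _, Category.assoc _ _ _⟩

theorem related_swap {W : C} {a b : W ⟶ A} : Related r₂ r₁ a b ↔ Related r₁ r₂ b a :=
  exists_congr fun _ => and_comm

/-- Being related is a local property, with respect to regular epimorphisms. -/
theorem related_of_cover (hr : JointlyMono₂ r₁ r₂) {V W : C} (e : V ⟶ W) [he : IsRegularEpi e]
    {a b : W ⟶ A} (h : Related r₁ r₂ (e ≫ a) (e ≫ b)) : Related r₁ r₂ a b := by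
  obtain ⟨t, h₁, h₂⟩ := h
  obtain ⟨⟨E⟩⟩ := he
  have w : E.left ≫ t = E.right ≫ t := hr.right_cancellation _ _
    (by rw [Category.assoc, Category.assoc, h₁, ← Category.assoc, E.w, Category.assoc])
    (by rw [Category.assoc, Category.assoc, h₂, ← Category.assoc, E.w, Category.assoc])
  obtain ⟨s, hs⟩ := Cofork.IsColimit.desc' E.isColimit t w
  have hs : e ≫ s = t := hs
  have := E.epi
  refine ⟨s, ?_, ?_⟩
  · rw [← cancel_epi e, reassoc_of% hs, h₁]
  · rw [← cancel_epi e, reassoc_of% hs, h₂]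

theorem isTransRel_of_transitiveRelation (e : TransitiveRelation r₁ r₂) : IsTransRel r₁ r₂ := by
  rintro W _ _ _ ⟨s, rfl, rfl⟩ ⟨t, ht, rfl⟩
  refine ⟨PullbackCone.IsLimit.lift e.isLimit s t ht.symm ≫ e.t, ?_, ?_⟩
  · rw [Category.assoc, e.transitivity₁, PullbackCone.IsLimit.lift_fst_assoc]
  · rw [Category.assoc, e.transitivity₂, PullbackCone.IsLimit.lift_snd_assoc]

section

variable [HasPullbacks C]

theorem nonempty_transitiveRelation (hr : JointlyMono₂ r₁ r₂) (h : IsTransRel r₁ r₂) :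
    Nonempty (TransitiveRelation r₁ r₂) := by
  obtain ⟨m, h₁, h₂⟩ := h _ _ _ ⟨pullback.fst r₂ r₁, rfl, rfl⟩
    ⟨pullback.snd r₂ r₁, pullback.condition.symm, rfl⟩
  exact ⟨{ right_cancellation := hr.right_cancellation, c := pullback.cone r₂ r₁,
           isLimit := pullback.isLimit r₂ r₁, t := m, transitivity₁ := h₁,
           transitivity₂ := h₂ }⟩

/-- The preorder given by a reflexive and transitive relation on generalized elements. -/
noncomputable abbrev ofRelated (r₁ r₂ : R ⟶ A) (hr : JointlyMono₂ r₁ r₂)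
    (refl : Related r₁ r₂ (𝟙 A) (𝟙 A)) (trans : IsTransRel r₁ r₂) : PreOrd C :=
  ofLe r₁ r₂ hr.right_cancellation refl
    (fun _ s t h => trans _ (s ≫ r₂) _ ⟨s, rfl, rfl⟩ ⟨t, h.symm, rfl⟩)

theorem jointlyMono₂_pullback {B : C} (f : A ⟶ B) :
    JointlyMono₂ (pullback.fst f f) (pullback.snd f f) :=
  ⟨fun _ _ _ => pullback.hom_ext⟩

theorem related_pullback_iff {B W : C} (f : A ⟶ B) {a b : W ⟶ A} :
    Related (pullback.fst f f) (pullback.snd f f) a b ↔ a ≫ f = b ≫ f := by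
  constructor
  · rintro ⟨t, rfl, rfl⟩
    rw [Category.assoc, Category.assoc, pullback.condition]
  · exact fun h => ⟨pullback.lift a b h, pullback.lift_fst _ _ _, pullback.lift_snd _ _ _⟩

end

section

variable [HasFiniteLimits C]

/-- The intersection of two relations. -/
theorem exists_related_iff_and {R' : C} {r₁' r₂' : R' ⟶ A} (hr : JointlyMono₂ r₁ r₂)
    (hr' : JointlyMono₂ r₁' r₂') : ∃ (N : C) (n₁ n₂ : N ⟶ A), JointlyMono₂ n₁ n₂ ∧
      ∀ ⦃W : C⦄ (a b : W ⟶ A), Related n₁ n₂ a b ↔ Related r₁ r₂ a b ∧ Related r₁' r₂' a b := by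
  have w : pullback.fst (prod.lift r₁ r₂) (prod.lift r₁' r₂') ≫ prod.lift r₁ r₂ =
    pullback.snd (prod.lift r₁ r₂) (prod.lift r₁' r₂') ≫ prod.lift r₁' r₂' := pullback.condition
  have w₁ := w =≫ prod.fst
  have w₂ := w =≫ prod.snd
  simp only [Category.assoc, prod.lift_fst, prod.lift_snd] at w₁ w₂
  refine ⟨pullback (prod.lift r₁ r₂) (prod.lift r₁' r₂'), pullback.fst _ _ ≫ r₁,
    pullback.fst _ _ ≫ r₂, ⟨fun W x y h₁ h₂ => pullback.hom_ext ?_ ?_⟩, fun W a b => ⟨?_, ?_⟩⟩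
  · exact hr.right_cancellation _ _ (by simpa using h₁) (by simpa using h₂)
  · rw [w₁] at h₁
    rw [w₂] at h₂
    exact hr'.right_cancellation _ _ (by simpa using h₁) (by simpa using h₂)
  · rintro ⟨t, rfl, rfl⟩
    exact ⟨⟨t ≫ pullback.fst _ _, by simp, by simp⟩,
      ⟨t ≫ pullback.snd _ _, by simp [w₁], by simp [w₂]⟩⟩
  · rintro ⟨⟨s, rfl, rfl⟩, ⟨t, h₁, h₂⟩⟩
    refine ⟨pullback.lift s t ?_, ?_, ?_⟩
    · apply Limits.prod.hom_ext <;> simp [h₁, h₂]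
    · rw [pullback.lift_fst_assoc]
    · rw [pullback.lift_fst_assoc]

/-- The inverse image of a relation. -/
theorem exists_related_iff_comp {B : C} (m : B ⟶ A) (hr : JointlyMono₂ r₁ r₂) :
    ∃ (N : C) (n₁ n₂ : N ⟶ B), JointlyMono₂ n₁ n₂ ∧
      ∀ ⦃W : C⦄ (a b : W ⟶ B), Related n₁ n₂ a b ↔ Related r₁ r₂ (a ≫ m) (b ≫ m) := by
  have w : pullback.fst (prod.lift r₁ r₂) (prod.map m m) ≫ prod.lift r₁ r₂ =
    pullback.snd (prod.lift r₁ r₂) (prod.map m m) ≫ prod.map m m := pullback.condition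
  have w₁ := w =≫ prod.fst
  have w₂ := w =≫ prod.snd
  simp only [Category.assoc, prod.lift_fst, prod.lift_snd, prod.map_fst, prod.map_snd] at w₁ w₂
  refine ⟨pullback (prod.lift r₁ r₂) (prod.map m m), pullback.snd _ _ ≫ prod.fst,
    pullback.snd _ _ ≫ prod.snd, ⟨fun W x y h₁ h₂ => pullback.hom_ext ?_ ?_⟩,
    fun W a b => ⟨?_, ?_⟩⟩
  · refine hr.right_cancellation _ _ ?_ ?_
    · simpa [w₁] using h₁ =≫ m
    · simpa [w₂] using h₂ =≫ m
  · apply Limits.prod.hom_ext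
    · simpa using h₁
    · simpa using h₂
  · rintro ⟨t, rfl, rfl⟩
    exact ⟨t ≫ pullback.fst _ _, by simp [w₁], by simp [w₂]⟩
  · rintro ⟨t, h₁, h₂⟩
    refine ⟨pullback.lift t (prod.lift a b) ?_, ?_, ?_⟩
    · apply Limits.prod.hom_ext <;> simp [h₁, h₂]
    · rw [pullback.lift_snd_assoc, prod.lift_fst]
    · rw [pullback.lift_snd_assoc, prod.lift_snd]

theorem factors_iff_related (S : Subobject (A ⨯ A)) {W : C} (a b : W ⟶ A) :
    S.Factors (prod.lift a b) ↔ Related (S.arrow ≫ prod.fst) (S.arrow ≫ prod.snd) a b := by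
  constructor
  · intro h
    exact ⟨S.factorThru _ h, by rw [Subobject.factorThru_arrow_assoc, prod.lift_fst],
      by rw [Subobject.factorThru_arrow_assoc, prod.lift_snd]⟩
  · rintro ⟨t, rfl, rfl⟩
    refine (S.factors_iff _).2 ⟨t, ?_⟩
    apply Limits.prod.hom_ext
    · exact (Category.assoc _ _ _).trans (prod.lift_fst _ _).symm
    · exact (Category.assoc _ _ _).trans (prod.lift_snd _ _).symm

theorem jointlyMono₂_arrow (S : Subobject (A ⨯ A)) :
    JointlyMono₂ (S.arrow ≫ prod.fst) (S.arrow ≫ prod.snd) :=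
  ⟨fun W a b h₁ h₂ => by
    rw [← cancel_mono S.arrow]
    apply Limits.prod.hom_ext <;> simpa⟩

theorem relIsTransitive_iff (S : Subobject (A ⨯ A)) :
    RelIsTransitive S ↔ IsTransRel (S.arrow ≫ prod.fst) (S.arrow ≫ prod.snd) :=
  ⟨fun ⟨e⟩ => isTransRel_of_transitiveRelation e,
    nonempty_transitiveRelation (jointlyMono₂_arrow S)⟩

/-- The subobject given by a relation. -/
theorem exists_subobject_related (hr : JointlyMono₂ r₁ r₂) : ∃ S : Subobject (A ⨯ A),
    ∀ ⦃W : C⦄ (a b : W ⟶ A),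
      Related (S.arrow ≫ prod.fst) (S.arrow ≫ prod.snd) a b ↔ Related r₁ r₂ a b := by
  have : Mono (prod.lift r₁ r₂) := ⟨fun x y h => hr.right_cancellation _ _
    (by simpa [prod.lift_fst] using h =≫ prod.fst)
    (by simpa [prod.lift_snd] using h =≫ prod.snd)⟩
  refine ⟨Subobject.mk (prod.lift r₁ r₂), fun W a b => ?_⟩
  rw [← factors_iff_related, Subobject.mk_factors_iff]
  constructor
  · intro h
    obtain ⟨t, ht⟩ : ∃ t : W ⟶ R, t ≫ prod.lift r₁ r₂ = prod.lift a b := h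
    exact ⟨t, by simpa [prod.lift_fst] using ht =≫ prod.fst,
      by simpa [prod.lift_snd] using ht =≫ prod.snd⟩
  · rintro ⟨t, rfl, rfl⟩
    refine ⟨t, ?_⟩
    change t ≫ prod.lift r₁ r₂ = _
    apply Limits.prod.hom_ext <;> simp

end

/-- The transitive relation generated by a span. -/
theorem exists_transClosure [TauPretopos C] (s₁ s₂ : R ⟶ A) :
    ∃ (T : C) (t₁ t₂ : T ⟶ A), JointlyMono₂ t₁ t₂ ∧ IsTransRel t₁ t₂ ∧ Related t₁ t₂ s₁ s₂ ∧
      ∀ ⦃U : C⦄ (u₁ u₂ : U ⟶ A), JointlyMono₂ u₁ u₂ → IsTransRel u₁ u₂ → Related u₁ u₂ s₁ s₂ →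
        ∀ ⦃W : C⦄ (a b : W ⟶ A), Related t₁ t₂ a b → Related u₁ u₂ a b := by
  obtain ⟨T, ⟨h₁, h₂⟩, hT⟩ :=
    TauPretopos.transitiveClosure (imageSubobject (prod.lift s₁ s₂))
  refine ⟨_, T.arrow ≫ prod.fst, T.arrow ≫ prod.snd, jointlyMono₂_arrow T,
    (relIsTransitive_iff T).1 h₂, ?_, fun U u₁ u₂ hu hu' hs W a b hab => ?_⟩
  · rw [← factors_iff_related]
    refine Subobject.factors_of_le _ h₁ ((Subobject.factors_iff _ _).2 ⟨?_, ?_⟩)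
    · exact factorThruImageSubobject (prod.lift s₁ s₂)
    · exact imageSubobject_arrow_comp _
  · obtain ⟨S, hS⟩ := exists_subobject_related hu
    have hS' : RelIsTransitive S := by
      rw [relIsTransitive_iff]
      intro W a b c
      rw [hS, hS, hS]
      exact hu' a b c
    rw [← hS, ← factors_iff_related] at hs ⊢
    rw [← factors_iff_related] at hab
    refine Subobject.factors_of_le _ (hT ⟨?_, hS'⟩) hab
    exact imageSubobject_le _ (S.factorThru _ hs) (S.factorThru_arrow _ hs)

/-- The quotient by an equivalence relation. -/
theorem exists_quotient [Pretopos C] (hr : JointlyMono₂ r₁ r₂)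
    (refl : Related r₁ r₂ (𝟙 A) (𝟙 A))
    (symm : Related r₁ r₂ r₂ r₁) (trans : IsTransRel r₁ r₂) :
    ∃ (Q : C) (q : A ⟶ Q), IsRegularEpi q ∧
      (∀ ⦃W : C⦄ (a b : W ⟶ A), a ≫ q = b ≫ q ↔ Related r₁ r₂ a b) ∧
      ∀ ⦃Y : C⦄ (l : A ⟶ Y), r₁ ≫ l = r₂ ≫ l → ∃ m : Q ⟶ Y, q ≫ m = l := by
  obtain ⟨t⟩ := nonempty_transitiveRelation hr trans
  obtain ⟨r, hr₁, hr₂⟩ := refl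
  obtain ⟨s, hs₁, hs₂⟩ := symm
  have hE : IsEquivalenceRelation r₁ r₂ := ⟨⟨
    { t with
      r := r
      reflexivity₁ := hr₁
      reflexivity₂ := hr₂
      s := s
      symmetry₁ := hs₁
      symmetry₂ := hs₂ }⟩⟩
  obtain ⟨⟨E⟩⟩ := Pretopos.effective r₁ r₂ hE
  refine ⟨E.B, E.π, inferInstance, fun W a b => ⟨fun h => ?_, ?_⟩, fun Y l h => ?_⟩
  · exact ⟨E.isKernelPair.lift a b h, E.isKernelPair.lift_fst _ _ _,
      E.isKernelPair.lift_snd _ _ _⟩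
  · rintro ⟨t, rfl, rfl⟩
    rw [Category.assoc, Category.assoc, E.isKernelPair.w]
  · exact ⟨E.isPushout.desc l l h, E.isPushout.inl_desc _ _ _⟩

theorem exists_cover [Regular C] {Q W : C} (q : A ⟶ Q) [IsRegularEpi q] (x : W ⟶ Q) :
    ∃ (V : C) (e : V ⟶ W) (a : V ⟶ A), IsRegularEpi e ∧ a ≫ q = e ≫ x :=
  ⟨_, pullback.snd q x, pullback.fst q x, inferInstance, pullback.condition⟩

/-- The image of a span: the relation that consists of the pairs that are locally the image of an
element of the span. -/
theorem exists_image [Regular C] (s₁ s₂ : R ⟶ A) :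
    ∃ (I : C) (i₁ i₂ : I ⟶ A), JointlyMono₂ i₁ i₂ ∧ Related i₁ i₂ s₁ s₂ ∧
      ∀ ⦃W : C⦄ (a b : W ⟶ A), Related i₁ i₂ a b → ∃ (V : C) (e : V ⟶ W) (s : V ⟶ R),
        IsRegularEpi e ∧ s ≫ s₁ = e ≫ a ∧ s ≫ s₂ = e ≫ b := by
  let F := Regular.strongEpiMonoFactorisation (prod.lift s₁ s₂)
  have hF : F.e ≫ F.m = prod.lift s₁ s₂ := F.fac
  refine ⟨F.I, F.m ≫ prod.fst, F.m ≫ prod.snd, ⟨fun W x y h₁ h₂ => ?_⟩, ⟨F.e, ?_, ?_⟩, ?_⟩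
  · rw [← cancel_mono F.m]
    apply Limits.prod.hom_ext <;> simpa
  · rw [reassoc_of% hF, prod.lift_fst]
  · rw [reassoc_of% hF, prod.lift_snd]
  · rintro W _ _ ⟨t, rfl, rfl⟩
    obtain ⟨V, e, s, he, hs⟩ := exists_cover F.e t
    refine ⟨V, e, s, he, ?_, ?_⟩
    · rw [← reassoc_of% hs, reassoc_of% hF, prod.lift_fst]
    · rw [← reassoc_of% hs, reassoc_of% hF, prod.lift_snd]

end Relations

/-! ### Relative kernels and cokernels of preorders -/

section KernelsAndCokernels

variable {C : Type u} [Category.{v} C]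

/-- The relative kernel of `f`: the elements of `A`, ordered by `a ≤ b` and `f a = f b`. -/
noncomputable def kernelPreOrd [HasFiniteLimits C] {A B : PreOrd C} (f : A ⟶ B) : PreOrd C :=
  ofLe (equalizer.ι (A.r₁ ≫ base f) (A.r₂ ≫ base f) ≫ A.r₁)
    (equalizer.ι (A.r₁ ≫ base f) (A.r₂ ≫ base f) ≫ A.r₂)
    (fun W x y h₁ h₂ => equalizer.hom_ext (A.rel_ext (by simpa using h₁) (by simpa using h₂)))
    (by
      obtain ⟨r, h₁, h₂⟩ := A.le_refl (𝟙 _)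
      exact ⟨equalizer.lift r (by rw [reassoc_of% h₁, reassoc_of% h₂]),
        by simp [h₁], by simp [h₂]⟩)
    (fun W s t h => by
      obtain ⟨m, h₁, h₂⟩ := A.le_trans ⟨s ≫ equalizer.ι _ _, rfl, rfl⟩
        ⟨t ≫ equalizer.ι _ _, (by simpa using h.symm), rfl⟩
      have w : m ≫ A.r₁ ≫ base f = m ≫ A.r₂ ≫ base f := by
        rw [reassoc_of% h₁, reassoc_of% h₂, equalizer.condition, reassoc_of% h,
          equalizer.condition]
      exact ⟨equalizer.lift m w, by simp [h₁], by simp [h₂]⟩)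

theorem kernelPreOrd_le_iff [HasFiniteLimits C] {A B : PreOrd C} (f : A ⟶ B) {W : C}
    {a b : W ⟶ A.carrier} :
    (kernelPreOrd f).Le a b ↔ A.Le a b ∧ a ≫ base f = b ≫ base f := by
  constructor
  · intro h
    obtain ⟨t, rfl, rfl⟩ : ∃ t : W ⟶ equalizer (A.r₁ ≫ base f) (A.r₂ ≫ base f),
      t ≫ equalizer.ι _ _ ≫ A.r₁ = a ∧ t ≫ equalizer.ι _ _ ≫ A.r₂ = b := h
    refine ⟨⟨t ≫ equalizer.ι _ _, Category.assoc _ _ _, Category.assoc _ _ _⟩, ?_⟩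
    simp only [Category.assoc]
    rw [equalizer.condition]
  · rintro ⟨⟨t, rfl, rfl⟩, h⟩
    refine ⟨equalizer.lift t (by simpa using h), ?_, ?_⟩
    · exact equalizer.lift_ι_assoc _ _ _
    · exact equalizer.lift_ι_assoc _ _ _

/-- The inclusion of the relative kernel. -/
noncomputable def kernelι [HasFiniteLimits C] {A B : PreOrd C} (f : A ⟶ B) :
    kernelPreOrd f ⟶ A :=
  Hom.mk (𝟙 A.carrier) (equalizer.ι _ _) (Category.comp_id _) (Category.comp_id _)

theorem isKernelRel_kernelι [HasFiniteLimits C] {A B : PreOrd C} (f : A ⟶ B) :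
    IsKernelRel (isTriv C) (kernelι f) f := by
  have : Mono (kernelι f) := mono_of_base _ (inferInstanceAs (Mono (𝟙 A.carrier)))
  refine .of_mono ?_ fun Y l hl => ?_
  · rw [isTrivial_iff]
    have := ((kernelPreOrd_le_iff f).1 (kernelPreOrd f).le_r).2
    have hι : base (kernelι f ≫ f) = base f := Category.id_comp _
    rwa [hι]
  · rw [isTrivial_iff] at hl
    have hl : (Y.r₁ ≫ base l) ≫ base f = (Y.r₂ ≫ base l) ≫ base f := by simpa using hl
    exact ⟨homOfLe (B := kernelPreOrd f) (base (B := A) l) ((kernelPreOrd_le_iff f).2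
      ⟨le_comp l Y.le_r, hl⟩), PreOrd.hom_ext (Category.comp_id _)⟩

/-- A relative cokernel of `f` is obtained by identifying the images of comparable elements, and
taking the preorder generated by the image of the preorder of the codomain. -/
theorem exists_isCokernelRel [TauPretopos C] {A B : PreOrd C} (f : A ⟶ B) :
    ∃ (Q : PreOrd C) (q : B ⟶ Q), IsCokernelRel (isTriv C) q f := by
  -- the equivalence relation generated by the pairs `(f a, f a')` with `a ≤ a'`
  obtain ⟨T, t₁, t₂, hT, trans, hs, hmin⟩ := exists_transClosure
    (coprod.desc (coprod.desc (A.r₁ ≫ base f) (A.r₂ ≫ base f)) (𝟙 B.carrier))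
    (coprod.desc (coprod.desc (A.r₂ ≫ base f) (A.r₁ ≫ base f)) (𝟙 B.carrier))
  have hrefl : Related t₁ t₂ (𝟙 B.carrier) (𝟙 B.carrier) := by
    simpa [coprod.inl_desc, coprod.inr_desc] using hs.precomp coprod.inr
  have hf : Related t₁ t₂ (A.r₁ ≫ base f) (A.r₂ ≫ base f) := by
    simpa [coprod.inl_desc, coprod.inr_desc] using hs.precomp (coprod.inl ≫ coprod.inl)
  have hf' : Related t₁ t₂ (A.r₂ ≫ base f) (A.r₁ ≫ base f) := by
    simpa [coprod.inl_desc, coprod.inr_desc] using hs.precomp (coprod.inr ≫ coprod.inl)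
  have hsymm : Related t₁ t₂ t₂ t₁ := by
    refine related_swap.1 (hmin t₂ t₁ ⟨fun W x y h₁ h₂ => hT.right_cancellation x y h₂ h₁⟩
      (fun W a b c hab hbc => ?_) ?_ _ _ (related_self t₁ t₂))
    · rw [related_swap] at *
      exact trans _ _ _ hbc hab
    · obtain ⟨r, h₁, h₂⟩ := hrefl
      obtain ⟨s, h₃, h₄⟩ := hf
      obtain ⟨s', h₅, h₆⟩ := hf'
      refine ⟨coprod.desc (coprod.desc s' s) r, ?_, ?_⟩ <;>
        apply coprod.hom_ext <;> [apply coprod.hom_ext; skip; apply coprod.hom_ext; skip] <;>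
        simp [coprod.inl_desc, coprod.inr_desc, h₁, h₂, h₃, h₄, h₅, h₆]
  obtain ⟨Q, q, hq, hker, hdesc⟩ := exists_quotient hT hrefl hsymm trans
  obtain ⟨S, s₁, s₂, hS, trans', hB, hmin'⟩ := exists_transClosure (B.r₁ ≫ q) (B.r₂ ≫ q)
  have hrefl' : Related s₁ s₂ (𝟙 Q) (𝟙 Q) := by
    obtain ⟨r, h₁, h₂⟩ := B.le_refl (𝟙 _)
    refine related_of_cover hS q ?_
    simpa [reassoc_of% h₁, reassoc_of% h₂] using hB.precomp r
  let Q' : PreOrd C := ofRelated s₁ s₂ hS hrefl' trans'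
  let q' : B ⟶ Q' := homOfLe (B := Q') q hB
  have : Epi q := inferInstance
  have : Epi q' := ⟨fun x y e => PreOrd.hom_ext ((cancel_epi q).1 (base_eq e))⟩
  refine ⟨Q', q', .of_epi ?_ fun Y l hl => ?_⟩
  · rw [isTrivial_iff]
    have := (hker _ _).2 hf
    rw [Category.assoc, Category.assoc] at this
    exact this
  · rw [isTrivial_iff] at hl
    have hl : A.r₁ ≫ base f ≫ base l = A.r₂ ≫ base f ≫ base l := hl
    obtain ⟨m, hm⟩ := hdesc (base l) (by
      rw [← related_pullback_iff]
      refine hmin _ _ (jointlyMono₂_pullback _) (fun W a b c => ?_) ?_ _ _ (related_self _ _)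
      · simp only [related_pullback_iff]
        exact Eq.trans
      · rw [related_pullback_iff]
        apply coprod.hom_ext <;> [apply coprod.hom_ext; skip] <;>
          simp [coprod.inl_desc, coprod.inr_desc, hl])
    obtain ⟨U, u₁, u₂, hU, hU'⟩ := exists_related_iff_comp m Y.mono
    have hm' : Y.Le (s₁ ≫ m) (s₂ ≫ m) := by
      refine (hU' _ _).1 (hmin' _ _ hU (fun W a b c => ?_) ?_ _ _ (related_self _ _))
      · simp only [hU']
        exact Y.le_trans
      · rw [hU', Category.assoc, Category.assoc, hm]
        exact le_comp l B.le_r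
    exact ⟨homOfLe (A := Q') m hm', PreOrd.hom_ext hm⟩

/-! ### The pretorsion theory of equivalence relations and partial orders -/

/-- The partially ordered reflection of a preorder `A`: the quotient of `A` by the equivalence
relation `a ≤ b ≤ a`, ordered by the image of the preorder.  The inverse image of this order along
the quotient map is the preorder of `A`. -/
theorem exists_isShortExactRel [Pretopos C] (A : PreOrd C) :
    ∃ (F : PreOrd C) (q : A ⟶ F), isEq C (kernelPreOrd q) ∧ isPar C F ∧
      IsShortExactRel (isTriv C) (kernelι q) q := by
  obtain ⟨T, t₁, t₂, hT, hiff⟩ := exists_related_iff_and A.mono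
    (⟨fun W x y h₁ h₂ => A.mono.right_cancellation x y h₂ h₁⟩ : JointlyMono₂ A.r₂ A.r₁)
  have hiff {W : C} (a b : W ⟶ A.carrier) : Related t₁ t₂ a b ↔ A.Le a b ∧ A.Le b a :=
    (hiff a b).trans (and_congr_right fun _ => related_swap)
  obtain ⟨Q, q, hq, hker, hdesc⟩ := exists_quotient hT ((hiff _ _).2 ⟨A.le_refl _, A.le_refl _⟩)
    ((hiff _ _).2 ((hiff _ _).1 (related_self t₁ t₂)).symm)
    (fun W a b c hab hbc => by
      rw [hiff] at *
      exact ⟨A.le_trans hab.1 hbc.1, A.le_trans hbc.2 hab.2⟩)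
  have hker {W : C} (a b : W ⟶ A.carrier) : a ≫ q = b ≫ q ↔ A.Le a b ∧ A.Le b a :=
    (hker a b).trans (hiff a b)
  obtain ⟨S, s₁, s₂, hS, hA, hloc⟩ := exists_image (A.r₁ ≫ q) (A.r₂ ≫ q)
  have hle {W : C} {a b : W ⟶ A.carrier} : Related s₁ s₂ (a ≫ q) (b ≫ q) ↔ A.Le a b := by
    constructor
    · intro h
      obtain ⟨V, e, s, he, h₁, h₂⟩ := hloc _ _ h
      simp only [← Category.assoc] at h₁ h₂
      exact related_of_cover A.mono e (A.le_trans ((hker _ _).1 h₁).2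
        (A.le_trans ⟨s, rfl, rfl⟩ ((hker _ _).1 h₂).1))
    · rintro ⟨t, rfl, rfl⟩
      simpa using hA.precomp t
  have trans : IsTransRel s₁ s₂ := by
    intro W x y z hxy hyz
    -- locally, `x`, `y` and `z` are images of elements of `A`
    obtain ⟨V, e, a, he, ha⟩ := exists_cover q x
    refine related_of_cover hS e ?_
    obtain ⟨V', e', b, he', hb⟩ := exists_cover q (e ≫ y)
    refine related_of_cover hS e' ?_
    obtain ⟨V'', e'', c, he'', hc⟩ := exists_cover q (e' ≫ e ≫ z)
    refine related_of_cover hS e'' ?_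
    have hxy := ((hxy.precomp e).precomp e').precomp e''
    have hyz := ((hyz.precomp e).precomp e').precomp e''
    rw [← hb, ← ha, ← Category.assoc, ← Category.assoc, ← Category.assoc, hle] at hxy
    rw [← hb, ← hc, ← Category.assoc, hle] at hyz
    rw [← hc, ← ha, ← Category.assoc, ← Category.assoc, hle]
    exact A.le_trans (by simpa using hxy) hyz
  have hrefl : Related s₁ s₂ (𝟙 Q) (𝟙 Q) := by
    refine related_of_cover hS q ?_
    have := hle.2 (A.le_refl (𝟙 A.carrier))
    rwa [Category.id_comp, ← Category.comp_id q] at this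
  let F : PreOrd C := ofRelated s₁ s₂ hS hrefl trans
  let q' : A ⟶ F := homOfLe (B := F) q hA
  have : Epi q' := ⟨fun x y e => PreOrd.hom_ext ((cancel_epi q).1 (base_eq e))⟩
  refine ⟨F, q', ?_, ?_, isKernelRel_kernelι q', .of_epi (isKernelRel_kernelι q').1
    fun Y l hl => ?_⟩
  · rw [isEq_iff]
    intro W a b hab
    obtain ⟨-, h⟩ := (kernelPreOrd_le_iff q').1 hab
    exact (kernelPreOrd_le_iff q').2 ⟨((hker a b).1 h).2, h.symm⟩
  · intro W x y hxy hyx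
    obtain ⟨V, e, a, he, ha⟩ := exists_cover q x
    obtain ⟨V', e', b, he', hb⟩ := exists_cover q (e ≫ y)
    have ha' : (e' ≫ a) ≫ q = e' ≫ e ≫ x := by rw [Category.assoc, ha]
    have h₁ : Related s₁ s₂ ((e' ≫ a) ≫ q) (b ≫ q) := by
      rw [ha', hb]
      exact (Related.precomp hxy e).precomp e'
    have h₂ : Related s₁ s₂ (b ≫ q) ((e' ≫ a) ≫ q) := by
      rw [ha', hb]
      exact (Related.precomp hyx e).precomp e'
    rw [← cancel_epi e, ← cancel_epi e', ← ha', ← hb]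
    exact (hker _ _).2 ⟨hle.1 h₁, hle.1 h₂⟩
  · rw [isTrivial_iff] at hl
    have hl' {W : C} {a b : W ⟶ A.carrier} (h : (kernelPreOrd q').Le a b) :
        a ≫ base l = b ≫ base l := by
      obtain ⟨t, rfl, rfl⟩ := h
      have hι : base (kernelι q' ≫ l) = base l := Category.id_comp _
      rw [hι] at hl
      exact (Category.assoc _ _ _).trans ((t ≫= hl).trans (Category.assoc _ _ _).symm)
    have h := (hiff _ _).1 (related_self t₁ t₂)
    obtain ⟨m, hm⟩ := hdesc (base l) (hl' ((kernelPreOrd_le_iff q').2 ⟨h.1, (hker _ _).2 h⟩))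
    have hm' : Y.Le (s₁ ≫ m) (s₂ ≫ m) := by
      obtain ⟨V, e, s, he, h₁, h₂⟩ := hloc _ _ (related_self s₁ s₂)
      refine related_of_cover Y.mono e ?_
      rw [← reassoc_of% h₁, ← reassoc_of% h₂, hm]
      exact le_precomp (le_comp l A.le_r) s
    exact ⟨homOfLe (A := F) m hm', PreOrd.hom_ext hm⟩

theorem isPretorsionTheory_preOrd [Pretopos C] : IsPretorsionTheory (isEq C) (isPar C) where
  replete_left := ⟨fun e hA => isEq_of_iso e hA⟩
  replete_right := ⟨fun e hA => isPar_of_iso e hA⟩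
  trivial _ _ f hA hB := isTrivial_of_isEq_of_isPar f hA hB
  exact A := by
    obtain ⟨F, q, hT, hF, h⟩ := exists_isShortExactRel A
    exact ⟨_, F, _, q, hT, hF, h⟩

end KernelsAndCokernels

section General

variable {D : Type u} [Category.{v} D] {Z : ObjectProperty D}

/-! ### Uniqueness of short exact sequences -/

theorem IsCokernelRel.iso_comp {A A' B Q : D} {q : B ⟶ Q} {f : A ⟶ B}
    (h : IsCokernelRel Z q f) (e : A' ⟶ A) [IsIso e] : IsCokernelRel Z q (e ≫ f) := by
  have key {Y : D} (l : B ⟶ Y) : IsTrivial Z ((e ≫ f) ≫ l) ↔ IsTrivial Z (f ≫ l) := by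
    rw [Category.assoc]
    exact ⟨fun h => by simpa using h.comp_left (inv e), fun h => h.comp_left e⟩
  simp only [IsCokernelRel, key]
  exact h

theorem IsShortExactRel.comp_iso {A A' B Q Q' : D} {f : A ⟶ B} {g : B ⟶ Q}
    (h : IsShortExactRel Z f g) (e : A' ⟶ A) [IsIso e] (e' : Q ⟶ Q') [IsIso e'] :
    IsShortExactRel Z (e ≫ f) (g ≫ e') :=
  ⟨(isKernelRel_comp_iso_iff e').2 (h.1.iso_comp e), (h.2.comp_iso e').iso_comp e⟩

/-- The short exact sequence of a (pre)torsion theory at a given object is unique up to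
isomorphism. -/
theorem IsShortExactRel.exists_iso {T F : ObjectProperty D}
    (hZ : ∀ ⦃A B : D⦄ (f : A ⟶ B), T A → F B → IsTrivial Z f) {A T₁ F₁ T₂ F₂ : D} {f₁ : T₁ ⟶ A}
    {g₁ : A ⟶ F₁} {f₂ : T₂ ⟶ A} {g₂ : A ⟶ F₂} (h₁ : IsShortExactRel Z f₁ g₁)
    (h₂ : IsShortExactRel Z f₂ g₂) (hT₁ : T T₁) (hF₁ : F F₁) (hT₂ : T T₂) (hF₂ : F F₂) :
    ∃ (e : T₁ ≅ T₂) (e' : F₂ ≅ F₁), e.hom ≫ f₂ = f₁ ∧ g₂ ≫ e'.hom = g₁ := by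
  have := h₁.1.mono
  have := h₂.1.mono
  have := h₁.2.epi
  have := h₂.2.epi
  obtain ⟨a, ha, -⟩ := h₂.1.2 f₁ (hZ _ hT₁ hF₂)
  obtain ⟨b, hb, -⟩ := h₁.1.2 f₂ (hZ _ hT₂ hF₁)
  obtain ⟨c, hc, -⟩ := h₂.2.2 g₁ (hZ _ hT₂ hF₁)
  obtain ⟨d, hd, -⟩ := h₁.2.2 g₂ (hZ _ hT₁ hF₂)
  exact ⟨⟨a, b, by rw [← cancel_mono f₁]; simp [hb, ha], by rw [← cancel_mono f₂]; simp [hb, ha]⟩,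
    ⟨c, d, by rw [← cancel_epi g₂]; simp [reassoc_of% hc, hd],
      by rw [← cancel_epi g₁]; simp [reassoc_of% hd, hc]⟩, ha, hc⟩

theorem isZero_of_isTrivial_id {A : D} (h : IsTrivial (zeroObjects D) (𝟙 A)) : IsZero A := by
  obtain ⟨W, hW, g, k, e⟩ := h
  exact IsZero.of_iso hW ⟨g, k, e, hW.eq_of_src _ _⟩

theorem IsSum.isIso_left {A B S : D} {i : A ⟶ S} {j : B ⟶ S} (h : IsSum i j) (hB : IsZero B) :
    IsIso i := by
  obtain ⟨d, hd, -⟩ := h.exists_desc (𝟙 A) (hB.to_ A)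
  exact ⟨d, hd, h.hom_ext (by rw [reassoc_of% hd, Category.comp_id]) (hB.eq_of_src _ _)⟩

end General

/-! ### The functor induced on the stable category -/

section Extension

variable {C : Type u} [Category.{v} C] [Pretopos C] {X : Type u'} [Category.{v'} X]
variable (G : PreOrd C ⥤ X) [PreservesFiniteCoproducts G]

variable {G} in
theorem map_eq_of_stablyEq (hG : ∀ A, isTriv C A → IsZero (G.obj A)) {A B : PreOrd C}
    {f g : A ⟶ B} (h : StablyEq f g) : G.map f = G.map g := by
  obtain ⟨A₀, A₁, α, β, h, e, hf, hg⟩ := h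
  refine (h.isSum.map G).hom_ext ?_ ?_
  · rw [← Functor.map_comp, e, Functor.map_comp]
  · rw [← Functor.map_comp, ← Functor.map_comp]
    exact (hf.map hG).eq (hg.map hG)

variable {G} in
theorem isIso_map_toAddPoint (hG : ∀ A, isTriv C A → IsZero (G.obj A)) (B : PreOrd C) :
    IsIso (G.map (toAddPoint B)) :=
  ((isComplement_addPoint B).isSum.map G).isIso_left (hG _ (isTriv_disc _))

variable {G} in
theorem exists_stableExtension_map (hG : ∀ A, isTriv C A → IsZero (G.obj A)) {A B : PreOrd C}
    (φ : (sigma C).obj A ⟶ (sigma C).obj B) : ∃ ψ : G.obj A ⟶ G.obj B, ∀ f : A ⟶ addPoint B,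
      φ ≫ (sigma C).map (toAddPoint B) = (sigma C).map f →
        ψ ≫ G.map (toAddPoint B) = G.map f := by
  have := isIso_map_toAddPoint hG B
  obtain ⟨f, hf⟩ := exists_comp_sigma_toAddPoint φ
  refine ⟨G.map f ≫ inv (G.map (toAddPoint B)), fun g hg => ?_⟩
  rw [Category.assoc, IsIso.inv_hom_id, Category.comp_id]
  exact map_eq_of_stablyEq hG (sigma_map_eq_iff.1 (hf.symm.trans hg))

/-- The value of the induced functor on the fraction `f / toAddPoint B` is the fraction
`G f / G (toAddPoint B)`. -/
noncomputable def stableExtensionMap (hG : ∀ A, isTriv C A → IsZero (G.obj A)) {A B : PreOrd C}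
    (φ : (sigma C).obj A ⟶ (sigma C).obj B) : G.obj A ⟶ G.obj B :=
  (exists_stableExtension_map hG φ).choose

variable {G} in
theorem stableExtensionMap_comp (hG : ∀ A, isTriv C A → IsZero (G.obj A)) {A B : PreOrd C}
    {φ : (sigma C).obj A ⟶ (sigma C).obj B} {f : A ⟶ addPoint B}
    (hf : φ ≫ (sigma C).map (toAddPoint B) = (sigma C).map f) :
    stableExtensionMap G hG φ ≫ G.map (toAddPoint B) = G.map f :=
  (exists_stableExtension_map hG φ).choose_spec f hf

theorem stableExtensionMap_sigma_map (hG : ∀ A, isTriv C A → IsZero (G.obj A)) {A B : PreOrd C}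
    (f : A ⟶ B) : stableExtensionMap G hG ((sigma C).map f) = G.map f := by
  have := isIso_map_toAddPoint hG B
  rw [← cancel_mono (G.map (toAddPoint B)), ← Functor.map_comp]
  exact stableExtensionMap_comp hG (Functor.map_comp _ _ _).symm

theorem stableExtensionMap_comp_comp (hG : ∀ A, isTriv C A → IsZero (G.obj A))
    {A B E : PreOrd C} (φ : (sigma C).obj A ⟶ (sigma C).obj B)
    (ψ : (sigma C).obj B ⟶ (sigma C).obj E) : stableExtensionMap G hG (φ ≫ ψ) =
      stableExtensionMap G hG φ ≫ stableExtensionMap G hG ψ := by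
  have := isIso_map_toAddPoint hG E
  obtain ⟨f, hf⟩ := exists_comp_sigma_toAddPoint φ
  obtain ⟨g, hg⟩ := exists_comp_sigma_toAddPoint ψ
  have h : (φ ≫ ψ) ≫ (sigma C).map (toAddPoint E) = (sigma C).map (f ≫ addPointExt g) := by
    rw [Functor.map_comp, ← hf, Category.assoc, Category.assoc, ← Functor.map_comp, sumInl_desc,
      hg]
  rw [← cancel_mono (G.map (toAddPoint E)), Category.assoc, stableExtensionMap_comp hG h,
    stableExtensionMap_comp hG hg, Functor.map_comp, ← stableExtensionMap_comp hG hf,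
    Category.assoc, ← Functor.map_comp, sumInl_desc]

/-- The functor on the stable category induced by a functor that preserves finite coproducts and
sends trivial preorders to zero objects. -/
noncomputable def stableExtension (hG : ∀ A, isTriv C A → IsZero (G.obj A)) : Stab C ⥤ X where
  obj A := G.obj A.as.obj
  map {A B} φ := stableExtensionMap G hG (A := A.as.obj) (B := B.as.obj) φ
  map_id A := (congrArg _ ((sigma C).map_id A.as.obj).symm).trans
    ((stableExtensionMap_sigma_map G hG (𝟙 A.as.obj)).trans (G.map_id _))
  map_comp {A B E} φ ψ := stableExtensionMap_comp_comp G hG (A := A.as.obj) (B := B.as.obj)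
    (E := E.as.obj) φ ψ

variable (hG : ∀ A, isTriv C A → IsZero (G.obj A))

theorem stableExtension_map_sigma {A B : PreOrd C} (f : A ⟶ B) :
    (stableExtension G hG).map ((sigma C).map f) = G.map f :=
  stableExtensionMap_sigma_map G hG f

theorem sigma_comp_stableExtension : sigma C ⋙ stableExtension G hG = G :=
  Functor.hext (fun _ => rfl) (fun _ _ f => heq_of_eq (stableExtension_map_sigma G hG f))

/-- Morphisms of the stable category are fractions, hence the induced functor is unique. -/
theorem eq_stableExtension (H : Stab C ⥤ X) (hH : sigma C ⋙ H = G) :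
    H = stableExtension G hG := by
  subst hH
  refine Functor.hext (fun _ => rfl) (fun A B φ => heq_of_eq ?_)
  obtain ⟨A, rfl⟩ := exists_eq_sigma_obj A
  obtain ⟨B, rfl⟩ := exists_eq_sigma_obj B
  obtain ⟨f, hf⟩ := exists_comp_sigma_toAddPoint φ
  exact (cancel_mono (H.map ((sigma C).map (toAddPoint B)))).1
    (((H.map_comp _ _).symm.trans (congrArg H.map hf)).trans (stableExtensionMap_comp hG hf).symm)

theorem preservesFiniteCoproducts_stableExtension :
    PreservesFiniteCoproducts (stableExtension G hG) := by
  refine preservesFiniteCoproducts_of_isSum _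
    (sigma_obj_isZero (isTriv_disc (⊤_ C))).isInitial (hG _ (isTriv_disc _)).isInitial
    fun A B => ?_
  obtain ⟨A, rfl⟩ := exists_eq_sigma_obj A
  obtain ⟨B, rfl⟩ := exists_eq_sigma_obj B
  have h := isComplement_sum A B
  refine ⟨_, _, _, h.isSum_sigma, ?_⟩
  rw [stableExtension_map_sigma, stableExtension_map_sigma]
  exact h.isSum.map G

theorem isTorsionTheoryFunctor_stableExtension {T F : ObjectProperty X}
    (hGT : IsTorsionTheoryFunctor (isEq C) (isPar C) T F G) :
    IsTorsionTheoryFunctor (stabEq C) (stabPar C) T F (stableExtension G hG) where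
  map_left A hA := hGT.map_left _ hA
  map_right A hA := hGT.map_right _ hA
  map_exact TA A FA f g hT hF h := by
    rw [stabEq_inf_stabPar] at h
    obtain ⟨A, rfl⟩ := exists_eq_sigma_obj A
    obtain ⟨T', F', k, q, hT', hF', h'⟩ := isPretorsionTheory_preOrd.exact A
    obtain ⟨e, e', rfl, rfl⟩ := h.exists_iso (fun _ _ φ => isTrivial_of_stabEq_of_stabPar φ)
      h'.sigma_map hT hF hT' hF'
    have h₂ : IsShortExactRel (zeroObjects X) ((stableExtension G hG).map ((sigma C).map k))
        ((stableExtension G hG).map ((sigma C).map q)) := by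
      rw [stableExtension_map_sigma, stableExtension_map_sigma]
      exact hGT.map_exact k q hT' hF' h'
    rw [Functor.map_comp, Functor.map_comp]
    exact h₂.comp_iso _ _

theorem sendsKernels_stableExtension (h : SendsKernels (isTriv C) (zeroObjects X) G) :
    SendsKernels (zeroObjects (Stab C)) (zeroObjects X) (stableExtension G hG) := by
  intro K A B k φ hk
  obtain ⟨A, rfl⟩ := exists_eq_sigma_obj A
  obtain ⟨B, rfl⟩ := exists_eq_sigma_obj B
  obtain ⟨f, hf⟩ := exists_comp_sigma_toAddPoint φ
  have h₁ := (isKernelRel_kernelι f).sigma_map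
  rw [← hf, isKernelRel_comp_iso_iff] at h₁
  obtain ⟨e, rfl⟩ := hk.exists_iso h₁
  have h₂ : IsKernelRel (zeroObjects X) ((stableExtension G hG).map ((sigma C).map (kernelι f)))
      ((stableExtension G hG).map ((sigma C).map f)) := by
    rw [stableExtension_map_sigma, stableExtension_map_sigma]
    exact h _ _ (isKernelRel_kernelι f)
  rw [← hf, Functor.map_comp, isKernelRel_comp_iso_iff] at h₂
  rw [Functor.map_comp]
  exact h₂.iso_comp _

end Extension

section ExtensionTau

variable {C : Type u} [Category.{v} C] [TauPretopos C] {X : Type u'} [Category.{v'} X]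
variable (G : PreOrd C ⥤ X) [PreservesFiniteCoproducts G]

theorem sendsCokernels_stableExtension (hG : ∀ A, isTriv C A → IsZero (G.obj A))
    (h : SendsCokernels (isTriv C) (zeroObjects X) G) :
    SendsCokernels (zeroObjects (Stab C)) (zeroObjects X) (stableExtension G hG) := by
  intro A B Q q φ hq
  obtain ⟨A, rfl⟩ := exists_eq_sigma_obj A
  obtain ⟨B, rfl⟩ := exists_eq_sigma_obj B
  obtain ⟨f, hf⟩ := exists_comp_sigma_toAddPoint φ
  obtain ⟨Q', q', hq'⟩ := exists_isCokernelRel f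
  have h₁ := hq'.sigma_map
  rw [← hf] at h₁
  obtain ⟨e, rfl⟩ := h₁.of_comp_iso.exists_iso hq
  have h₂ : IsCokernelRel (zeroObjects X) ((stableExtension G hG).map ((sigma C).map q'))
      ((stableExtension G hG).map ((sigma C).map f)) := by
    rw [stableExtension_map_sigma, stableExtension_map_sigma]
    exact h _ _ hq'
  rw [← hf, Functor.map_comp] at h₂
  rw [Functor.map_comp, Functor.map_comp]
  exact h₂.of_comp_iso.comp_iso _

end ExtensionTau

end StableCategory

theorem mainTheorem2 (C : Type u) [Category.{v} C] [TauPretopos C] :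
    -- `Σ` belongs to the class of functors among which it is universal
    (IsPretorsionTheory (PreOrd.isEq C) (PreOrd.isPar C) ∧
      IsTorsionTheory (stabEq C) (stabPar C) ∧
      (∃ _ : HasBinaryCoproducts (Stab C),
        DisjointCoproducts (Stab C) ∧ PreUniversalCoproducts (Stab C)) ∧
      PreservesFiniteCoproducts (sigma C) ∧
      IsTorsionTheoryFunctor (PreOrd.isEq C) (PreOrd.isPar C) (stabEq C) (stabPar C) (sigma C)) ∧
    -- the universal property
    ∀ (X : Type u') [Category.{v'} X] [HasBinaryCoproducts X],
      DisjointCoproducts X → PreUniversalCoproducts X →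
      ∀ T F : ObjectProperty X, IsTorsionTheory T F →
      ∀ G : PreOrd C ⥤ X, PreservesFiniteCoproducts G →
        IsTorsionTheoryFunctor (PreOrd.isEq C) (PreOrd.isPar C) T F G →
        ∃ Gbar : Stab C ⥤ X,
          sigma C ⋙ Gbar = G ∧
          (∀ H : Stab C ⥤ X, sigma C ⋙ H = G → H = Gbar) ∧
          PreservesFiniteCoproducts Gbar ∧
          IsTorsionTheoryFunctor (stabEq C) (stabPar C) T F Gbar ∧
          (SendsKernels (PreOrd.isTriv C) (zeroObjects X) G →
            SendsCokernels (PreOrd.isTriv C) (zeroObjects X) G →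
            SendsKernels (zeroObjects (Stab C)) (zeroObjects X) Gbar ∧
            SendsCokernels (zeroObjects (Stab C)) (zeroObjects X) Gbar ∧
            SendsShortExact (zeroObjects (Stab C)) (zeroObjects X) Gbar) := by
  refine ⟨⟨isPretorsionTheory_preOrd, isTorsionTheory_stab isPretorsionTheory_preOrd,
    ⟨inferInstance, disjointCoproducts_of_hasZeroObject, preUniversalCoproducts_stab⟩,
    inferInstance, isTorsionTheoryFunctor_sigma⟩, ?_⟩
  intro X _ _ _ _ T F hTF G _ hGT
  -- an object that is both torsion and torsion-free is zero
  have hG : ∀ A, PreOrd.isTriv C A → IsZero (G.obj A) := fun A hA =>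
    isZero_of_isTrivial_id (hTF.zero _ (hGT.map_left A hA.1) (hGT.map_right A hA.2))
  refine ⟨stableExtension G hG, sigma_comp_stableExtension G hG, eq_stableExtension G hG,
    preservesFiniteCoproducts_stableExtension G hG,
    isTorsionTheoryFunctor_stableExtension G hG hGT, fun hk hc => ?_⟩
  have hk' := sendsKernels_stableExtension G hG hk
  have hc' := sendsCokernels_stableExtension G hG hc
  exact ⟨hk', hc', fun A B Q f g h => ⟨hk' f g h.1, hc' g f h.2⟩⟩
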